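/- Fix an integer $p\ge 2$. There is a constant $C>0$ depending only on $p$ such that the following holds for every $n$, all $M_p,R,\varepsilon>0$ and every $x_0\in\mathbb R^n$ (with the Euclidean norm). **Notation.** For a $p$ times differentiable $g$ on $\mathbb R^n$ let $T^{g}_{p,M}(x)$ denote any global minimizer over $y\in\mathbb R^n$ of $\sum_{r=0}^p\frac1{r!}\nabla^r g(x)[y-x,\dots,y-x]+\frac{M}{(p+1)!}\|y-x\|^{p+1}$. *Algorithm 1* applied to $g$ from $z$ for $N$ steps: put $A_0=0$, $y^0=u^0=z$. For $k=0,\dots,N-1$ choose $L_k>0$ such that, with $$a_{k+1}=\tfrac12\Big(\tfrac1{L_k}+\sqrt{\tfrac1{L_k^2}+\tfrac{4A_k}{L_k}}\Big),\quad A_{k+1}=A_k+a_{k+1},\quad x^k=\tfrac{A_k}{A_{k+1}}y^k+\tfrac{a_{k+1}}{A_{k+1}}u^k,\quad y^{k+1}=T^{F}_{p,pM_p}(x^k),\quad F=g+\tfrac{L_k}{2}\|\cdot-x^k\|^2,$$ one has $\frac12\le\frac{2(p+1)M_p}{p!\,L_k}\|y^{k+1}-x^k\|^{p-1}\le1$;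 then put $u^{k+1}=u^k-a_{k+1}\nabla g(y^{k+1})$. Return $y^N$. For an arbitrary value $L>0$ in place of $L_k$ the corresponding point $y^{k+1}$ is called a trial point of this iteration. *Algorithm 3*: put $\mu=\frac{\varepsilon}{4R}$, $f_\mu=f+\frac\mu2\|\cdot-x_0\|^2$, $\tilde\varepsilon=\frac{(\varepsilon/2)^{(p+1)/p}}{8(p+1)!\,(pM_p)^{1/p}}$, $c=2^{(3(p+1)^2+4)/4}\frac{p+1}{p!}$, $z_0=x_0$, $R_k=2^{-k}R$. For $k=0,1,\dots$, as long as $\mu R_k^2/2\ge\tilde\varepsilon$, let $z_{k+1}$ be the output of Algorithm 1 applied to $f_\mu$ from $z_k$ for $N_k=\max\{\lceil(8cM_pR_k^{p-1}/\mu)^{2/(3p+1)}\rceil,1\}$ steps. When the test first fails, at $k=K$, return $\tilde z=T^{f_\mu}_{p,pM_p}(z_K)$. Put $$B=\frac{M_p^{\frac2{3p+1}}R^{\frac{2p}{3p+1}}}{\varepsilon^{\frac2{3p+1}}}+\log^+\frac{2^{\frac{p+1}p}(p+1)!\,(pM_p)^{\frac1p}R}{\varepsilon^{\frac1p}},\qquad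 \log^+t=\max\{0,\log t\}.$$ **Claim.** Let $f:\mathbb R^n\to\mathbb R$ be any convex, $p$ times differentiable function with $M_p$-Lipschitz $p$-th derivative that has a minimizer $x^*$ with $\|x_0-x^*\|\le R$. 1. Every complete execution of Algorithm 3, whatever the admissible choices of the $L_k$, returns $\tilde z$ with $\|\nabla f(\tilde z)\|\le\varepsilon$, and its total number $\sum_{k<K}N_k$ of iterations of Algorithm 1 is at most $C\,B$. 2. There is a deterministic adaptive method, which depends on $n,p,M_p,R,\varepsilon,x_0$ only and accesses $f$ only through an oracle returning $f(x),\nabla f(x),\dots,\nabla^pf(x)$ at a queried point $x$, such that for every such $f$ the method carries out and returns an execution of Algorithm 3 (all iterates and all $L_k$), which is complete, or is stopped during the choice of some $L_k$ because a trial point $w$ of the current iteration satisfies $\|\nabla f(w)\|\le\varepsilon$ (then $w$ is returned). It makes at most $C\,\ln\!\big(2+M_pR^p/\varepsilon\big)\,(1+B)$ oracle calls, i.e. for fixed $p,M_p,R$ the oracle complexity is within a factor $O(\ln\frac1\varepsilon)$ of the iteration complexity as $\varepsilon\to0$. -/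

import Mathlib

open scoped Nat

noncomputable section

/-- The space `ℝⁿ` with the Euclidean norm. -/
abbrev EucSp (n : ℕ) : Type := EuclideanSpace ℝ (Fin n)

/-- `f` is convex and `p` times (continuously) differentiable with `M`-Lipschitz `p`-th derivative,
the norm of `p`-linear forms being the operator norm
(a Lipschitz `p`-th derivative is automatically continuous). -/
structure IsConvexSmooth {n : ℕ} (p : ℕ) (M : ℝ) (f : EucSp n → ℝ) : Prop where
  convex : ConvexOn ℝ Set.univ f
  contDiff : ContDiff ℝ p f
  lipschitz : ∀ x y, ‖iteratedFDeriv ℝ p f x - iteratedFDeriv ℝ p f y‖ ≤ M * ‖x - y‖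

/-- The `p`-th order Taylor polynomial of `f` centred at `x`, evaluated at `y`. -/
def taylorModel {n : ℕ} (p : ℕ) (f : EucSp n → ℝ) (x y : EucSp n) : ℝ :=
  ∑ r ∈ Finset.range (p + 1), 1 / (r ! : ℝ) * iteratedFDeriv ℝ r f x (fun _ => y - x)

/-- `y` is a tensor step `T_{p,M}^f(x)`: a global minimizer of the regularized Taylor model. -/
def IsTensorStep {n : ℕ} (p : ℕ) (M : ℝ) (f : EucSp n → ℝ) (x y : EucSp n) : Prop :=
  IsMinOn (fun w => taylorModel p f x w + M / ((p + 1)! : ℝ) * ‖w - x‖ ^ (p + 1)) Set.univ y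

/-- `F_{L,z}(x) = f(x) + (L/2) ‖x - z‖²`. -/
def quadReg {n : ℕ} (f : EucSp n → ℝ) (L : ℝ) (z : EucSp n) : EucSp n → ℝ :=
  fun x => f x + L / 2 * ‖x - z‖ ^ 2

/-! ### The accelerated tensor method (Algorithm 1) -/

/-- The state `(A_k, y^k, u^k)` between two iterations. -/
structure MSNState (n : ℕ) where
  A : ℝ
  y : EucSp n
  u : EucSp n

namespace MSNState

variable {n : ℕ}

/-- The initial state `A_0 = 0`, `y^0 = u^0 = z`. -/
def start (z : EucSp n) : MSNState n := ⟨0, z, z⟩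

/-- `a_{k+1}` as a function of the current state and of `L_k`. -/
def weight (s : MSNState n) (L : ℝ) : ℝ :=
  (1 / L + √(1 / L ^ 2 + 4 * s.A / L)) / 2

/-- `A_{k+1} = A_k + a_{k+1}`. -/
def nextA (s : MSNState n) (L : ℝ) : ℝ := s.A + s.weight L

/-- `x^k = (A_k / A_{k+1}) y^k + (a_{k+1} / A_{k+1}) u^k`. -/
def extrap (s : MSNState n) (L : ℝ) : EucSp n :=
  (s.A / s.nextA L) • s.y + (s.weight L / s.nextA L) • s.u

/-- `w` is the trial point belonging to the trial value `L` of `L_k`: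
`w = T_{p,pM}^{F_{L,x}}(x)`, where `F_{L,x} = g + (L/2)‖· - x‖²` and `x = x^k` depends on `L`. -/
def IsTrial (p : ℕ) (M : ℝ) (g : EucSp n → ℝ) (s : MSNState n) (L : ℝ) (w : EucSp n) : Prop :=
  0 < L ∧ IsTensorStep p (p * M) (quadReg g L (s.extrap L)) (s.extrap L) w

/-- One iteration of the method on the objective `g`, with the choice `L` of `L_k`. -/
structure IsStep (p : ℕ) (M : ℝ) (g : EucSp n → ℝ) (s : MSNState n) (L : ℝ) (s' : MSNState n) :
    Prop where
  trial : s.IsTrial p M g L s'.y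
  lower : 1 / 2 ≤ 2 * (p + 1) * M / ((p ! : ℝ) * L) * ‖s'.y - s.extrap L‖ ^ (p - 1)
  upper : 2 * (p + 1) * M / ((p ! : ℝ) * L) * ‖s'.y - s.extrap L‖ ^ (p - 1) ≤ 1
  eq_A : s'.A = s.nextA L
  eq_u : s'.u = s.u - s.weight L • gradient g s'.y

end MSNState

/-! ### The restarted method (Algorithm 3) -/

/-- `μ = ε / (4R)`. -/
def regMu (R ε : ℝ) : ℝ := ε / (4 * R)

/-- `ε̃ = (ε/2)^((p+1)/p) / (8 (p+1)! (pM)^(1/p))`. -/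
def tolTilde (p : ℕ) (M ε : ℝ) : ℝ :=
  (ε / 2) ^ (((p : ℝ) + 1) / p) / (8 * ((p + 1)! : ℝ) * ((p : ℝ) * M) ^ (1 / (p : ℝ)))

/-- `R_k = R 2^{-k}`. -/
def radius (R : ℝ) (k : ℕ) : ℝ := R / 2 ^ k

/-- `c = 2^{(3(p+1)²+4)/4} (p+1) / p!`. -/
def rateConst (p : ℕ) : ℝ :=
  2 ^ ((3 * ((p : ℝ) + 1) ^ 2 + 4) / 4) * (p + 1) / (p ! : ℝ)

/-- `N_k = max {⌈(8 c M R_k^{p-1} / μ)^{2/(3p+1)}⌉, 1}`. -/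
def innerCount (p : ℕ) (M R ε : ℝ) (k : ℕ) : ℕ :=
  max ⌈(8 * rateConst p * M * radius R k ^ (p - 1) / regMu R ε) ^ (2 / (3 * (p : ℝ) + 1))⌉₊ 1

/-- The test `μ R_k² / 2 ≥ ε̃` of the while loop. -/
def loopTest (p : ℕ) (M R ε : ℝ) (k : ℕ) : Prop :=
  tolTilde p M ε ≤ regMu R ε * radius R k ^ 2 / 2

/-- The record of an execution, complete or stopped early: `K` is the number of finished restarts,
`J` the number of finished iterations in the restart in progress, `state k j` the state of the
inner method in restart `k` after `j` iterations (so `z_k = (state k 0).y`), `L k j` the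
parameter chosen in that state, and `out` the point returned. -/
structure Execution (n : ℕ) where
  K : ℕ
  J : ℕ
  state : ℕ → ℕ → MSNState n
  L : ℕ → ℕ → ℝ
  out : EucSp n

namespace Execution

variable {n : ℕ}

/-- The first `K` restarts are performed correctly: `z_0 = x₀`, the loop test holds before each of
them, and restart `k` consists of `N_k` iterations of the inner method, applied to `f_μ` and
started at `z_k`; its final `y` is `z_{k+1}`. -/
structure IsRestarts (p : ℕ) (M R ε : ℝ) (f : EucSp n → ℝ) (x₀ : EucSp n) (e : Execution n) :
    Prop where
  init : e.state 0 0 = MSNState.start x₀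
  test : ∀ k < e.K, loopTest p M R ε k
  step : ∀ k < e.K, ∀ j < innerCount p M R ε k,
    (e.state k j).IsStep p M (quadReg f (regMu R ε) x₀) (e.L k j) (e.state k (j + 1))
  next : ∀ k < e.K, e.state (k + 1) 0 = MSNState.start (e.state k (innerCount p M R ε k)).y

/-- A complete execution: the loop test fails after `K` restarts, and the output is one tensor
step `T_{p,pM}^{f_μ}(z_K)`. -/
structure IsComplete (p : ℕ) (M R ε : ℝ) (f : EucSp n → ℝ) (x₀ : EucSp n) (e : Execution n) :
    Prop where
  restarts : e.IsRestarts p M R ε f x₀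
  noExtra : e.J = 0
  exit : ¬ loopTest p M R ε e.K
  final : IsTensorStep p (p * M) (quadReg f (regMu R ε) x₀) (e.state e.K 0).y e.out

/-- An execution stopped while `L_J` is being searched for in the restart number `K`, because
a trial point, which is returned, already satisfies `‖∇f‖ ≤ ε`. -/
structure IsStoppedEarly (p : ℕ) (M R ε : ℝ) (f : EucSp n → ℝ) (x₀ : EucSp n) (e : Execution n) :
    Prop where
  restarts : e.IsRestarts p M R ε f x₀
  test : loopTest p M R ε e.K
  lt : e.J < innerCount p M R ε e.K
  step : ∀ j < e.J,
    (e.state e.K j).IsStep p M (quadReg f (regMu R ε) x₀) (e.L e.K j) (e.state e.K (j + 1))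
  trial : (e.state e.K e.J).IsTrial p M (quadReg f (regMu R ε) x₀) (e.L e.K e.J) e.out
  small : ‖gradient f e.out‖ ≤ ε

/-- The total number of iterations of the inner method. -/
def iterations (p : ℕ) (M R ε : ℝ) (e : Execution n) : ℕ :=
  (∑ k ∈ Finset.range e.K, innerCount p M R ε k) + e.J

end Execution

/-- The iteration complexity
`M^{2/(3p+1)} R^{2p/(3p+1)} / ε^{2/(3p+1)} + log⁺ (2^{(p+1)/p} (p+1)! (pM)^{1/p} R / ε^{1/p})`,
where `log⁺ t = max (0, log t)`. -/
def iterBound (p : ℕ) (M R ε : ℝ) : ℝ :=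
  M ^ (2 / (3 * (p : ℝ) + 1)) * R ^ (2 * (p : ℝ) / (3 * (p : ℝ) + 1))
      / ε ^ (2 / (3 * (p : ℝ) + 1))
    + Real.posLog (2 ^ (((p : ℝ) + 1) / p) * ((p + 1)! : ℝ) * ((p : ℝ) * M) ^ (1 / (p : ℝ)) * R
      / ε ^ (1 / (p : ℝ)))

/-! ### Oracle complexity -/

/-- The answer of the `p`-th order oracle: the value and the derivatives up to order `p`. -/
abbrev Jet (n p : ℕ) : Type := (r : Fin (p + 1)) → (EucSp n) [×(r : ℕ)]→L[ℝ] ℝ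

/-- The `p`-th order oracle of `f`. -/
def jetOracle {n : ℕ} (p : ℕ) (f : EucSp n → ℝ) (x : EucSp n) : Jet n p :=
  fun r => iteratedFDeriv ℝ r f x

/-- A deterministic adaptive method: from the queries made so far and the answers to them it
determines either the next query point or its final result in `α`. -/
structure OracleMethod (n p : ℕ) (α : Type) where
  next : List (EucSp n × Jet n p) → EucSp n ⊕ α

namespace OracleMethod

variable {n p : ℕ} {α : Type}

/-- The list of the first `t` queries (fewer if the method has halted) with their answers. -/
def transcript (m : OracleMethod n p α) (O : EucSp n → Jet n p) : ℕ → List (EucSp n × Jet n p)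
  | 0 => []
  | t + 1 =>
    match m.next (m.transcript O t) with
    | Sum.inl x => m.transcript O t ++ [(x, O x)]
    | Sum.inr _ => m.transcript O t

/-- The method halts with the result `a` after at most `t` oracle calls. -/
def HaltsWithin (m : OracleMethod n p α) (O : EucSp n → Jet n p) (t : ℕ) (a : α) : Prop :=
  m.next (m.transcript O t) = Sum.inr a

end OracleMethod

end

/-! Rate of the inner method. Stationarity of the regularized Taylor model together with the Taylor
remainder bounds the gradient after a tensor step of length `r` by `(p+1) M r^p / p!`
(`IsTensorStep.norm_gradient_le`). The upper half of the condition on `L_k` turns this into an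
inexact proximal step with relative error 1/2, so the energy `A_k (g(y^k) - g(v)) + ‖u^k - v‖² / 2`
drops by at least `3/8 A_{k+1} L_k r_k²` with `r_k = ‖y^{k+1} - x^k‖` (`IsStep.energy_add_le`). The
lower half gives `L_k ≤ κ r_k^{p-1}`. Since the sum of the drops is bounded, Hölder's inequality
forces `A_N` to grow like `N^{(3p+1)/2}` (`large_step_growth`), and `A_N (g(y^N) - g(v)) ≤ D²/2` is
the rate (`IsRun.rate`).

Restarts. `f_μ` is strongly convex and its minimizer lies within `R` of `x₀`. The number `N_k` is
chosen so that the rate and strong convexity halve the guaranteed distance, so the `N_k` decay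
geometrically down to 1 and the number of restarts is logarithmic (`exists_sum_innerCount_le`). On
exit after a restart the gap is below `ε̃`; the decrease achieved by the last tensor step bounds its
length, hence its gradient, by `ε/2`, and the term `μ (x - x₀)` costs the other `ε/2`.

Oracle calls. `L_k` is found by bisection on `[searchLo, searchHi]`. All points stay in a ball of
radius proportional to `R`, so the tested ratio is at most 1/2 at `searchHi`; a ratio at most 1 at
`searchLo` would already give `‖∇f‖ ≤ ε`. Monotonicity of the derivative of the model
(`IsConvexSmooth.model_monotone`) makes trial points quantitatively stable in `L`
(`IsTrial.norm_sub_le`). Hence a ratio at least 1 at `L` and at most 1/2 at `L' > L` keep `L' - L`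
above `searchHi / (C (2 + M R^p/ε)³)` (`exists_searchHi_le`), and a logarithmic number of halvings
must hit `[1/2, 1]`. Monotonicity of the ratio in `L` is never needed. -/

noncomputable section

/-! ### Taylor polynomials of vector-valued maps and their remainders -/

section Taylor

universe u

variable {E : Type u} [NormedAddCommGroup E] [NormedSpace ℝ E]

/-- Symmetry of higher derivatives in the only form needed: one slot differs from the others.
Induction moves `h` past the last slot by Schwarz's theorem for the second derivative. -/
theorem iteratedFDeriv_update_const {F : Type u} [NormedAddCommGroup F] [NormedSpace ℝ F] (r : ℕ)
    {G : E → F} (hG : ContDiff ℝ (r + 1) G) (x v h : E) (i : Fin (r + 1)) :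
    iteratedFDeriv ℝ (r + 1) G x (Function.update (fun _ => v) i h) =
      iteratedFDeriv ℝ r (fderiv ℝ G) x (fun _ => v) h := by
  induction r generalizing F with
  | zero =>
    rw [iteratedFDeriv_succ_apply_right]
    have hi : i = Fin.last 0 := Subsingleton.elim (α := Fin 1) _ _
    subst hi
    rw [Function.update_self]
    congr 2
    exact Subsingleton.elim _ _
  | succ r ih =>
    have hDG : ContDiff ℝ (r + 1) (fderiv ℝ G) := hG.fderiv_right (by norm_cast)
    have hDDG : ContDiff ℝ r (fderiv ℝ (fderiv ℝ G)) := hDG.fderiv_right le_rfl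
    rw [iteratedFDeriv_succ_apply_right]
    refine Fin.lastCases ?_ (fun j => ?_) i
    · rw [Function.update_self]
      congr 2
      exact Fin.init_update_last _ _
    · rw [Fin.init_update_castSucc, Function.update_of_ne (Fin.castSucc_lt_last j).ne']
      have hswap : iteratedFDeriv ℝ r (fderiv ℝ (fderiv ℝ G)) x (fun _ => v) h v =
          iteratedFDeriv ℝ r (fderiv ℝ (fderiv ℝ G)) x (fun _ => v) v h := by
        -- Swapping two arguments is a continuous linear map that fixes the second derivative of
        -- `G`, so it also fixes all further derivatives of it.
        let flip : (E →L[ℝ] E →L[ℝ] F) →L[ℝ] (E →L[ℝ] E →L[ℝ] F) :=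
          ((ContinuousLinearMap.flipₗᵢ ℝ E E F).toContinuousLinearEquiv :
            (E →L[ℝ] E →L[ℝ] F) →L[ℝ] (E →L[ℝ] E →L[ℝ] F))
        have hflip : fderiv ℝ (fderiv ℝ G) = flip ∘ fderiv ℝ (fderiv ℝ G) := by
          funext y
          ext a b
          have h2 : IsSymmSndFDerivAt ℝ G y :=
            hG.contDiffAt.isSymmSndFDerivAt (by
              simp only [minSmoothness_of_isRCLikeNormedField]
              norm_cast
              omega)
          exact h2 a b
        have key := ContinuousLinearMap.iteratedFDeriv_comp_left
          (F := E →L[ℝ] E →L[ℝ] F) (G := E →L[ℝ] E →L[ℝ] F) flip (hDDG.contDiffAt (x := x)) (i := r) le_rfl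
        rw [← hflip] at key
        conv_lhs => rw [key]
        rfl
      have e1 := ih hDG j
      change iteratedFDeriv ℝ (r + 1) (fderiv ℝ G) x (Function.update (fun _ => v) j h) v = _
      rw [e1, hswap, iteratedFDeriv_succ_apply_right]
      rfl

/-- The Taylor polynomial of order `k` of a vector-valued function, centred at `x`. -/
def vecTaylor {F : Type u} [NormedAddCommGroup F] [NormedSpace ℝ F] (k : ℕ) (G : E → F)
    (x w : E) : F :=
  ∑ r ∈ Finset.range (k + 1), (1 / (r ! : ℝ)) • iteratedFDeriv ℝ r G x (fun _ => w - x)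

theorem vecTaylor_zero {F : Type u} [NormedAddCommGroup F] [NormedSpace ℝ F] (G : E → F)
    (x w : E) : vecTaylor 0 G x w = G x := by
  simp [vecTaylor]

theorem vecTaylor_self {F : Type u} [NormedAddCommGroup F] [NormedSpace ℝ F] (k : ℕ) (G : E → F)
    (x : E) : vecTaylor k G x x = G x := by
  rw [vecTaylor, Finset.sum_range_succ', Finset.sum_eq_zero]
  · simp
  · intro r _
    have : (fun _ : Fin (r + 1) => x - x) = (0 : Fin (r + 1) → E) := by
      ext; simp
    rw [this, ContinuousMultilinearMap.map_zero, smul_zero]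

/-- By symmetry the `r + 1` slots of each term contribute equally, which cancels one factor of the
factorial. This is what lets every Taylor estimate pass from `G` to `fderiv ℝ G` by induction on the
order. -/
theorem hasFDerivAt_vecTaylor {F : Type u} [NormedAddCommGroup F] [NormedSpace ℝ F] (k : ℕ)
    {G : E → F} (hG : ContDiff ℝ (k + 1) G) (x w : E) :
    HasFDerivAt (vecTaylor (k + 1) G x) (vecTaylor k (fderiv ℝ G) x w) w := by
  have hterm : ∀ r ∈ Finset.range (k + 1),
      HasFDerivAt (fun w => (1 / ((r + 1)! : ℝ)) • iteratedFDeriv ℝ (r + 1) G x (fun _ => w - x))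
        ((1 / (r ! : ℝ)) • iteratedFDeriv ℝ r (fderiv ℝ G) x (fun _ => w - x)) w := by
    intro r hr
    have hr' : r < k + 1 := Finset.mem_range.1 hr
    have hL : HasFDerivAt (fun w : E => (fun _ : Fin (r + 1) => w - x))
        (ContinuousLinearMap.pi fun _ => ContinuousLinearMap.id ℝ E) w :=
      hasFDerivAt_pi.2 fun _ => (hasFDerivAt_id w).sub_const x
    have h1 := ((iteratedFDeriv ℝ (r + 1) G x).hasFDerivAt (fun _ => w - x)).comp w hL
    have h2 := h1.const_smul (1 / ((r + 1)! : ℝ))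
    refine h2.congr_fderiv ?_
    ext h
    change (1 / ((r + 1)! : ℝ)) • ((iteratedFDeriv ℝ (r + 1) G x).linearDeriv (fun _ => w - x))
      (fun _ => h) = (1 / (r ! : ℝ)) • iteratedFDeriv ℝ r (fderiv ℝ G) x (fun _ => w - x) h
    rw [ContinuousMultilinearMap.linearDeriv_apply]
    have hG' : ContDiff ℝ (r + 1) G := hG.of_le (by norm_cast)
    simp only [iteratedFDeriv_update_const r hG']
    rw [Finset.sum_const, Finset.card_univ, Fintype.card_fin, ← Nat.cast_smul_eq_nsmul ℝ, smul_smul]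
    congr 1
    rw [Nat.factorial_succ]
    push_cast
    field_simp
  have hsum := HasFDerivAt.fun_sum hterm
  have h0 : vecTaylor (k + 1) G x = fun w => (∑ r ∈ Finset.range (k + 1),
      (1 / ((r + 1)! : ℝ)) • iteratedFDeriv ℝ (r + 1) G x (fun _ => w - x)) + G x := by
    funext w
    rw [vecTaylor, Finset.sum_range_succ']
    simp
  rw [h0]
  exact hsum.add_const (G x)

/-- `G` is `k` times continuously differentiable with `M`-Lipschitz `k`-th derivative. -/
structure LipschitzJet {F : Type u} [NormedAddCommGroup F] [NormedSpace ℝ F] (k : ℕ) (M : ℝ)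
    (G : E → F) : Prop where
  contDiff : ContDiff ℝ k G
  lipschitz : ∀ x y, ‖iteratedFDeriv ℝ k G x - iteratedFDeriv ℝ k G y‖ ≤ M * ‖x - y‖

theorem LipschitzJet.fderiv {F : Type u} [NormedAddCommGroup F] [NormedSpace ℝ F] {k : ℕ} {M : ℝ}
    {G : E → F} (h : LipschitzJet (k + 1) M G) : LipschitzJet k M (_root_.fderiv ℝ G) := by
  refine ⟨h.contDiff.fderiv_right (by norm_cast), fun x y => ?_⟩
  have := h.lipschitz x y
  rwa [iteratedFDeriv_succ_eq_comp_right, iteratedFDeriv_succ_eq_comp_right, Function.comp_apply,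
    Function.comp_apply, ← LinearIsometryEquiv.map_sub, LinearIsometryEquiv.norm_map] at this

/-- Integration of a derivative bound along the segment from `x` to `w`, in the form of a comparison
with the boundary function `B`. -/
theorem norm_le_of_fderiv_le_radial {F : Type u} [NormedAddCommGroup F] [NormedSpace ℝ F]
    {H : E → F} {H' : E → E →L[ℝ] F} {x : E} {B B' : ℝ → ℝ}
    (hH : ∀ w, HasFDerivAt H (H' w) w) (hB : ∀ t, HasDerivAt B (B' t) t)
    (h0 : ‖H x‖ ≤ B 0) (hbd : ∀ w, ‖H' w‖ ≤ B' ‖w - x‖) (w : E) : ‖H w‖ ≤ B ‖w - x‖ := by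
  have hline : ∀ t : ℝ, HasDerivAt (fun t : ℝ => x + t • (w - x)) (w - x) t := fun t => by
    simpa using ((hasDerivAt_id t).smul_const (w - x)).const_add x
  have hf : ∀ t : ℝ, HasDerivAt (fun t : ℝ => H (x + t • (w - x)))
      (H' (x + t • (w - x)) (w - x)) t := fun t => (hH _).comp_hasDerivAt t (hline t)
  have hb : ∀ t : ℝ, HasDerivAt (fun t => B (t * ‖w - x‖)) (B' (t * ‖w - x‖) * ‖w - x‖) t :=
    fun t => by
      have := (hB (t * ‖w - x‖)).comp t ((hasDerivAt_id t).mul_const ‖w - x‖)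
      simpa [Function.comp_def] using this
  have := image_norm_le_of_norm_deriv_right_le_deriv_boundary (a := 0) (b := 1)
    (f := fun t : ℝ => H (x + t • (w - x))) (B := fun t => B (t * ‖w - x‖))
    (fun t _ => (hf t).continuousAt.continuousWithinAt) (fun t _ => (hf t).hasDerivWithinAt)
    (by simpa using h0) hb (fun t ht => ?_) (Set.right_mem_Icc.2 zero_le_one)
  · simpa using this
  · refine (ContinuousLinearMap.le_opNorm _ _).trans ?_
    refine mul_le_mul_of_nonneg_right ((hbd _).trans (le_of_eq ?_)) (norm_nonneg _)
    congr 1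
    rw [add_sub_cancel_left, norm_smul, Real.norm_of_nonneg ht.1]

theorem LipschitzJet.norm_sub_vecTaylor_le {F : Type u} [NormedAddCommGroup F] [NormedSpace ℝ F]
    {k : ℕ} {M : ℝ} {G : E → F} (h : LipschitzJet k M G) (x w : E) :
    ‖G w - vecTaylor k G x w‖ ≤ M / ((k + 1)! : ℝ) * ‖w - x‖ ^ (k + 1) := by
  induction k generalizing F w with
  | zero =>
    have h1 := h.lipschitz w x
    rw [iteratedFDeriv_zero_eq_comp, Function.comp_apply, Function.comp_apply, ← map_sub,
      LinearIsometryEquiv.norm_map] at h1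
    simpa [vecTaylor_zero] using h1
  | succ k ih =>
    have hd : Differentiable ℝ G := h.contDiff.differentiable (by norm_cast)
    refine norm_le_of_fderiv_le_radial (H := fun w => G w - vecTaylor (k + 1) G x w)
      (H' := fun w => _root_.fderiv ℝ G w - vecTaylor k (_root_.fderiv ℝ G) x w)
      (B := fun t => M / ((k + 1 + 1)! : ℝ) * t ^ (k + 1 + 1))
      (B' := fun t => M / ((k + 1)! : ℝ) * t ^ (k + 1)) (x := x)
      (fun w => (hd w).hasFDerivAt.sub (hasFDerivAt_vecTaylor k h.contDiff x w)) (fun t => ?_) ?_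
      (fun w => ih h.fderiv w) w
    · have := (hasDerivAt_pow (k + 1 + 1) t).const_mul (M / ((k + 1 + 1)! : ℝ))
      refine this.congr_deriv ?_
      rw [Nat.factorial_succ (k + 1)]
      push_cast
      field_simp
    · simp [vecTaylor_self]

/-- Needed because the centre `x^k` moves with `L`. Differentiating in `w` lowers the order by one;
at `w = z` the difference is an ordinary Taylor remainder. -/
theorem LipschitzJet.norm_vecTaylor_sub_le {F : Type u} [NormedAddCommGroup F] [NormedSpace ℝ F]
    {k : ℕ} {M : ℝ} (hM : 0 ≤ M) {G : E → F} (h : LipschitzJet k M G) (x z w : E) :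
    ‖vecTaylor k G x w - vecTaylor k G z w‖ ≤
      M * ‖x - z‖ * (‖x - z‖ + ‖w - z‖) ^ k / (k ! : ℝ) := by
  induction k generalizing F w with
  | zero =>
    have h1 := h.lipschitz x z
    rw [iteratedFDeriv_zero_eq_comp, Function.comp_apply, Function.comp_apply, ← map_sub,
      LinearIsometryEquiv.norm_map] at h1
    simpa [vecTaylor_zero] using h1
  | succ k ih =>
    refine norm_le_of_fderiv_le_radial
      (H := fun w => vecTaylor (k + 1) G x w - vecTaylor (k + 1) G z w)
      (H' := fun w => vecTaylor k (_root_.fderiv ℝ G) x w - vecTaylor k (_root_.fderiv ℝ G) z w)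
      (B := fun t => M * ‖x - z‖ * (‖x - z‖ + t) ^ (k + 1) / ((k + 1)! : ℝ))
      (B' := fun t => M * ‖x - z‖ * (‖x - z‖ + t) ^ k / (k ! : ℝ)) (x := z)
      (fun w => (hasFDerivAt_vecTaylor k h.contDiff x w).sub
        (hasFDerivAt_vecTaylor k h.contDiff z w)) (fun t => ?_) ?_
      (fun w => ih h.fderiv w) w
    · have h1 := ((hasDerivAt_id t).const_add ‖x - z‖).pow (k + 1)
      have := (h1.const_mul (M * ‖x - z‖)).div_const ((k + 1)! : ℝ)
      refine this.congr_deriv ?_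
      rw [Nat.factorial_succ k]
      push_cast
      simp only [id]
      field_simp
    · rw [vecTaylor_self, norm_sub_rev]
      refine (h.norm_sub_vecTaylor_le x z).trans ?_
      rw [add_zero, norm_sub_rev z x, mul_assoc M, ← pow_succ', div_mul_eq_mul_div]
      gcongr
      omega

end Taylor

end

noncomputable section

/-! ### The regularized Taylor model and tensor steps -/

section Model

open scoped RealInnerProductSpace Gradient

variable {n p : ℕ}

theorem hasFDerivAt_quadratic (L : ℝ) (z x : EucSp n) :
    HasFDerivAt (fun x : EucSp n => L / 2 * ‖x - z‖ ^ 2) (L • innerSL ℝ (x - z)) x := by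
  have h := (((hasFDerivAt_id x).sub_const z).norm_sq).const_mul (L / 2)
  refine h.congr_fderiv ?_
  ext v
  change L / 2 * ((2 : ℕ) • ⟪x - z, v⟫) = L * ⟪x - z, v⟫
  rw [two_nsmul]
  ring

theorem fderiv_quadratic (L : ℝ) (z : EucSp n) :
    fderiv ℝ (fun x : EucSp n => L / 2 * ‖x - z‖ ^ 2) = fun x => L • innerSL ℝ (x - z) :=
  funext fun x => (hasFDerivAt_quadratic L z x).fderiv

/-- The second derivative is constant, so for `p ≥ 2` the quadratic neither changes the Lipschitz
constant nor differs from its Taylor polynomial. -/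
theorem lipschitzJet_quadratic (hp : 2 ≤ p) (L : ℝ) (z : EucSp n) :
    LipschitzJet p 0 (fun x : EucSp n => L / 2 * ‖x - z‖ ^ 2) := by
  obtain ⟨j, rfl⟩ : ∃ j, p = j + 2 := ⟨p - 2, by omega⟩
  refine ⟨contDiff_const.mul ((contDiff_id.sub contDiff_const).norm_sq ℝ), fun x y => ?_⟩
  have h2 : fderiv ℝ (fderiv ℝ (fun x : EucSp n => L / 2 * ‖x - z‖ ^ 2)) =
      fun _ => L • innerSL ℝ := by
    rw [fderiv_quadratic]
    funext x
    exact ((innerSL ℝ).hasFDerivAt.comp x ((hasFDerivAt_id x).sub_const z)).const_smul L |>.fderiv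
  have h3 : ∀ x, iteratedFDeriv ℝ j (fderiv ℝ (fderiv ℝ (fun x : EucSp n => L / 2 * ‖x - z‖ ^ 2))) x
      = iteratedFDeriv ℝ j (fderiv ℝ (fderiv ℝ (fun x : EucSp n => L / 2 * ‖x - z‖ ^ 2))) y := by
    intro x
    rw [h2]
    rcases Nat.eq_zero_or_pos j with rfl | hj
    · ext; simp
    · rw [iteratedFDeriv_const_of_ne hj.ne']; rfl
  have h4 : iteratedFDeriv ℝ (j + 2) (fun x : EucSp n => L / 2 * ‖x - z‖ ^ 2) x =
      iteratedFDeriv ℝ (j + 2) (fun x : EucSp n => L / 2 * ‖x - z‖ ^ 2) y := by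
    ext m
    rw [iteratedFDeriv_succ_apply_right, iteratedFDeriv_succ_apply_right,
      iteratedFDeriv_succ_apply_right, iteratedFDeriv_succ_apply_right]
    rw [h3 x]
  rw [h4]
  simp

theorem IsConvexSmooth.lipschitzJet {M : ℝ} {f : EucSp n → ℝ} (hf : IsConvexSmooth p M f) :
    LipschitzJet p M f := ⟨hf.contDiff, hf.lipschitz⟩

theorem IsConvexSmooth.quadReg {M L : ℝ} {f : EucSp n → ℝ} (hf : IsConvexSmooth p M f)
    (hp : 2 ≤ p) (hL : 0 ≤ L) (z : EucSp n) : IsConvexSmooth p M (quadReg f L z) := by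
  have hq := lipschitzJet_quadratic (n := n) hp L z
  refine ⟨?_, hf.contDiff.add hq.contDiff, fun x y => ?_⟩
  · refine hf.convex.add (ConvexOn.smul (c := L / 2) (by positivity) ?_)
    refine ConvexOn.pow ?_ (fun _ _ => norm_nonneg _) 2
    have := (convexOn_univ_norm (E := EucSp n)).translate_left (-z)
    simpa [Function.comp_def, sub_eq_add_neg] using this
  · have hadd : ∀ x, iteratedFDeriv ℝ p (_root_.quadReg f L z) x = iteratedFDeriv ℝ p f x +
        iteratedFDeriv ℝ p (fun x : EucSp n => L / 2 * ‖x - z‖ ^ 2) x := fun x =>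
      iteratedFDeriv_add_apply hf.contDiff.contDiffAt hq.contDiff.contDiffAt
    have h0 := hq.lipschitz x y
    rw [zero_mul] at h0
    have h1 : iteratedFDeriv ℝ p (fun x : EucSp n => L / 2 * ‖x - z‖ ^ 2) x =
        iteratedFDeriv ℝ p (fun x : EucSp n => L / 2 * ‖x - z‖ ^ 2) y :=
      sub_eq_zero.1 (norm_le_zero_iff.1 h0)
    rw [hadd, hadd, h1, add_sub_add_right_eq_sub]
    exact hf.lipschitz x y

theorem taylorModel_eq_vecTaylor (f : EucSp n → ℝ) (x w : EucSp n) :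
    taylorModel p f x w = vecTaylor p f x w := by
  simp [taylorModel, vecTaylor]

theorem vecTaylor_add {E F : Type} [NormedAddCommGroup E] [NormedSpace ℝ E] [NormedAddCommGroup F]
    [NormedSpace ℝ F] {k : ℕ} {G H : E → F} (hG : ContDiff ℝ k G) (hH : ContDiff ℝ k H) (x w : E) :
    vecTaylor k (fun x => G x + H x) x w = vecTaylor k G x w + vecTaylor k H x w := by
  rw [vecTaylor, vecTaylor, vecTaylor, ← Finset.sum_add_distrib]
  refine Finset.sum_congr rfl fun r hr => ?_
  have hr' : ((r : ℕ) : WithTop ℕ∞) ≤ k := by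
    have := Finset.mem_range.1 hr
    norm_cast
    omega
  rw [fun_iteratedFDeriv_add_apply (hG.of_le hr').contDiffAt (hH.of_le hr').contDiffAt,
    add_apply, smul_add]

theorem LipschitzJet.vecTaylor_eq {E F : Type} [NormedAddCommGroup E] [NormedSpace ℝ E]
    [NormedAddCommGroup F] [NormedSpace ℝ F] {k : ℕ} {G : E → F} (h : LipschitzJet k 0 G)
    (x w : E) : vecTaylor k G x w = G w := by
  have := h.norm_sub_vecTaylor_le x w
  rw [zero_div, zero_mul] at this
  exact (sub_eq_zero.1 (norm_le_zero_iff.1 this)).symm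

theorem taylorModel_quadReg (hp : 2 ≤ p) {f : EucSp n → ℝ} (hf : ContDiff ℝ p f) (L : ℝ)
    (z x w : EucSp n) :
    taylorModel p (quadReg f L z) x w = taylorModel p f x w + L / 2 * ‖w - z‖ ^ 2 := by
  have hq := lipschitzJet_quadratic (n := n) hp L z
  rw [taylorModel_eq_vecTaylor, taylorModel_eq_vecTaylor, ← hq.vecTaylor_eq x w]
  exact vecTaylor_add hf hq.contDiff x w

theorem fderiv_quadReg {f : EucSp n → ℝ} (hf : Differentiable ℝ f) (L : ℝ) (z : EucSp n) :
    fderiv ℝ (quadReg f L z) = fun x => fderiv ℝ f x + L • innerSL ℝ (x - z) :=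
  funext fun x => ((hf x).hasFDerivAt.add (hasFDerivAt_quadratic L z x)).fderiv

theorem gradient_quadReg {f : EucSp n → ℝ} (hf : Differentiable ℝ f) (L : ℝ) (z x : EucSp n) :
    gradient (quadReg f L z) x = gradient f x + L • (x - z) := by
  refine ext_inner_right ℝ fun v => ?_
  rw [inner_add_left, inner_gradient_left, inner_gradient_left, fderiv_quadReg hf, inner_smul_left]
  rfl

theorem IsConvexSmooth.differentiable {M : ℝ} {f : EucSp n → ℝ} (hf : IsConvexSmooth p M f)
    (hp : 2 ≤ p) : Differentiable ℝ f :=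
  hf.contDiff.differentiable (by norm_cast; omega)

theorem norm_gradient_eq (f : EucSp n → ℝ) (x : EucSp n) : ‖gradient f x‖ = ‖fderiv ℝ f x‖ := by
  rw [← toDual_gradient, LinearIsometryEquiv.norm_map]

theorem ConvexOn.add_inner_gradient_le {f : EucSp n → ℝ} (hf : ConvexOn ℝ Set.univ f)
    (hd : Differentiable ℝ f) (x y : EucSp n) : f x + ⟪gradient f x, y - x⟫ ≤ f y := by
  have hline : HasDerivAt (fun t : ℝ => x + t • (y - x)) (y - x) 0 := by
    simpa using ((hasDerivAt_id (0 : ℝ)).smul_const (y - x)).const_add x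
  have h0 : HasFDerivAt f (fderiv ℝ f x) (x + (0 : ℝ) • (y - x)) := by
    simpa using (hd x).hasFDerivAt
  have hder : HasDerivAt (fun t : ℝ => f (x + t • (y - x))) (fderiv ℝ f x (y - x)) 0 :=
    h0.comp_hasDerivAt 0 hline
  have hconv : ConvexOn ℝ Set.univ (fun t : ℝ => f (x + t • (y - x))) := by
    have := hf.comp_affineMap (AffineMap.lineMap x y : ℝ →ᵃ[ℝ] EucSp n)
    simpa [Function.comp_def, AffineMap.lineMap_apply, add_comm] using this
  have := hconv.le_slope_of_hasDerivAt (Set.mem_univ 0) (Set.mem_univ 1) one_pos hder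
  rw [slope_def_field] at this
  simp only [one_smul, zero_smul, add_zero, add_sub_cancel, sub_zero, div_one] at this
  rw [inner_gradient_left]
  linarith

theorem quadReg_add_le {f : EucSp n → ℝ} (hf : ConvexOn ℝ Set.univ f)
    (hd : Differentiable ℝ f) (L : ℝ) (z x y : EucSp n) :
    quadReg f L z x + ⟪gradient (quadReg f L z) x, y - x⟫ + L / 2 * ‖y - x‖ ^ 2 ≤
      quadReg f L z y := by
  have h := hf.add_inner_gradient_le hd x y
  rw [gradient_quadReg hd, inner_add_left, inner_smul_left]
  have h2 : ‖y - z‖ ^ 2 = ‖x - z‖ ^ 2 + 2 * ⟪x - z, y - x⟫ + ‖y - x‖ ^ 2 := by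
    rw [← norm_add_sq_real]
    congr 2
    abel
  simp only [quadReg, RCLike.conj_to_real]
  rw [h2]
  linarith

theorem gradient_eq_zero_of_isMinOn {f : EucSp n → ℝ} {x : EucSp n} (hx : IsMinOn f Set.univ x) :
    gradient f x = 0 := by
  have : IsLocalMin f x := hx.isLocalMin Filter.univ_mem
  rw [gradient, this.fderiv_eq_zero, map_zero]

/-- The vector field `v ↦ ‖v‖ᵏ v`. -/
def normPow (k : ℕ) (v : EucSp n) : EucSp n := ‖v‖ ^ k • v

theorem norm_normPow (k : ℕ) (v : EucSp n) : ‖normPow k v‖ = ‖v‖ ^ (k + 1) := by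
  rw [normPow, norm_smul, norm_pow, norm_norm, pow_succ]

theorem hasFDerivAt_norm_sub_pow (k : ℕ) (x w : EucSp n) :
    HasFDerivAt (fun w : EucSp n => ‖w - x‖ ^ (k + 2))
      (((k + 2 : ℕ) : ℝ) • innerSL ℝ (normPow k (w - x))) w := by
  have h := hasFDerivAt_norm_rpow (w - x) (p := ((k + 2 : ℕ) : ℝ)) (by push_cast; linarith)
  have h2 := h.comp w ((hasFDerivAt_id w).sub_const x)
  simp only [Real.rpow_natCast] at h2
  refine h2.congr_fderiv ?_
  ext v
  have : ((k + 2 : ℕ) : ℝ) - 2 = k := by push_cast; ring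
  rw [this, Real.rpow_natCast]
  simp [normPow]
  ring

/-- Away from the origin the derivative is `h ↦ ‖v‖^k h + k ‖v‖^(k-2) ⟪v, h⟫ v`, whose second term
contributes a nonnegative quadratic form. At the origin it vanishes, since the field is of order `k
+ 1 ≥ 2` there. -/
theorem exists_hasFDerivAt_normPow {k : ℕ} (hk : 1 ≤ k) (v : EucSp n) :
    ∃ N' : EucSp n →L[ℝ] EucSp n, HasFDerivAt (normPow k) N' v ∧
      ∀ h, ‖v‖ ^ k * ‖h‖ ^ 2 ≤ ⟪N' h, h⟫ := by
  by_cases hv : v = 0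
  · subst hv
    refine ⟨0, ?_, fun h => by simp [show k ≠ 0 by omega]⟩
    refine Asymptotics.IsBigO.hasFDerivAt (n := k + 1) ?_ (by omega)
    refine Asymptotics.IsBigO.of_norm_eventuallyLE (Filter.Eventually.of_forall fun w => ?_)
    change ‖normPow k w‖ ≤ ‖w - 0‖ ^ (k + 1)
    rw [norm_normPow, sub_zero]
  · have h1 := (hasStrictFDerivAt_norm_sq v).rpow_const (p := (k : ℝ) / 2) (by simp [hv])
    have h2 : HasFDerivAt (fun v : EucSp n => ‖v‖ ^ k)
        ((k / 2 * (‖v‖ ^ 2) ^ ((k : ℝ) / 2 - 1)) • (2 : ℕ) • innerSL ℝ v) v := by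
      have e : (fun v : EucSp n => ‖v‖ ^ k) = fun v => (‖v‖ ^ 2) ^ ((k : ℝ) / 2) := by
        funext w
        rw [← Real.rpow_natCast_mul (norm_nonneg _),
          show ((2 : ℕ) : ℝ) * ((k : ℝ) / 2) = k by push_cast; ring, Real.rpow_natCast]
      rw [e]
      exact h1.hasFDerivAt
    refine ⟨_, h2.smul (hasFDerivAt_id v), fun h => ?_⟩
    change _ ≤ ⟪‖v‖ ^ k • h + ((k / 2 * (‖v‖ ^ 2) ^ ((k : ℝ) / 2 - 1)) * ((2 : ℕ) • ⟪v, h⟫)) • v, h⟫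
    rw [two_nsmul, inner_add_left, inner_smul_left, inner_smul_left, RCLike.conj_to_real,
      RCLike.conj_to_real, real_inner_self_eq_norm_sq]
    have h3 : 0 ≤ (k / 2 * (‖v‖ ^ 2) ^ ((k : ℝ) / 2 - 1)) := by positivity
    have h4 := mul_nonneg h3 (mul_self_nonneg ⟪v, h⟫)
    linarith

theorem norm_normPow_sub_le (k : ℕ) {v w : EucSp n} {ρ : ℝ} (hv : ‖v‖ ≤ ρ) (hw : ‖w‖ ≤ ρ) :
    ‖normPow k v - normPow k w‖ ≤ (k + 1) * ρ ^ k * ‖v - w‖ := by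
  have hρ : 0 ≤ ρ := (norm_nonneg v).trans hv
  induction k with
  | zero => simp [normPow]
  | succ k ih =>
    have e : normPow (k + 1) v - normPow (k + 1) w =
        ‖v‖ • (normPow k v - normPow k w) + (‖v‖ - ‖w‖) • normPow k w := by
      simp only [normPow, pow_succ', mul_smul, smul_sub, sub_smul]
      abel
    rw [e]
    refine (norm_add_le _ _).trans ?_
    rw [norm_smul, norm_smul, norm_norm, norm_normPow, Real.norm_eq_abs]
    have h1 : ‖v‖ * ‖normPow k v - normPow k w‖ ≤ ρ * ((k + 1) * ρ ^ k * ‖v - w‖) := by gcongr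
    have h2 : |‖v‖ - ‖w‖| * ‖w‖ ^ (k + 1) ≤ ‖v - w‖ * ρ ^ (k + 1) := by
      gcongr
      exact abs_norm_sub_norm_le v w
    push_cast
    calc _ ≤ _ := add_le_add h1 h2
      _ = _ := by ring

/-- The derivative of the regularized Taylor model, as a function of the second point. -/
def modelDeriv (p : ℕ) (M : ℝ) (F : EucSp n → ℝ) (x w : EucSp n) : EucSp n →L[ℝ] ℝ :=
  vecTaylor (p - 1) (fderiv ℝ F) x w + (M / (p ! : ℝ)) • innerSL ℝ (normPow (p - 1) (w - x))

theorem hasFDerivAt_model (hp : 1 ≤ p) (M : ℝ) {F : EucSp n → ℝ} (hF : ContDiff ℝ p F)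
    (x w : EucSp n) :
    HasFDerivAt (fun w => taylorModel p F x w + M / ((p + 1)! : ℝ) * ‖w - x‖ ^ (p + 1))
      (modelDeriv p M F x w) w := by
  obtain ⟨k, rfl⟩ : ∃ k, p = k + 1 := ⟨p - 1, by omega⟩
  have h1 := hasFDerivAt_vecTaylor k (G := F) (by exact_mod_cast hF) x w
  have h2 := (hasFDerivAt_norm_sub_pow k x w).const_mul (M / ((k + 1 + 1)! : ℝ))
  have h3 := h1.add h2
  have e : (fun w => taylorModel (k + 1) F x w + M / ((k + 1 + 1)! : ℝ) * ‖w - x‖ ^ (k + 1 + 1)) =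
      vecTaylor (k + 1) F x + fun w => M / ((k + 1 + 1)! : ℝ) * ‖w - x‖ ^ (k + 2) := by
    funext w
    rw [taylorModel_eq_vecTaylor]
    rfl
  rw [e]
  refine h3.congr_fderiv ?_
  rw [modelDeriv, smul_smul]
  congr 2
  rw [Nat.factorial_succ (k + 1)]
  push_cast
  field_simp
  ring

theorem IsTensorStep.modelDeriv_eq_zero (hp : 1 ≤ p) {M : ℝ} {F : EucSp n → ℝ}
    (hF : ContDiff ℝ p F) {x w : EucSp n} (h : IsTensorStep p M F x w) :
    modelDeriv p M F x w = 0 :=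
  (h.isLocalMin Filter.univ_mem).hasFDerivAt_eq_zero (hasFDerivAt_model hp M hF x w)

theorem IsConvexSmooth.lipschitzJet_fderiv {M : ℝ} {F : EucSp n → ℝ} (hF : IsConvexSmooth p M F)
    (hp : 1 ≤ p) : LipschitzJet (p - 1) M (fderiv ℝ F) := by
  have := hF.lipschitzJet
  obtain ⟨k, rfl⟩ : ∃ k, p = k + 1 := ⟨p - 1, by omega⟩
  exact this.fderiv

theorem hasDerivAt_clm_line {H : EucSp n → EucSp n →L[ℝ] ℝ} {H' : EucSp n →L[ℝ] EucSp n →L[ℝ] ℝ}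
    {w h : EucSp n} {t : ℝ} (hH : HasFDerivAt H H' (w + t • h)) :
    HasDerivAt (fun t : ℝ => H (w + t • h) h) (H' h h) t := by
  have hline : HasDerivAt (fun t : ℝ => w + t • h) h t := by
    simpa using ((hasDerivAt_id t).smul_const h).const_add w
  have h1 : HasDerivAt (fun t : ℝ => H (w + t • h)) (H' h) t := hH.comp_hasDerivAt t hline
  exact ((ContinuousLinearMap.apply ℝ ℝ h).hasFDerivAt (x := H (w + t • h))).comp_hasDerivAt t h1

theorem clm_apply_self_le {A : EucSp n →L[ℝ] EucSp n →L[ℝ] ℝ} {C : ℝ} (hA : ‖A‖ ≤ C)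
    (h : EucSp n) : A h h ≤ C * ‖h‖ ^ 2 := by
  refine (le_abs_self _).trans ((Real.norm_eq_abs _).symm.le.trans ?_)
  refine (A.le_opNorm₂ h h).trans ?_
  rw [mul_assoc, ← sq]
  gcongr

/-- The Hessian of `F` differs from that of its Taylor polynomial by at most `M/(p-1)! ‖· -
x‖^(p-1)`, and the regularizer with weight `p M` has a Hessian at least that large. Thus model minus
`F` has a monotone gradient, which is the reason for the factor `p` in the tensor step. -/
theorem IsConvexSmooth.model_monotone (hp : 2 ≤ p) {M : ℝ} {F : EucSp n → ℝ}
    (hF : IsConvexSmooth p M F) (hM : 0 ≤ M) (x w w' : EucSp n) :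
    (fderiv ℝ F w - fderiv ℝ F w') (w - w') ≤
      (modelDeriv p (p * M) F x w - modelDeriv p (p * M) F x w') (w - w') := by
  obtain ⟨j, rfl⟩ : ∃ j, p = j + 2 := ⟨p - 2, by omega⟩
  have hG := hF.lipschitzJet_fderiv (by omega)
  change LipschitzJet (j + 1) M (fderiv ℝ F) at hG
  have hGd : Differentiable ℝ (fderiv ℝ F) := hG.contDiff.differentiable (by norm_cast)
  set h := w - w' with hh
  set c : ℝ := ((j + 2 : ℕ) : ℝ) * M / ((j + 2)! : ℝ) with hc
  have hc' : c = M / ((j + 1)! : ℝ) := by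
    rw [hc, Nat.factorial_succ (j + 1)]
    push_cast
    field_simp
    ring
  have hline : ∀ t : ℝ, HasDerivAt (fun t : ℝ => w' + t • h) h t := fun t => by
    simpa using ((hasDerivAt_id t).smul_const h).const_add w'
  have hE : ∀ v, HasFDerivAt (fun v => fderiv ℝ F v - vecTaylor (j + 1) (fderiv ℝ F) x v)
      (fderiv ℝ (fderiv ℝ F) v - vecTaylor j (fderiv ℝ (fderiv ℝ F)) x v) v := fun v =>
    (hGd v).hasFDerivAt.sub (hasFDerivAt_vecTaylor j hG.contDiff x v)
  choose N' hN' hN'pos using fun v : EucSp n => exists_hasFDerivAt_normPow (k := j + 1) (by omega) v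
  -- The gradient difference between model and `F` along the segment from `w'` to `w`, tested
  -- against `h`; the claim is `ψ 0 ≤ ψ 1`.
  set ψ : ℝ → ℝ := fun t => c * ⟪normPow (j + 1) (w' + t • h - x), h⟫ -
    (fderiv ℝ F (w' + t • h) - vecTaylor (j + 1) (fderiv ℝ F) x (w' + t • h)) h with hψ
  have hder : ∀ t, HasDerivAt ψ (c * ⟪N' (w' + t • h - x) h, h⟫ -
      (fderiv ℝ (fderiv ℝ F) (w' + t • h) -
        vecTaylor j (fderiv ℝ (fderiv ℝ F)) x (w' + t • h)) h h) t := by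
    intro t
    have a1 := (hN' (w' + t • h - x)).comp_hasDerivAt t ((hline t).sub_const x)
    have a2 : HasDerivAt (fun t : ℝ => ⟪normPow (j + 1) (w' + t • h - x), h⟫)
        (⟪N' (w' + t • h - x) h, h⟫) t := by
      simpa using a1.inner ℝ (hasDerivAt_const t h)
    have a3 := hasDerivAt_clm_line (hE (w' + t • h))
    exact (a2.const_mul c).sub a3
  have hmono : Monotone ψ := by
    refine monotone_of_deriv_nonneg (fun t => (hder t).differentiableAt) fun t => ?_
    rw [(hder t).deriv, sub_nonneg]
    set v := w' + t • h
    have b1 := hG.fderiv.norm_sub_vecTaylor_le x v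
    have b2 : (fderiv ℝ (fderiv ℝ F) v - vecTaylor j (fderiv ℝ (fderiv ℝ F)) x v) h h ≤
        M / ((j + 1)! : ℝ) * ‖v - x‖ ^ (j + 1) * ‖h‖ ^ 2 := clm_apply_self_le b1 h
    have b3 := mul_le_mul_of_nonneg_left (hN'pos (v - x) h)
      (show 0 ≤ M / ((j + 1)! : ℝ) by positivity)
    rw [hc']
    linarith
  have := hmono (zero_le_one)
  simp only [hψ, zero_smul, add_zero, one_smul] at this
  have hw : w' + h = w := by rw [hh]; abel
  rw [hw] at this
  simp only [modelDeriv, FunLike.coe_add, FunLike.coe_sub, FunLike.coe_smul, Pi.sub_apply,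
    Pi.add_apply, Pi.smul_apply, innerSL_apply_apply, smul_eq_mul] at this ⊢
  change _ ≤ vecTaylor (j + 1) (fderiv ℝ F) x w h + c * ⟪normPow (j + 1) (w - x), h⟫ -
    (vecTaylor (j + 1) (fderiv ℝ F) x w' h + c * ⟪normPow (j + 1) (w' - x), h⟫)
  linarith

theorem IsConvexSmooth.le_model {M : ℝ} {F : EucSp n → ℝ} (hF : IsConvexSmooth p M F)
    (x w : EucSp n) :
    F w + (p - 1) * M / ((p + 1)! : ℝ) * ‖w - x‖ ^ (p + 1) ≤
      taylorModel p F x w + p * M / ((p + 1)! : ℝ) * ‖w - x‖ ^ (p + 1) := by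
  have h := hF.lipschitzJet.norm_sub_vecTaylor_le x w
  rw [← taylorModel_eq_vecTaylor, Real.norm_eq_abs] at h
  have h2 := (abs_le.1 h).2
  have : (p - 1) * M / ((p + 1)! : ℝ) * ‖w - x‖ ^ (p + 1) =
    p * M / ((p + 1)! : ℝ) * ‖w - x‖ ^ (p + 1) - M / ((p + 1)! : ℝ) * ‖w - x‖ ^ (p + 1) := by ring
  linarith

theorem IsConvexSmooth.model_le {M : ℝ} {F : EucSp n → ℝ} (hF : IsConvexSmooth p M F)
    (x w : EucSp n) :
    taylorModel p F x w + p * M / ((p + 1)! : ℝ) * ‖w - x‖ ^ (p + 1) ≤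
      F w + (p + 1) * M / ((p + 1)! : ℝ) * ‖w - x‖ ^ (p + 1) := by
  have h := hF.lipschitzJet.norm_sub_vecTaylor_le x w
  rw [← taylorModel_eq_vecTaylor, Real.norm_eq_abs] at h
  have h2 := (abs_le.1 h).1
  have : (p + 1) * M / ((p + 1)! : ℝ) * ‖w - x‖ ^ (p + 1) =
    p * M / ((p + 1)! : ℝ) * ‖w - x‖ ^ (p + 1) + M / ((p + 1)! : ℝ) * ‖w - x‖ ^ (p + 1) := by ring
  linarith

theorem taylorModel_self (F : EucSp n → ℝ) (x : EucSp n) : taylorModel p F x x = F x := by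
  rw [taylorModel_eq_vecTaylor, vecTaylor_self]

theorem IsTensorStep.le_self {M : ℝ} {F : EucSp n → ℝ} (hF : IsConvexSmooth p M F)
    {x w : EucSp n} (h : IsTensorStep p (p * M) F x w) :
    F w + (p - 1) * M / ((p + 1)! : ℝ) * ‖w - x‖ ^ (p + 1) ≤ F x := by
  refine (hF.le_model x w).trans ((h (Set.mem_univ x)).trans (le_of_eq ?_))
  simp [taylorModel_self]

theorem IsTensorStep.le_of_point {M : ℝ} {F : EucSp n → ℝ}
    (hF : IsConvexSmooth p M F) {x w : EucSp n} (h : IsTensorStep p (p * M) F x w)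
    (v : EucSp n) :
    F w + (p - 1) * M / ((p + 1)! : ℝ) * ‖w - x‖ ^ (p + 1) ≤
      F v + (p + 1) * M / ((p + 1)! : ℝ) * ‖v - x‖ ^ (p + 1) :=
  (hF.le_model x w).trans ((h (Set.mem_univ v)).trans (hF.model_le x v))

/-- At a stationary point of the model the gradient of `F` is the Taylor remainder of `fderiv ℝ F`
minus the gradient of the regularizer. These contribute 1 and `p` times `M/p! ‖w - x‖^p`. -/
theorem IsTensorStep.norm_gradient_le (hp : 1 ≤ p) {M : ℝ} {F : EucSp n → ℝ}
    (hF : IsConvexSmooth p M F) (hM : 0 ≤ M) {x w : EucSp n}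
    (h : IsTensorStep p (p * M) F x w) :
    ‖gradient F w‖ ≤ (p + 1) * M / (p ! : ℝ) * ‖w - x‖ ^ p := by
  have h0 := h.modelDeriv_eq_zero hp hF.contDiff
  have h1 := (hF.lipschitzJet_fderiv hp).norm_sub_vecTaylor_le x w
  rw [Nat.sub_add_cancel hp] at h1
  rw [norm_gradient_eq]
  have e : fderiv ℝ F w = (fderiv ℝ F w - vecTaylor (p - 1) (fderiv ℝ F) x w) -
      (p * M / (p ! : ℝ)) • innerSL ℝ (normPow (p - 1) (w - x)) := by
    rw [modelDeriv] at h0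
    rw [eq_neg_of_add_eq_zero_left h0]
    abel
  rw [e]
  refine (norm_sub_le _ _).trans ?_
  rw [norm_smul, innerSL_apply_norm, norm_normPow, Nat.sub_add_cancel hp,
    Real.norm_of_nonneg (by positivity)]
  calc _ ≤ M / (p ! : ℝ) * ‖w - x‖ ^ p + p * M / (p ! : ℝ) * ‖w - x‖ ^ p := by gcongr
    _ = _ := by ring

/-- The tensor step moves at most twice as far as the distance to any minimizer of the
unregularized objective. -/
theorem IsTensorStep.norm_sub_le (hp : 2 ≤ p) {M L : ℝ} {g : EucSp n → ℝ}
    (hg : IsConvexSmooth p M g) (hM : 0 < M) (hL : 0 ≤ L) {x w v : EucSp n}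
    (hv : IsMinOn g Set.univ v) (h : IsTensorStep p (p * M) (quadReg g L x) x w) :
    ‖w - x‖ ≤ 2 * ‖v - x‖ := by
  by_contra! hlt
  have h1 := h.le_of_point (hg.quadReg hp hL x) v
  have h2 : g v ≤ g w := hv (Set.mem_univ w)
  simp only [quadReg] at h1
  have h3 : ‖v - x‖ ≤ ‖w - x‖ := by linarith [norm_nonneg (v - x)]
  have h4 : L / 2 * ‖v - x‖ ^ 2 ≤ L / 2 * ‖w - x‖ ^ 2 := by gcongr
  have h5 : (2 * ‖v - x‖) ^ (p + 1) < ‖w - x‖ ^ (p + 1) :=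
    pow_lt_pow_left₀ hlt (by positivity) (by omega)
  rw [mul_pow] at h5
  -- Optimality against `v` gives `(p-1) ‖w - x‖^(p+1) ≤ (p+1) ‖v - x‖^(p+1)`, while a step longer
  -- than twice the distance makes the left side exceed `8 (p-1) ‖v - x‖^(p+1)`. For `p ≥ 2` this is
  -- impossible because `8 (p-1) ≥ p + 1`.
  have h6 : (8 : ℝ) ≤ 2 ^ (p + 1) := by
    calc (8 : ℝ) = 2 ^ 3 := by norm_num
      _ ≤ 2 ^ (p + 1) := pow_le_pow_right₀ (by norm_num) (by omega)
  have h7 : 8 * ‖v - x‖ ^ (p + 1) < ‖w - x‖ ^ (p + 1) :=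
    lt_of_le_of_lt (by gcongr) h5
  have h8 : (p - 1) * M / ((p + 1)! : ℝ) * ‖w - x‖ ^ (p + 1) ≤
      (p + 1) * M / ((p + 1)! : ℝ) * ‖v - x‖ ^ (p + 1) := by linarith
  have hM' : 0 < M / ((p + 1)! : ℝ) := by positivity
  have hp' : (2 : ℝ) ≤ p := by exact_mod_cast hp
  have h9 : (p - 1) * ‖w - x‖ ^ (p + 1) ≤ (p + 1) * ‖v - x‖ ^ (p + 1) := by
    refine le_of_mul_le_mul_left ?_ hM'
    calc _ = (p - 1) * M / ((p + 1)! : ℝ) * ‖w - x‖ ^ (p + 1) := by ring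
      _ ≤ _ := h8
      _ = _ := by ring
  have h10 : (p - 1) * (8 * ‖v - x‖ ^ (p + 1)) < (p - 1) * ‖w - x‖ ^ (p + 1) := by
    refine mul_lt_mul_of_pos_left h7 (by linarith)
  have h11 : 0 ≤ ‖v - x‖ ^ (p + 1) := by positivity
  nlinarith

theorem exists_isMinOn_of_growth {Ω : EucSp n → ℝ} (hc : Continuous Ω) {a b : ℝ} {m : ℕ}
    (ha : 0 < a) (hm : m ≠ 0) (x : EucSp n) (h : ∀ w, b + a * ‖w - x‖ ^ m ≤ Ω w) :
    ∃ w, IsMinOn Ω Set.univ w := by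
  have hlim : Filter.Tendsto Ω (Filter.cocompact (EucSp n)) Filter.atTop := by
    refine Filter.tendsto_atTop_mono h ?_
    refine Filter.tendsto_atTop_add_const_left _ _ (Filter.Tendsto.const_mul_atTop ha ?_)
    refine (Filter.tendsto_pow_atTop hm).comp ?_
    have : Filter.Tendsto (fun w : EucSp n => ‖w‖ - ‖x‖) (Filter.cocompact (EucSp n))
        Filter.atTop :=
      Filter.tendsto_atTop_add_const_right _ _ (tendsto_norm_cocompact_atTop (E := EucSp n))
    exact Filter.tendsto_atTop_mono (fun w => norm_sub_norm_le w x) this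
  obtain ⟨w, hw⟩ := hc.exists_forall_le hlim
  exact ⟨w, fun y _ => hw y⟩

theorem exists_isTensorStep (hp : 2 ≤ p) {M : ℝ} {F : EucSp n → ℝ} (hF : IsConvexSmooth p M F)
    (hM : 0 < M) {b : ℝ} (hb : ∀ w, b ≤ F w) (x : EucSp n) :
    ∃ w, IsTensorStep p (p * M) F x w := by
  have hp' : (2 : ℝ) ≤ p := by exact_mod_cast hp
  refine exists_isMinOn_of_growth (m := p + 1) (b := b) (a := (p - 1) * M / ((p + 1)! : ℝ)) ?_ ?_
    (by omega) x fun w => ?_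
  · exact continuous_iff_continuousAt.2 fun w =>
      (hasFDerivAt_model (by omega) _ hF.contDiff x w).continuousAt
  · have : (0 : ℝ) < p - 1 := by linarith
    positivity
  · exact (add_le_add_left (hb w) _).trans (hF.le_model x w)

end Model

end

noncomputable section

/-! ### Growth of `A_k` under the large-step condition -/

section Rate

theorem rpow_concave_step {θ s t : ℝ} (hθ : 0 ≤ θ) (hθ1 : θ ≤ 1) (ht : 0 ≤ t) (hs : 0 < s) :
    θ * s ^ (θ - 1) * (s - t) ≤ s ^ θ - t ^ θ := by
  have h := rpow_one_add_le_one_add_mul_self (s := t / s - 1)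
    (by have := div_nonneg ht hs.le; linarith) hθ hθ1
  rw [add_sub_cancel, Real.div_rpow ht hs.le, div_le_iff₀ (by positivity)] at h
  have e : s ^ θ = s ^ (θ - 1) * s := by
    rw [← Real.rpow_add_one hs.ne', sub_add_cancel]
  have e2 : (1 + θ * (t / s - 1)) * s ^ θ = s ^ θ - θ * s ^ (θ - 1) * (s - t) := by
    rw [e]; field_simp; ring
  linarith

/-- Growth of the sequence `A` of an accelerated proximal scheme under the large-step condition
`L ≤ κ r^{p-1}`. -/
theorem large_step_growth {p : ℕ} (hp : 2 ≤ p) (N : ℕ) {A a L r : ℕ → ℝ} {κ G : ℝ} (hκ : 0 < κ)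
    (hA0 : 0 ≤ A 0) (hA : ∀ i < N, A (i + 1) = A i + a i) (ha : ∀ i < N, 0 < a i)
    (hL : ∀ i < N, L i * a i ^ 2 = A (i + 1)) (hr : ∀ i < N, 0 < r i)
    (hLr : ∀ i < N, L i ≤ κ * r i ^ (p - 1))
    (hG : ∑ i ∈ Finset.range N, A (i + 1) * L i * r i ^ 2 ≤ G) :
    (N : ℝ) ^ ((3 * (p : ℝ) + 1) / 2) ≤
      κ * G ^ (((p : ℝ) - 1) / 2) * ((p : ℝ) + 1) ^ (p + 1) * A N := by
  have hp' : (2 : ℝ) ≤ p := by exact_mod_cast hp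
  have hApos : ∀ i ≤ N, 0 ≤ A i := by
    intro i
    induction i with
    | zero => exact fun _ => hA0
    | succ i ih =>
      intro hi
      rw [hA i hi]
      exact add_nonneg (ih (by omega)) (ha i hi).le
  have hA1 : ∀ i < N, 0 < A (i + 1) := fun i hi => by
    rw [hA i hi]
    exact add_pos_of_nonneg_of_pos (hApos i hi.le) (ha i hi)
  set S : ℕ → ℝ := fun i => √(A i) with hS
  have hS1 : ∀ i < N, 0 < S (i + 1) := fun i hi => Real.sqrt_pos.2 (hA1 i hi)
  have hSsq : ∀ i ≤ N, S i ^ 2 = A i := fun i hi => Real.sq_sqrt (hApos i hi)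
  set q : ℝ := 3 * (p : ℝ) + 1 with hq
  have hqpos : 0 < q := by rw [hq]; linarith
  -- The exponents are chosen so that in `X^α Y^β`, with `L a² = S²`, everything cancels except
  -- `(r^(p-1)/L)^(2/q)`, which the large-step condition bounds below. The exponent `θ` makes the
  -- sum of the `Y i` telescope.
  set α : ℝ := ((p : ℝ) - 1) / q with hα
  set β : ℝ := (2 * (p : ℝ) + 2) / q with hβ
  set θ : ℝ := 2 / ((p : ℝ) + 1) with hθ
  have hαpos : 0 < α := div_pos (by linarith) hqpos
  have hβpos : 0 < β := div_pos (by linarith) hqpos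
  have hαβ : α + β = 1 := by rw [hα, hβ, hq]; field_simp; ring
  set X : ℕ → ℝ := fun i => A (i + 1) * L i * r i ^ 2 with hX
  set Y : ℕ → ℝ := fun i => a i * S (i + 1) ^ (-1 : ℝ) * S (i + 1) ^ (θ - 1) with hY
  have hLpos : ∀ i < N, 0 < L i := fun i hi => by
    have h1 := hL i hi
    have h2 := hA1 i hi
    rw [← h1] at h2
    exact pos_of_mul_pos_left h2 (sq_nonneg _)
  have hXpos : ∀ i < N, 0 < X i := fun i hi => by
    have := hLpos i hi; have := hA1 i hi; have := hr i hi
    simp only [hX]; positivity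
  have hYpos : ∀ i < N, 0 < Y i := fun i hi => by
    have := hS1 i hi; have := ha i hi
    simp only [hY]; positivity
  have hpoint : ∀ i < N, κ ^ (-(2 / q)) ≤ X i ^ α * Y i ^ β := by
    intro i hi
    have b1 := hS1 i hi
    have b2 := ha i hi
    have b3 := hr i hi
    have b4 := hLpos i hi
    have b5 := hXpos i hi
    have b6 := hYpos i hi
    rw [← Real.log_le_log_iff (by positivity) (by positivity), Real.log_rpow hκ,
      Real.log_mul (by positivity) (by positivity), Real.log_rpow b5, Real.log_rpow b6]
    have l1 : Real.log (X i) = 2 * Real.log (S (i + 1)) + Real.log (L i) + 2 * Real.log (r i) := by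
      simp only [hX]
      rw [← hSsq (i + 1) hi, Real.log_mul (by positivity) (by positivity),
        Real.log_mul (by positivity) (by positivity), Real.log_pow, Real.log_pow]
      push_cast; ring
    have l2 : Real.log (Y i) = Real.log (a i) + (θ - 2) * Real.log (S (i + 1)) := by
      simp only [hY]
      rw [Real.log_mul (by positivity) (by positivity),
        Real.log_mul (by positivity) (by positivity), Real.log_rpow b1, Real.log_rpow b1]
      ring
    have l3 : Real.log (L i) + 2 * Real.log (a i) = 2 * Real.log (S (i + 1)) := by
      have := congrArg Real.log (hL i hi)
      rw [← hSsq (i + 1) hi, Real.log_mul (by positivity) (by positivity), Real.log_pow,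
        Real.log_pow] at this
      exact_mod_cast this
    have l4 : Real.log (L i) ≤ Real.log κ + (p - 1) * Real.log (r i) := by
      have := Real.log_le_log b4 (hLr i hi)
      rw [Real.log_mul (by positivity) (by positivity), Real.log_pow, Nat.cast_sub (by omega)] at this
      exact_mod_cast this
    rw [l1, l2]
    have l5 : Real.log (S (i + 1)) = (Real.log (L i) + 2 * Real.log (a i)) / 2 := by linarith
    have e : α * (2 * Real.log (S (i + 1)) + Real.log (L i) + 2 * Real.log (r i)) +
        β * (Real.log (a i) + (θ - 2) * Real.log (S (i + 1))) =
        2 / q * ((p - 1) * Real.log (r i) - Real.log (L i)) := by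
      rw [l5, hα, hβ, hθ, hq]
      field_simp
      ring
    rw [e]
    have : 0 < 2 / q := by positivity
    nlinarith
  have hsumY : ∑ i ∈ Finset.range N, Y i ≤ (p + 1) * S N ^ θ := by
    have hstep : ∀ i ∈ Finset.range N, Y i ≤ (p + 1) * (S (i + 1) ^ θ - S i ^ θ) := by
      intro i hi
      have hi' := Finset.mem_range.1 hi
      have b1 := hS1 i hi'
      have hc := rpow_concave_step (θ := θ) (s := S (i + 1)) (t := S i) (by rw [hθ]; positivity)
        (by rw [hθ, div_le_one (by linarith)]; linarith) (Real.sqrt_nonneg _) b1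
      have hmono : S i ≤ S (i + 1) := Real.sqrt_le_sqrt (by rw [hA i hi']; linarith [ha i hi'])
      -- Here `a i` is a difference of squares of the increasing sequence `S`; concavity of `s ↦
      -- s^θ` then bounds `Y i` by an increment of `S^θ`.
      have hai : a i ≤ 2 * S (i + 1) * (S (i + 1) - S i) := by
        have e1 := hSsq (i + 1) hi'
        have e2 := hSsq i hi'.le
        have e3 := hA i hi'
        nlinarith
      have hai2 : a i * S (i + 1) ^ (-1 : ℝ) ≤ 2 * (S (i + 1) - S i) := by
        rw [Real.rpow_neg_one, ← div_eq_mul_inv, div_le_iff₀ b1]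
        linarith
      have h3 : Y i ≤ 2 * (S (i + 1) - S i) * S (i + 1) ^ (θ - 1) := by
        simp only [hY]
        gcongr
      refine h3.trans ?_
      calc _ = (p + 1) * (θ * S (i + 1) ^ (θ - 1) * (S (i + 1) - S i)) := by
            rw [hθ]; field_simp
        _ ≤ _ := by gcongr
    refine (Finset.sum_le_sum hstep).trans ?_
    rw [← Finset.mul_sum, Finset.sum_range_sub (fun i => S i ^ θ)]
    have : 0 ≤ S 0 ^ θ := Real.rpow_nonneg (Real.sqrt_nonneg _) _
    gcongr
    linarith
  have hholder : (N : ℝ) * κ ^ (-(2 / q)) ≤ (∑ i ∈ Finset.range N, X i) ^ α *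
      (∑ i ∈ Finset.range N, Y i) ^ β := by
    have hconj : (1 / α).HolderConjugate (1 / β) := by
      have := Real.holderConjugate_one_div hαpos hβpos hαβ
      exact this
    have h1 := Real.inner_le_Lp_mul_Lq_of_nonneg (Finset.range N) (f := fun i => X i ^ α)
      (g := fun i => Y i ^ β) hconj
      (fun i hi => Real.rpow_nonneg (hXpos i (Finset.mem_range.1 hi)).le _)
      (fun i hi => Real.rpow_nonneg (hYpos i (Finset.mem_range.1 hi)).le _)
    have e1 : ∑ i ∈ Finset.range N, (X i ^ α) ^ (1 / α) = ∑ i ∈ Finset.range N, X i :=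
      Finset.sum_congr rfl fun i hi => by
        rw [← Real.rpow_mul (hXpos i (Finset.mem_range.1 hi)).le, mul_one_div_cancel hαpos.ne',
          Real.rpow_one]
    have e2 : ∑ i ∈ Finset.range N, (Y i ^ β) ^ (1 / β) = ∑ i ∈ Finset.range N, Y i :=
      Finset.sum_congr rfl fun i hi => by
        rw [← Real.rpow_mul (hYpos i (Finset.mem_range.1 hi)).le, mul_one_div_cancel hβpos.ne',
          Real.rpow_one]
    rw [e1, e2, one_div_one_div, one_div_one_div] at h1
    refine le_trans ?_ h1
    have := Finset.sum_le_sum (s := Finset.range N) fun i hi => hpoint i (Finset.mem_range.1 hi)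
    simpa using this
  have hX0 : 0 ≤ ∑ i ∈ Finset.range N, X i :=
    Finset.sum_nonneg fun i hi => (hXpos i (Finset.mem_range.1 hi)).le
  have hY0 : 0 ≤ ∑ i ∈ Finset.range N, Y i :=
    Finset.sum_nonneg fun i hi => (hYpos i (Finset.mem_range.1 hi)).le
  have hG0 : 0 ≤ G := hX0.trans hG
  have hSN : 0 ≤ S N := Real.sqrt_nonneg _
  have hmain : (N : ℝ) * κ ^ (-(2 / q)) ≤ G ^ α * ((p + 1) * S N ^ θ) ^ β :=
    hholder.trans (by gcongr)
  -- The power `q/2` turns the factor in `κ` into `κ⁻¹`, and `θ (p + 1) = 2` turns `S N` into `A N`.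
  have hpow := Real.rpow_le_rpow (z := q / 2) (by positivity) hmain (by positivity)
  rw [Real.mul_rpow (by positivity) (by positivity), Real.mul_rpow (by positivity) (by positivity),
    ← Real.rpow_mul hκ.le, ← Real.rpow_mul hG0, ← Real.rpow_mul (by positivity),
    Real.mul_rpow (by positivity) (by positivity), ← Real.rpow_mul hSN] at hpow
  have e1 : -(2 / q) * (q / 2) = -1 := by field_simp
  have e2 : α * (q / 2) = ((p : ℝ) - 1) / 2 := by rw [hα]; field_simp
  have e3 : β * (q / 2) = ((p + 1 : ℕ) : ℝ) := by rw [hβ]; push_cast; field_simp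
  have e4 : θ * ((p + 1 : ℕ) : ℝ) = ((2 : ℕ) : ℝ) := by rw [hθ]; push_cast; field_simp
  rw [e1, e2, e3, e4, Real.rpow_natCast, Real.rpow_natCast, hSsq N le_rfl, Real.rpow_neg_one,
    ← div_eq_mul_inv, div_le_iff₀ hκ] at hpow
  calc _ ≤ _ := hpow
    _ = _ := by ring

end Rate

/-! ### Energy estimate and rate of Algorithm 1 -/

section Accelerated

open scoped RealInnerProductSpace

variable {n p : ℕ}

namespace MSNState

theorem weight_pos {s : MSNState n} {L : ℝ} (hL : 0 < L) : 0 < s.weight L := by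
  have : 0 < 1 / L := by positivity
  rw [weight]
  positivity

/-- The weight is the positive root of `L a² = A + a`, the identity that makes the gradient terms in
the energy balance match. -/
theorem mul_weight_sq {s : MSNState n} {L : ℝ} (hL : 0 < L) (hA : 0 ≤ s.A) :
    L * s.weight L ^ 2 = s.nextA L := by
  have h : √(1 / L ^ 2 + 4 * s.A / L) ^ 2 = 1 / L ^ 2 + 4 * s.A / L :=
    Real.sq_sqrt (by positivity)
  rw [nextA, weight]
  set q := √(1 / L ^ 2 + 4 * s.A / L)
  have : L * ((1 / L + q) / 2) ^ 2 = (L / 4) * (1 / L ^ 2 + 2 / L * q + q ^ 2) := by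
    field_simp; ring
  rw [this, h]
  field_simp
  ring

theorem nextA_pos {s : MSNState n} {L : ℝ} (hL : 0 < L) (hA : 0 ≤ s.A) : 0 < s.nextA L :=
  add_pos_of_nonneg_of_pos hA (weight_pos hL)

theorem nextA_smul_extrap {s : MSNState n} {L : ℝ} (hL : 0 < L) (hA : 0 ≤ s.A) :
    s.nextA L • s.extrap L = s.A • s.y + s.weight L • s.u := by
  have h := (nextA_pos (s := s) hL hA).ne'
  rw [extrap, smul_add, smul_smul, smul_smul, mul_div_cancel₀ _ h, mul_div_cancel₀ _ h]

theorem norm_extrap_sub_le {s : MSNState n} {L : ℝ} (hL : 0 < L) (hA : 0 ≤ s.A) (v : EucSp n) :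
    s.nextA L * ‖s.extrap L - v‖ ≤ s.A * ‖s.y - v‖ + s.weight L * ‖s.u - v‖ := by
  have h := nextA_pos (s := s) hL hA
  have ha := weight_pos (s := s) hL
  have e : s.nextA L • (s.extrap L - v) = s.A • (s.y - v) + s.weight L • (s.u - v) := by
    rw [smul_sub, nextA_smul_extrap hL hA, nextA]
    module
  calc _ = ‖s.nextA L • (s.extrap L - v)‖ := by rw [norm_smul, Real.norm_of_nonneg h.le]
    _ ≤ _ := by
      rw [e]
      refine (norm_add_le _ _).trans ?_
      rw [norm_smul, norm_smul, Real.norm_of_nonneg hA, Real.norm_of_nonneg ha.le]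

/-- The estimating energy `A_k (g(y^k) - g(v)) + ‖u^k - v‖² / 2`. -/
def energy (g : EucSp n → ℝ) (v : EucSp n) (s : MSNState n) : ℝ :=
  s.A * (g s.y - g v) + 1 / 2 * ‖s.u - v‖ ^ 2

theorem IsTrial.norm_gradient_add_le (hp : 2 ≤ p) {M : ℝ} (hM : 0 ≤ M) {g : EucSp n → ℝ}
    (hg : IsConvexSmooth p M g) {s : MSNState n} {L : ℝ} {w : EucSp n}
    (h : s.IsTrial p M g L w) :
    ‖gradient g w + L • (w - s.extrap L)‖ ≤
      (p + 1) * M / (p ! : ℝ) * ‖w - s.extrap L‖ ^ p := by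
  rw [← gradient_quadReg (hg.differentiable hp)]
  exact h.2.norm_gradient_le (by omega) (hg.quadReg hp h.1.le _) hM

/-- Of the `p` factors in the gradient bound, `p - 1` are absorbed by the upper condition on `L`.
What remains says that `w` is a proximal step from `x^k` with relative error 1/2. -/
theorem IsTrial.residual_le (hp : 2 ≤ p) {M : ℝ} (hM : 0 ≤ M) {g : EucSp n → ℝ}
    (hg : IsConvexSmooth p M g) {s : MSNState n} {L : ℝ} {w : EucSp n}
    (h : s.IsTrial p M g L w)
    (hu : 2 * (p + 1) * M / ((p ! : ℝ) * L) * ‖w - s.extrap L‖ ^ (p - 1) ≤ 1) :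
    ‖gradient g w + L • (w - s.extrap L)‖ ≤ L / 2 * ‖w - s.extrap L‖ := by
  refine (h.norm_gradient_add_le hp hM hg).trans ?_
  have hL := h.1
  have e : (p + 1) * M / (p ! : ℝ) * ‖w - s.extrap L‖ ^ p =
      (2 * (p + 1) * M / ((p ! : ℝ) * L) * ‖w - s.extrap L‖ ^ (p - 1)) *
        (L / 2 * ‖w - s.extrap L‖) := by
    have : ‖w - s.extrap L‖ ^ p = ‖w - s.extrap L‖ ^ (p - 1) * ‖w - s.extrap L‖ := by
      rw [← pow_succ]; congr 1; omega
    rw [this]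
    field_simp
  rw [e]
  exact mul_le_of_le_one_left (by positivity) hu

/-- Convexity at `y^{k+1}` is used towards `y^k` with weight `A_k` and towards `v` with weight
`a_{k+1}`. The inner products that remain combine with `a² ‖G‖²` into `a²` times the expanded
squared residual, and the relative error leaves `1 - 1/4 = 3/4` of `L² ‖y^{k+1} - x^k‖²`, halved by
the factor 1/2 in the energy. -/
theorem IsStep.energy_add_le (hp : 2 ≤ p) {M : ℝ} (hM : 0 ≤ M) {g : EucSp n → ℝ}
    (hg : IsConvexSmooth p M g) {s s' : MSNState n} {L : ℝ} (hA : 0 ≤ s.A)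
    (h : s.IsStep p M g L s') (v : EucSp n) :
    energy g v s' + 3 / 8 * (s'.A * L * ‖s'.y - s.extrap L‖ ^ 2) ≤ energy g v s := by
  have hL := h.trial.1
  have hres := h.trial.residual_le hp hM hg h.upper
  have ha := weight_pos (s := s) hL
  have hA' := nextA_pos (s := s) hL hA
  have hx := nextA_smul_extrap hL hA
  have haL := mul_weight_sq hL hA
  have hd := hg.differentiable hp
  have c1 := hg.convex.add_inner_gradient_le hd s'.y s.y
  have c2 := hg.convex.add_inner_gradient_le hd s'.y v
  set G := gradient g s'.y with hG
  set a := s.weight L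
  set x := s.extrap L
  have hAA : s.nextA L = s.A + a := rfl
  set A' := s.nextA L
  have e1 : s.A • (s.y - s'.y) + a • (v - s'.y) = A' • (x - s'.y) - a • (s.u - v) := by
    rw [smul_sub A', hx, hAA]
    module
  have e2 : s.A * ⟪G, s.y - s'.y⟫ + a * ⟪G, v - s'.y⟫ = A' * ⟪G, x - s'.y⟫ - a * ⟪G, s.u - v⟫ := by
    have := congrArg (fun z => ⟪G, z⟫) e1
    simpa only [inner_add_right, inner_sub_right G (A' • _), inner_smul_right] using this
  have e3 : ‖s'.u - v‖ ^ 2 = ‖s.u - v‖ ^ 2 - 2 * (a * ⟪G, s.u - v⟫) + a ^ 2 * ‖G‖ ^ 2 := by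
    rw [h.eq_u]
    have : s.u - a • G - v = (s.u - v) - a • G := by abel
    rw [this, norm_sub_sq_real, inner_smul_right, real_inner_comm, norm_smul, mul_pow,
      Real.norm_eq_abs, sq_abs]
  have e4 : ‖G + L • (s'.y - x)‖ ^ 2 =
      ‖G‖ ^ 2 - 2 * (L * ⟪G, x - s'.y⟫) + L ^ 2 * ‖s'.y - x‖ ^ 2 := by
    have : G + L • (s'.y - x) = G - L • (x - s'.y) := by module
    rw [this, norm_sub_sq_real, inner_smul_right, norm_smul, mul_pow, Real.norm_eq_abs, sq_abs,
      norm_sub_rev x]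
  have e5 : ‖G + L • (s'.y - x)‖ ^ 2 ≤ (L / 2 * ‖s'.y - x‖) ^ 2 := by gcongr
  have e6 : ‖G‖ ^ 2 - 2 * (L * ⟪G, x - s'.y⟫) ≤ - (3 / 4 * L ^ 2 * ‖s'.y - x‖ ^ 2) := by
    rw [e4] at e5
    linarith [e5, mul_pow (L / 2) ‖s'.y - x‖ 2]
  have e7 : a ^ 2 * (‖G‖ ^ 2 - 2 * (L * ⟪G, x - s'.y⟫)) ≤
      a ^ 2 * (- (3 / 4 * L ^ 2 * ‖s'.y - x‖ ^ 2)) := by gcongr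
  have e8 : a ^ 2 * (‖G‖ ^ 2 - 2 * (L * ⟪G, x - s'.y⟫)) =
      a ^ 2 * ‖G‖ ^ 2 - 2 * (A' * ⟪G, x - s'.y⟫) := by rw [← haL]; ring
  have e9 : a ^ 2 * (- (3 / 4 * L ^ 2 * ‖s'.y - x‖ ^ 2)) =
      - (3 / 4 * (A' * L * ‖s'.y - x‖ ^ 2)) := by rw [← haL]; ring
  have c3 := mul_le_mul_of_nonneg_left c1 hA
  have c4 := mul_le_mul_of_nonneg_left c2 ha.le
  have hsA : s'.A = A' := h.eq_A
  have e10 : A' * (g s'.y - g v) = (s.A + a) * (g s'.y - g v) := by rw [hAA]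
  rw [energy, energy, e3, hsA, e10]
  rw [e8, e9] at e7
  linarith

/-- `m` iterations of the accelerated method on `g` started at `z`. -/
structure IsRun (p : ℕ) (M : ℝ) (g : EucSp n → ℝ) (z : EucSp n) (m : ℕ) (σ : ℕ → MSNState n)
    (L : ℕ → ℝ) : Prop where
  init : σ 0 = start z
  step : ∀ j < m, (σ j).IsStep p M g (L j) (σ (j + 1))

variable {M : ℝ} {g : EucSp n → ℝ} {z : EucSp n} {m : ℕ} {σ : ℕ → MSNState n} {L : ℕ → ℝ}

theorem IsRun.A_nonneg (h : IsRun p M g z m σ L) {j : ℕ} (hj : j ≤ m) : 0 ≤ (σ j).A := by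
  induction j with
  | zero => rw [h.init]; exact le_rfl
  | succ j ih =>
    rw [(h.step j hj).eq_A]
    exact (nextA_pos (h.step j hj).trial.1 (ih (by omega))).le

theorem IsRun.energy_add_sum_le (hp : 2 ≤ p) (hM : 0 ≤ M) (hg : IsConvexSmooth p M g)
    (h : IsRun p M g z m σ L) (v : EucSp n) {j : ℕ} (hj : j ≤ m) :
    energy g v (σ j) + 3 / 8 * ∑ i ∈ Finset.range j,
      (σ (i + 1)).A * L i * ‖(σ (i + 1)).y - (σ i).extrap (L i)‖ ^ 2 ≤ 1 / 2 * ‖z - v‖ ^ 2 := by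
  induction j with
  | zero => rw [h.init]; simp [energy, start]
  | succ j ih =>
    have h1 := ih (by omega)
    have h2 := (h.step j hj).energy_add_le hp hM hg (h.A_nonneg (by omega)) v
    rw [Finset.sum_range_succ, mul_add]
    linarith

theorem IsRun.sum_nonneg (h : IsRun p M g z m σ L) {j : ℕ} (hj : j ≤ m) :
    0 ≤ ∑ i ∈ Finset.range j,
      (σ (i + 1)).A * L i * ‖(σ (i + 1)).y - (σ i).extrap (L i)‖ ^ 2 := by
  refine Finset.sum_nonneg fun i hi => ?_
  have hi' := Finset.mem_range.1 hi
  have := h.A_nonneg (show i + 1 ≤ m by omega)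
  have := (h.step i (by omega)).trial.1
  positivity

variable {v : EucSp n} {D : ℝ}

theorem IsRun.norm_u_sub_le (hp : 2 ≤ p) (hM : 0 ≤ M) (hg : IsConvexSmooth p M g)
    (h : IsRun p M g z m σ L) (hv : IsMinOn g Set.univ v) (hD : ‖z - v‖ ≤ D) {j : ℕ}
    (hj : j ≤ m) : ‖(σ j).u - v‖ ≤ D := by
  have h1 := h.energy_add_sum_le hp hM hg v hj
  have h2 := h.sum_nonneg hj
  have h3 : 0 ≤ (σ j).A * (g (σ j).y - g v) :=
    mul_nonneg (h.A_nonneg hj) (sub_nonneg.2 (hv (Set.mem_univ _)))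
  rw [energy] at h1
  refine (abs_le_of_sq_le_sq' ?_ (norm_nonneg (z - v))).2.trans hD
  linarith

/-- The energy controls `u^k` directly, but `y^k` only through the drops. The bound propagates
without growth because the error made in a step is proportional to `a_{k+1}`, like the weight of
`u^k` in `x^k`: `6/5 a + 11/5 A + a = 11/5 (A + a)`. -/
theorem IsRun.norm_y_sub_le (hp : 2 ≤ p) (hM : 0 ≤ M) (hg : IsConvexSmooth p M g)
    (h : IsRun p M g z m σ L) (hv : IsMinOn g Set.univ v) (hD : ‖z - v‖ ≤ D) {j : ℕ}
    (hj : j ≤ m) : ‖(σ j).y - v‖ ≤ 11 / 5 * D := by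
  have hD0 : 0 ≤ D := (norm_nonneg _).trans hD
  induction j with
  | zero =>
    rw [h.init]
    change ‖z - v‖ ≤ _
    linarith
  | succ j ih =>
    have ih' := ih (by omega)
    have hs := h.step j hj
    have hL := hs.trial.1
    have hA := h.A_nonneg (show j ≤ m by omega)
    have hA' := nextA_pos (s := σ j) hL hA
    have ha := weight_pos (s := σ j) hL
    have hu := h.norm_u_sub_le hp hM hg hv hD (show j ≤ m by omega)
    have hx := norm_extrap_sub_le hL hA v
    have haL := mul_weight_sq hL hA
    have h1 := h.energy_add_sum_le hp hM hg v hj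
    have h2 := h.sum_nonneg (show j ≤ m by omega)
    have h3 : 0 ≤ (σ (j + 1)).A * (g (σ (j + 1)).y - g v) :=
      mul_nonneg (h.A_nonneg hj) (sub_nonneg.2 (hv (Set.mem_univ _)))
    rw [energy, Finset.sum_range_succ, hs.eq_A] at h1
    rw [hs.eq_A] at h3
    set r := ‖(σ (j + 1)).y - (σ j).extrap (L j)‖ with hr
    have hr0 : 0 ≤ r := norm_nonneg _
    set a := (σ j).weight (L j)
    have hAA : (σ j).nextA (L j) = (σ j).A + a := rfl
    set A' := (σ j).nextA (L j)
    have h4 : A' * L j * r ^ 2 ≤ 4 / 3 * D ^ 2 := by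
      have h5 : ‖z - v‖ ^ 2 ≤ D ^ 2 := by gcongr
      have h6 := sq_nonneg ‖(σ (j + 1)).u - v‖
      linarith
    -- Uses `L a² = A'` and `4/3 ≤ (6/5)²`.
    have h7 : (A' * r) ^ 2 ≤ (6 / 5 * (D * a)) ^ 2 := by
      have : (A' * r) ^ 2 = a ^ 2 * (A' * L j * r ^ 2) := by
        calc (A' * r) ^ 2 = A' * (L j * a ^ 2) * r ^ 2 := by rw [haL]; ring
          _ = _ := by ring
      rw [this]
      calc _ ≤ a ^ 2 * (4 / 3 * D ^ 2) := by gcongr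
        _ ≤ _ := by nlinarith [sq_nonneg (a * D)]
    have h8 : A' * r ≤ 6 / 5 * (D * a) := (abs_le_of_sq_le_sq' h7 (by positivity)).2
    have h9 : ‖(σ (j + 1)).y - v‖ ≤ r + ‖(σ j).extrap (L j) - v‖ :=
      norm_sub_le_norm_sub_add_norm_sub _ _ _
    refine le_of_mul_le_mul_left ?_ hA'
    have h10 : (σ j).A * ‖(σ j).y - v‖ ≤ (σ j).A * (11 / 5 * D) := by gcongr
    have h11 : a * ‖(σ j).u - v‖ ≤ a * D := by gcongr
    have h12 := mul_le_mul_of_nonneg_left h9 hA'.le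
    rw [mul_add] at h12
    calc _ ≤ _ := h12
      _ ≤ 6 / 5 * (D * a) + ((σ j).A * (11 / 5 * D) + a * D) := by linarith
      _ = _ := by rw [hAA]; ring

/-- Bounds the constant that the growth lemma produces by the prescribed one. With `m = p + 1`, the
root of 4/3 is absorbed in `(6/5)^m`, and `(6m/5)^m ≤ 2^(3m²/4)`. -/
theorem rate_constant_le (hp : 2 ≤ p) :
    1 / 2 * ((4 * (p + 1) / (p ! : ℝ)) * ((4 : ℝ) / 3) ^ (((p : ℝ) - 1) / 2) *
      ((p : ℝ) + 1) ^ (p + 1)) ≤ rateConst p := by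
  have hp' : (2 : ℝ) ≤ p := by exact_mod_cast hp
  have hfac : (0 : ℝ) < p ! := by positivity
  have h2 : (0 : ℝ) < 2 := by norm_num
  -- `6 m / 5 ≤ 2 ^ (3 m / 4)` for `m ≥ 3`
  have hkey : ∀ m : ℕ, 3 ≤ m → 6 / 5 * (m : ℝ) ≤ (2 : ℝ) ^ (3 * (m : ℝ) / 4) := by
    intro m hm
    induction m, hm using Nat.le_induction with
    | base =>
      have : (2 : ℝ) ^ (3 * ((3 : ℕ) : ℝ) / 4) = 2 ^ (2 : ℕ) * 2 ^ ((1 : ℝ) / 4) := by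
        rw [← Real.rpow_natCast, ← Real.rpow_add h2]; norm_num
      rw [this]
      have h3 : (1 : ℝ) ≤ 2 ^ ((1 : ℝ) / 4) := Real.one_le_rpow (by norm_num) (by norm_num)
      push_cast
      linarith
    | succ m hm ih =>
      have hm' : (3 : ℝ) ≤ m := by exact_mod_cast hm
      have e : (2 : ℝ) ^ (3 * ((m + 1 : ℕ) : ℝ) / 4) = 2 ^ (3 * (m : ℝ) / 4) * 2 ^ ((3 : ℝ) / 4) := by
        rw [← Real.rpow_add h2]; push_cast; ring_nf
      have h43 : (4 : ℝ) / 3 ≤ 2 ^ ((3 : ℝ) / 4) := by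
        have h5 : ((4 : ℝ) / 3) ^ (4 : ℕ) ≤ (2 ^ ((3 : ℝ) / 4)) ^ (4 : ℕ) := by
          rw [← Real.rpow_natCast (2 ^ ((3 : ℝ) / 4)), ← Real.rpow_mul h2.le,
            show (3 : ℝ) / 4 * ((4 : ℕ) : ℝ) = ((3 : ℕ) : ℝ) by norm_num, Real.rpow_natCast]
          norm_num
        exact le_of_pow_le_pow_left₀ (by norm_num) (by positivity) h5
      rw [e]
      calc _ ≤ (6 / 5 * (m : ℝ)) * (4 / 3) := by push_cast; linarith
        _ ≤ _ := by gcongr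
  have h3 := hkey (p + 1) (by omega)
  have h4 : ((4 : ℝ) / 3) ^ (((p : ℝ) - 1) / 2) ≤ (6 / 5 : ℝ) ^ (p + 1) := by
    have h5 : (4 : ℝ) / 3 ≤ (6 / 5 : ℝ) ^ (2 : ℝ) := by
      rw [Real.rpow_two]; norm_num
    calc _ ≤ ((6 / 5 : ℝ) ^ (2 : ℝ)) ^ (((p : ℝ) - 1) / 2) :=
          Real.rpow_le_rpow (by norm_num) h5 (by linarith)
      _ = (6 / 5 : ℝ) ^ ((p : ℝ) - 1) := by rw [← Real.rpow_mul (by norm_num)]; congr 1; ring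
      _ ≤ (6 / 5 : ℝ) ^ ((p + 1 : ℕ) : ℝ) :=
          Real.rpow_le_rpow_of_exponent_le (by norm_num) (by push_cast; linarith)
      _ = _ := Real.rpow_natCast _ _
  have h6 : (6 / 5 : ℝ) ^ (p + 1) * ((p : ℝ) + 1) ^ (p + 1) ≤
      2 ^ (3 * ((p : ℝ) + 1) ^ 2 / 4) := by
    rw [← mul_pow]
    calc _ ≤ ((2 : ℝ) ^ (3 * ((p + 1 : ℕ) : ℝ) / 4)) ^ (p + 1) := by
          push_cast at h3 ⊢
          gcongr
      _ = _ := by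
        rw [← Real.rpow_natCast, ← Real.rpow_mul h2.le]
        push_cast
        congr 1
        ring
  have e : rateConst p = 2 * (2 ^ (3 * ((p : ℝ) + 1) ^ 2 / 4)) * ((p + 1) / (p ! : ℝ)) := by
    rw [rateConst]
    have : (3 * ((p : ℝ) + 1) ^ 2 + 4) / 4 = 3 * ((p : ℝ) + 1) ^ 2 / 4 + 1 := by ring
    rw [this, Real.rpow_add_one h2.ne']
    ring
  rw [e]
  calc _ = 2 * (((4 : ℝ) / 3) ^ (((p : ℝ) - 1) / 2) * ((p : ℝ) + 1) ^ (p + 1)) *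
        ((p + 1) / (p ! : ℝ)) := by ring
    _ ≤ 2 * ((6 / 5 : ℝ) ^ (p + 1) * ((p : ℝ) + 1) ^ (p + 1)) * ((p + 1) / (p ! : ℝ)) := by
        gcongr
    _ ≤ _ := by gcongr

/-- The growth bound for `A_m` is multiplied by the gap and combined with `A_m · gap ≤ D²/2`.
Nothing is divided by `A_m`, so `m = 0` is covered. -/
theorem IsRun.rate (hp : 2 ≤ p) (hM : 0 < M) (hg : IsConvexSmooth p M g)
    (h : IsRun p M g z m σ L) (hv : IsMinOn g Set.univ v) (hD : ‖z - v‖ ≤ D) :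
    (m : ℝ) ^ ((3 * (p : ℝ) + 1) / 2) * (g (σ m).y - g v) ≤ rateConst p * M * D ^ (p + 1) := by
  have hD0 : 0 ≤ D := (norm_nonneg _).trans hD
  have hp' : (2 : ℝ) ≤ p := by exact_mod_cast hp
  have hgap : 0 ≤ g (σ m).y - g v := sub_nonneg.2 (hv (Set.mem_univ _))
  have hE := h.energy_add_sum_le hp hM.le hg v le_rfl
  have hsum := h.sum_nonneg (le_refl m)
  have hDsq : ‖z - v‖ ^ 2 ≤ D ^ 2 := by gcongr
  rw [energy] at hE
  have hu := sq_nonneg ‖(σ m).u - v‖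
  have hAgap : 0 ≤ (σ m).A * (g (σ m).y - g v) := mul_nonneg (h.A_nonneg le_rfl) hgap
  have hAgap' : (σ m).A * (g (σ m).y - g v) ≤ 1 / 2 * D ^ 2 := by linarith
  have hgrow := large_step_growth hp m (A := fun j => (σ j).A)
    (a := fun j => (σ j).weight (L j)) (L := L)
    (r := fun j => ‖(σ (j + 1)).y - (σ j).extrap (L j)‖) (κ := 4 * (p + 1) / (p ! : ℝ) * M)
    (G := 4 / 3 * D ^ 2) (by positivity) (h.A_nonneg (by omega)) (fun i hi => (h.step i hi).eq_A)
    (fun i hi => weight_pos (h.step i hi).trial.1)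
    (fun i hi => by
      rw [(h.step i hi).eq_A]
      exact mul_weight_sq (h.step i hi).trial.1 (h.A_nonneg (by omega)))
    (fun i hi => by
      have := (h.step i hi).lower
      by_contra hcon
      have h0 : ‖(σ (i + 1)).y - (σ i).extrap (L i)‖ = 0 :=
        le_antisymm (not_lt.1 hcon) (norm_nonneg _)
      rw [h0, zero_pow (by omega), mul_zero] at this
      norm_num at this)
    (fun i hi => by
      have h1 := (h.step i hi).lower
      have hL := (h.step i hi).trial.1
      have e : 2 * (p + 1) * M / ((p ! : ℝ) * L i) *
          ‖(σ (i + 1)).y - (σ i).extrap (L i)‖ ^ (p - 1) =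
          (4 * (p + 1) / (p ! : ℝ) * M * ‖(σ (i + 1)).y - (σ i).extrap (L i)‖ ^ (p - 1)) /
            (2 * L i) := by
        field_simp; ring
      rw [e, le_div_iff₀ (by positivity)] at h1
      linarith)
    (by linarith)
  calc _ ≤ (4 * (p + 1) / (p ! : ℝ) * M * (4 / 3 * D ^ 2) ^ (((p : ℝ) - 1) / 2) *
        ((p : ℝ) + 1) ^ (p + 1) * (σ m).A) * (g (σ m).y - g v) := by gcongr
    _ = 4 * (p + 1) / (p ! : ℝ) * M * (4 / 3 * D ^ 2) ^ (((p : ℝ) - 1) / 2) *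
        ((p : ℝ) + 1) ^ (p + 1) * ((σ m).A * (g (σ m).y - g v)) := by ring
    _ ≤ 4 * (p + 1) / (p ! : ℝ) * M * (4 / 3 * D ^ 2) ^ (((p : ℝ) - 1) / 2) *
        ((p : ℝ) + 1) ^ (p + 1) * (1 / 2 * D ^ 2) := by gcongr
    _ = 1 / 2 * ((4 * (p + 1) / (p ! : ℝ)) * ((4 : ℝ) / 3) ^ (((p : ℝ) - 1) / 2) *
      ((p : ℝ) + 1) ^ (p + 1)) * M * D ^ (p + 1) := by
        have e1 : (4 / 3 * D ^ 2) ^ (((p : ℝ) - 1) / 2) =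
            ((4 : ℝ) / 3) ^ (((p : ℝ) - 1) / 2) * D ^ (p - 1) := by
          rw [Real.mul_rpow (by norm_num) (by positivity), ← Real.rpow_natCast_mul hD0,
            ← Real.rpow_natCast D (p - 1), Nat.cast_sub (by omega)]
          congr 2
          push_cast
          ring
        have e2 : D ^ (p + 1) = D ^ (p - 1) * D ^ 2 := by
          rw [← pow_add]; congr 1; omega
        rw [e1, e2]
        ring
    _ ≤ _ := by
        have := rate_constant_le hp
        gcongr

end MSNState

end Accelerated

end

noncomputable section

/-! ### Restarts: iteration count and final gradient -/

section Restarts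

open scoped RealInnerProductSpace

variable {n p : ℕ} {M R ε : ℝ}

theorem regMu_pos (hR : 0 < R) (hε : 0 < ε) : 0 < regMu R ε := by rw [regMu]; positivity

theorem radius_pos (hR : 0 < R) (k : ℕ) : 0 < radius R k := by rw [radius]; positivity

theorem radius_zero : radius R 0 = R := by simp [radius]

theorem radius_le (hR : 0 < R) (k : ℕ) : radius R k ≤ R := by
  rw [radius, div_le_iff₀ (by positivity)]
  exact le_mul_of_one_le_right hR.le (one_le_pow₀ (by norm_num))

theorem rateConst_pos : 0 < rateConst p := by rw [rateConst]; positivity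

/-- The argument of `log⁺` in `iterBound`. -/
def logArg (p : ℕ) (M R ε : ℝ) : ℝ :=
  2 ^ (((p : ℝ) + 1) / p) * ((p + 1)! : ℝ) * ((p : ℝ) * M) ^ (1 / (p : ℝ)) * R / ε ^ (1 / (p : ℝ))

theorem loopTest_iff (hp : 2 ≤ p) (hM : 0 < M) (hR : 0 < R) (hε : 0 < ε) (k : ℕ) :
    loopTest p M R ε k ↔ (4 : ℝ) ^ k ≤ logArg p M R ε := by
  have hp0 : (0 : ℝ) < p := by positivity
  have h2 : (0 : ℝ) < 2 := by norm_num
  rw [loopTest, tolTilde, regMu, radius, logArg]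
  have e0 : ((p : ℝ) + 1) / p = 1 / p + 1 := by field_simp; ring
  have e1 : (ε / 2) ^ (((p : ℝ) + 1) / p) = ε ^ (1 / (p : ℝ)) / 2 ^ (1 / (p : ℝ)) * (ε / 2) := by
    rw [e0, Real.rpow_add_one (by positivity), Real.div_rpow hε.le h2.le]
  have e2 : (2 : ℝ) ^ (((p : ℝ) + 1) / p) = 2 ^ (1 / (p : ℝ)) * 2 := by
    rw [e0, Real.rpow_add_one (by positivity)]
  have e3 : ε / (4 * R) * (R / 2 ^ k) ^ 2 / 2 = ε * R / (8 * 4 ^ k) := by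
    rw [div_pow, ← pow_mul, mul_comm k 2, pow_mul]
    norm_num
    field_simp
    norm_num
  rw [e1, e2, e3]
  have hx : 0 < ε ^ (1 / (p : ℝ)) := by positivity
  have hy : (0 : ℝ) < 2 ^ (1 / (p : ℝ)) := by positivity
  have hz : 0 < ((p : ℝ) * M) ^ (1 / (p : ℝ)) := by positivity
  have hf : (0 : ℝ) < ((p + 1)! : ℝ) := by positivity
  have h4 : (0 : ℝ) < 4 ^ k := by positivity
  generalize ε ^ (1 / (p : ℝ)) = x at *
  generalize (2 : ℝ) ^ (1 / (p : ℝ)) = y at *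
  generalize ((p : ℝ) * M) ^ (1 / (p : ℝ)) = z at *
  generalize ((p + 1)! : ℝ) = c at *
  generalize (4 : ℝ) ^ k = t at *
  rw [div_le_div_iff₀ (by positivity) (by positivity), le_div_iff₀ hx]
  have e4 : x / y * (ε / 2) * (8 * t) = (4 * ε / y) * (t * x) := by field_simp; ring
  have e5 : ε * R * (8 * c * z) = (4 * ε / y) * (y * 2 * c * z * R) := by field_simp; ring
  rw [e4, e5]
  exact mul_le_mul_iff_right₀ (by positivity)

theorem logArg_pos (hp : 2 ≤ p) (hM : 0 < M) (hR : 0 < R) (hε : 0 < ε) : 0 < logArg p M R ε := by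
  have : (0 : ℝ) < p := by positivity
  rw [logArg]; positivity

/-- Both terms of the complexity bound are governed by the single quantity `M R^p / ε`; this links
the argument of the logarithm to it. -/
theorem logArg_rpow (hp : 2 ≤ p) (hM : 0 < M) (hε : 0 < ε) :
    logArg p M R ε ^ p = 2 ^ (p + 1) * ((p + 1)! : ℝ) ^ p * p * (M * R ^ p / ε) := by
  have hp0 : (p : ℝ) ≠ 0 := by positivity
  rw [logArg, div_pow, mul_pow, mul_pow, mul_pow, ← Real.rpow_mul_natCast (by norm_num),
    ← Real.rpow_mul_natCast (by positivity), ← Real.rpow_mul_natCast hε.le,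
    div_mul_cancel₀ _ hp0, div_mul_cancel₀ _ hp0, Real.rpow_one, Real.rpow_one]
  have : (2 : ℝ) ^ ((p : ℝ) + 1) = 2 ^ (p + 1) := by
    rw [← Real.rpow_natCast]; push_cast; rfl
  rw [this]
  ring

theorem iterBound_eq (hM : 0 < M) (hR : 0 < R) (hε : 0 < ε) :
    iterBound p M R ε = (M * R ^ p / ε) ^ (2 / (3 * (p : ℝ) + 1)) +
      Real.posLog (logArg p M R ε) := by
  rw [iterBound, logArg, Real.div_rpow (by positivity) hε.le, Real.mul_rpow hM.le (by positivity),
    ← Real.rpow_natCast_mul hR.le]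
  congr 4
  ring

theorem iterBound_nonneg (hM : 0 < M) (hR : 0 < R) (hε : 0 < ε) : 0 ≤ iterBound p M R ε := by
  rw [iterBound_eq hM hR hε]
  exact add_nonneg (by positivity) Real.posLog_nonneg

/-- Each `N_k` is at most a multiple of `q^ν ρ^k` plus 1, where `q = M R^p / ε` and `ρ < 1` because
`p ≥ 2`. The first parts form a geometric series and the ones add up to `K`, which is logarithmic
since the loop test means `4^k ≤ logArg`. -/
theorem exists_sum_innerCount_le (hp : 2 ≤ p) : ∃ C : ℝ, 0 < C ∧ ∀ (M R ε : ℝ), 0 < M → 0 < R →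
    0 < ε → ∀ K : ℕ, (∀ k < K, loopTest p M R ε k) →
      ((∑ k ∈ Finset.range K, innerCount p M R ε k : ℕ) : ℝ) ≤ C * iterBound p M R ε := by
  have hp' : (2 : ℝ) ≤ p := by exact_mod_cast hp
  set ν : ℝ := 2 / (3 * (p : ℝ) + 1) with hν
  have hν0 : 0 < ν := by positivity
  set ρ : ℝ := (1 / 2 ^ (p - 1)) ^ ν with hρ
  have hρ0 : 0 < ρ := by positivity
  have hρ1 : ρ < 1 := by
    refine Real.rpow_lt_one (by positivity) ?_ hν0
    rw [div_lt_one (by positivity)]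
    exact one_lt_pow₀ (by norm_num) (by omega)
  have hc := rateConst_pos (p := p)
  set C₁ : ℝ := (32 * rateConst p) ^ ν / (1 - ρ) with hC₁
  set C₂ : ℝ := (2 ^ (p + 1) * ((p + 1)! : ℝ) ^ p * p) ^ ν with hC₂
  have h1ρ : 0 < 1 - ρ := by linarith
  have hC₁0 : 0 < C₁ := by positivity
  have hC₂0 : 0 < C₂ := by
    have : (0 : ℝ) < p := by linarith
    positivity
  refine ⟨C₁ + C₂ + 1, by positivity, fun M R ε hM hR hε K hK => ?_⟩
  have hB0 := iterBound_nonneg (p := p) hM hR hε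
  rcases Nat.eq_zero_or_pos K with rfl | hKpos
  · simp only [Finset.range_zero, Finset.sum_empty, Nat.cast_zero]
    positivity
  set q : ℝ := M * R ^ p / ε with hq
  have hq0 : 0 < q := by positivity
  have hlog0 : 0 ≤ Real.posLog (logArg p M R ε) := Real.posLog_nonneg
  have hN : ∀ k, (innerCount p M R ε k : ℝ) ≤ (32 * rateConst p) ^ ν * q ^ ν * ρ ^ k + 1 := by
    intro k
    have e : 8 * rateConst p * M * radius R k ^ (p - 1) / regMu R ε =
        32 * rateConst p * q * (1 / 2 ^ (p - 1)) ^ k := by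
      have e1 : R ^ p = R ^ (p - 1) * R := by rw [← pow_succ]; congr 1; omega
      rw [radius, regMu, hq, div_pow, div_pow, one_pow, ← pow_mul, ← pow_mul, mul_comm k, e1]
      field_simp
      norm_num
    have e2 : (8 * rateConst p * M * radius R k ^ (p - 1) / regMu R ε) ^ ν =
        (32 * rateConst p) ^ ν * q ^ ν * ρ ^ k := by
      rw [e, Real.mul_rpow (by positivity) (by positivity),
        Real.mul_rpow (by positivity) (by positivity), hρ, ← Real.rpow_mul_natCast (by positivity),
        ← Real.rpow_natCast_mul (by positivity), mul_comm ν]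
    rw [innerCount, ← hν, e2, Nat.cast_max]
    refine max_le (Nat.ceil_lt_add_one (by positivity)).le ?_
    rw [Nat.cast_one]
    have : 0 ≤ (32 * rateConst p) ^ ν * q ^ ν * ρ ^ k := by positivity
    linarith
  have hgeom : ∑ k ∈ Finset.range K, ρ ^ k ≤ 1 / (1 - ρ) := by
    rw [one_div, ← tsum_geometric_of_lt_one hρ0.le hρ1]
    exact (summable_geometric_of_lt_one hρ0.le hρ1).sum_le_tsum _ (fun _ _ => by positivity)
  have hsum : ((∑ k ∈ Finset.range K, innerCount p M R ε k : ℕ) : ℝ) ≤ C₁ * q ^ ν + K := by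
    push_cast
    calc _ ≤ ∑ k ∈ Finset.range K, ((32 * rateConst p) ^ ν * q ^ ν * ρ ^ k + 1) :=
          Finset.sum_le_sum fun k _ => hN k
      _ = (32 * rateConst p) ^ ν * q ^ ν * ∑ k ∈ Finset.range K, ρ ^ k + K := by
          rw [Finset.sum_add_distrib, Finset.mul_sum]; simp
      _ ≤ (32 * rateConst p) ^ ν * q ^ ν * (1 / (1 - ρ)) + K := by gcongr
      _ = _ := by rw [hC₁]; ring
  have hlast := (loopTest_iff hp hM hR hε _).1 (hK (K - 1) (by omega))
  have hQ1 : 1 ≤ logArg p M R ε := le_trans (one_le_pow₀ (by norm_num)) hlast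
  have hKlog : (K : ℝ) ≤ 1 + Real.posLog (logArg p M R ε) := by
    rw [Real.posLog_eq_log (by rw [abs_of_nonneg (by linarith)]; exact hQ1)]
    have h1 := Real.log_le_log (by positivity) hlast
    rw [Real.log_pow, Nat.cast_sub (by omega), Nat.cast_one] at h1
    have h4 : 1 ≤ Real.log 4 := by
      rw [Real.le_log_iff_exp_le (by norm_num)]
      linarith [Real.exp_one_lt_d9]
    have h5 : (0 : ℝ) ≤ K - 1 := by
      have : (1 : ℝ) ≤ K := by exact_mod_cast hKpos
      linarith
    nlinarith
  -- Absorbs the additive 1 in the bound for `K`: once a single restart takes place, `logArg` is at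
  -- least 1, hence `q` is bounded below.
  have hone : 1 ≤ C₂ * q ^ ν := by
    rw [hC₂, ← Real.mul_rpow (by positivity) hq0.le, hq, ← logArg_rpow hp hM hε]
    exact Real.one_le_rpow (one_le_pow₀ hQ1) hν0.le
  rw [iterBound_eq hM hR hε, ← hν, ← hq]
  have hqν : 0 < q ^ ν := by positivity
  nlinarith

theorem rpow_innerCount_ge (hM : 0 < M) (hR : 0 < R) (hε : 0 < ε) (k : ℕ) :
    8 * rateConst p * M * radius R k ^ (p - 1) / regMu R ε ≤
      (innerCount p M R ε k : ℝ) ^ ((3 * (p : ℝ) + 1) / 2) := by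
  have hc := rateConst_pos (p := p)
  have hr := radius_pos hR k
  have hμ := regMu_pos hR hε
  set X := 8 * rateConst p * M * radius R k ^ (p - 1) / regMu R ε with hX
  have hX0 : 0 ≤ X := by positivity
  have h1 : X ^ (2 / (3 * (p : ℝ) + 1)) ≤ innerCount p M R ε k := by
    rw [innerCount, Nat.cast_max]
    exact (Nat.le_ceil _).trans (le_max_left _ _)
  calc X = (X ^ (2 / (3 * (p : ℝ) + 1))) ^ ((3 * (p : ℝ) + 1) / 2) := by
        rw [← Real.rpow_mul hX0]
        have : 2 / (3 * (p : ℝ) + 1) * ((3 * (p : ℝ) + 1) / 2) = 1 := by field_simp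
        rw [this, Real.rpow_one]
    _ ≤ _ := by gcongr

variable {f : EucSp n → ℝ} {x₀ xstar v : EucSp n}

theorem exists_isMinOn_quadReg {μ : ℝ} (hμ : 0 < μ) (hd : Differentiable ℝ f)
    (hs : IsMinOn f Set.univ xstar) (x₀ : EucSp n) : ∃ v, IsMinOn (quadReg f μ x₀) Set.univ v := by
  refine exists_isMinOn_of_growth (b := f xstar) (a := μ / 2) (m := 2) ?_ (by positivity)
    (by norm_num) x₀ fun w => ?_
  · have := hd.continuous
    unfold quadReg
    fun_prop
  · have : f xstar ≤ f w := hs (Set.mem_univ w)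
    simp only [quadReg]
    linarith

theorem norm_sub_isMinOn_quadReg_le {μ : ℝ} (hμ : 0 < μ) (hs : IsMinOn f Set.univ xstar)
    (hx : ‖x₀ - xstar‖ ≤ R) (hv : IsMinOn (quadReg f μ x₀) Set.univ v) : ‖x₀ - v‖ ≤ R := by
  have h1 : quadReg f μ x₀ v ≤ quadReg f μ x₀ xstar := hv (Set.mem_univ _)
  have h2 : f xstar ≤ f v := hs (Set.mem_univ _)
  simp only [quadReg] at h1
  have h3 : μ / 2 * ‖v - x₀‖ ^ 2 ≤ μ / 2 * ‖xstar - x₀‖ ^ 2 := by linarith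
  have h4 : ‖v - x₀‖ ^ 2 ≤ ‖xstar - x₀‖ ^ 2 := le_of_mul_le_mul_left h3 (by positivity)
  have h5 := (abs_le_of_sq_le_sq' h4 (norm_nonneg _)).2
  rw [norm_sub_rev x₀ v]
  rw [norm_sub_rev xstar] at h5
  linarith

theorem quadReg_gap_ge {μ : ℝ} (hf : ConvexOn ℝ Set.univ f) (hd : Differentiable ℝ f)
    (hv : IsMinOn (quadReg f μ x₀) Set.univ v) (w : EucSp n) :
    μ / 2 * ‖w - v‖ ^ 2 ≤ quadReg f μ x₀ w - quadReg f μ x₀ v := by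
  have h := quadReg_add_le hf hd μ x₀ v w
  rw [gradient_eq_zero_of_isMinOn hv, inner_zero_left] at h
  linarith

theorem norm_le_of_quadReg_gap_le {μ ρ : ℝ} (hμ : 0 < μ) (hρ : 0 ≤ ρ)
    (hf : ConvexOn ℝ Set.univ f) (hd : Differentiable ℝ f)
    (hv : IsMinOn (quadReg f μ x₀) Set.univ v) {w : EucSp n}
    (h : quadReg f μ x₀ w - quadReg f μ x₀ v ≤ μ / 2 * ρ ^ 2) : ‖w - v‖ ≤ ρ := by
  have h1 := (quadReg_gap_ge hf hd hv w).trans h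
  have h2 : ‖w - v‖ ^ 2 ≤ ρ ^ 2 := le_of_mul_le_mul_left h1 (by positivity)
  exact (abs_le_of_sq_le_sq' h2 hρ).2

namespace Execution

variable {e : Execution n}

theorem IsRestarts.state_zero (h : e.IsRestarts p M R ε f x₀) {k : ℕ} (hk : k ≤ e.K) :
    e.state k 0 = MSNState.start (e.state k 0).y := by
  cases k with
  | zero => rw [h.init]; rfl
  | succ k => rw [h.next k hk]; rfl

theorem IsRestarts.isRun (h : e.IsRestarts p M R ε f x₀) {k : ℕ} (hk : k < e.K) :
    MSNState.IsRun p M (quadReg f (regMu R ε) x₀) (e.state k 0).y (innerCount p M R ε k)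
      (e.state k) (e.L k) :=
  ⟨h.state_zero hk.le, h.step k hk⟩

theorem IsRestarts.gap_succ_le (hp : 2 ≤ p) (hM : 0 < M) (hR : 0 < R) (hε : 0 < ε)
    (hf : IsConvexSmooth p M f) (hv : IsMinOn (quadReg f (regMu R ε) x₀) Set.univ v)
    (h : e.IsRestarts p M R ε f x₀) {k : ℕ} (hk : k < e.K)
    (hD : ‖(e.state k 0).y - v‖ ≤ radius R k) :
    quadReg f (regMu R ε) x₀ (e.state (k + 1) 0).y - quadReg f (regMu R ε) x₀ v ≤
      regMu R ε / 2 * radius R (k + 1) ^ 2 := by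
  have hμ := regMu_pos hR hε
  have hr := radius_pos hR k
  have hrun := (h.isRun hk).rate hp hM (hf.quadReg hp hμ.le x₀) hv hD
  have hN := rpow_innerCount_ge (p := p) hM hR hε k
  have hc := rateConst_pos (p := p)
  rw [h.next k hk]
  change quadReg f (regMu R ε) x₀ (e.state k (innerCount p M R ε k)).y - _ ≤ _
  set gap := quadReg f (regMu R ε) x₀ (e.state k (innerCount p M R ε k)).y -
    quadReg f (regMu R ε) x₀ v with hgap
  have hgap0 : 0 ≤ gap := sub_nonneg.2 (hv (Set.mem_univ _))
  have h1 := (mul_le_mul_of_nonneg_right hN hgap0).trans hrun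
  have e1 : radius R k ^ (p + 1) = radius R k ^ (p - 1) * radius R k ^ 2 := by
    rw [← pow_add]; congr 1; omega
  have e2 : radius R (k + 1) = radius R k / 2 := by
    rw [radius, radius, pow_succ]; field_simp
  rw [e1] at h1
  have h2 : (rateConst p * M * radius R k ^ (p - 1)) * (8 / regMu R ε * gap) ≤
      (rateConst p * M * radius R k ^ (p - 1)) * radius R k ^ 2 := by
    calc _ = 8 * rateConst p * M * radius R k ^ (p - 1) / regMu R ε * gap := by ring
      _ ≤ _ := h1
      _ = _ := by ring
  have h3 := le_of_mul_le_mul_left h2 (by positivity)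
  rw [div_mul_eq_mul_div, div_le_iff₀ hμ] at h3
  rw [e2]
  linarith

theorem IsRestarts.norm_sub_le (hp : 2 ≤ p) (hM : 0 < M) (hR : 0 < R) (hε : 0 < ε)
    (hf : IsConvexSmooth p M f) (hs : IsMinOn f Set.univ xstar) (hx : ‖x₀ - xstar‖ ≤ R)
    (hv : IsMinOn (quadReg f (regMu R ε) x₀) Set.univ v)
    (h : e.IsRestarts p M R ε f x₀) {k : ℕ} (hk : k ≤ e.K) :
    ‖(e.state k 0).y - v‖ ≤ radius R k := by
  have hμ := regMu_pos hR hε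
  induction k with
  | zero =>
    rw [h.init, radius_zero]
    exact norm_sub_isMinOn_quadReg_le hμ hs hx hv
  | succ k ih =>
    exact norm_le_of_quadReg_gap_le hμ (radius_pos hR _).le hf.convex (hf.differentiable hp) hv
      (h.gap_succ_le hp hM hR hε hf hv hk (ih (by omega)))

end Execution

theorem succ_div_factorial_le (hp : 2 ≤ p) : ((p : ℝ) + 1) / (p ! : ℝ) ≤ 2 := by
  have h1 : (p : ℝ) ≤ (p ! : ℝ) := by exact_mod_cast Nat.self_le_factorial p
  have h2 : (2 : ℝ) ≤ p := by exact_mod_cast hp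
  rw [div_le_iff₀ (by positivity)]
  linarith

theorem tolTilde_pow (hp : 2 ≤ p) (hM : 0 < M) (hε : 0 < ε) :
    tolTilde p M ε ^ p = (ε / 2) ^ (p + 1) / (8 ^ p * ((p + 1)! : ℝ) ^ p * (p * M)) := by
  have hp0 : (p : ℝ) ≠ 0 := by positivity
  rw [tolTilde, div_pow, mul_pow, mul_pow, ← Real.rpow_mul_natCast (by positivity),
    ← Real.rpow_mul_natCast (by positivity), div_mul_cancel₀ _ hp0, div_mul_cancel₀ _ hp0,
    Real.rpow_one]
  congr 1
  rw [← Real.rpow_natCast]; push_cast; rfl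

/-- For `p ≥ 2` a tensor step of length `r` decreases the objective by at least `(p-1) M r^(p+1) /
(p+1)!`, so a small gap forces a short step and a short step has a small gradient. -/
theorem tensorStep_norm_gradient_le (hp : 2 ≤ p) (hM : 0 < M) (hε : 0 < ε) {g : EucSp n → ℝ}
    (hg : IsConvexSmooth p M g) {z w : EucSp n} (h : IsTensorStep p (p * M) g z w)
    (hgap : g z - g w ≤ tolTilde p M ε) : ‖gradient g w‖ ≤ ε / 2 := by
  have hp' : (2 : ℝ) ≤ p := by exact_mod_cast hp
  have h1 := h.le_self hg
  have h2 := h.norm_gradient_le (by omega) hg hM.le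
  set r := ‖w - z‖ with hr
  have hr0 : 0 ≤ r := norm_nonneg _
  have hp1 : (0 : ℝ) < p - 1 := by linarith
  have h3 : r ^ (p + 1) ≤ tolTilde p M ε * ((p + 1)! : ℝ) / ((p - 1) * M) := by
    rw [le_div_iff₀ (by positivity)]
    have h4 : (p - 1) * M / ((p + 1)! : ℝ) * r ^ (p + 1) ≤ tolTilde p M ε := by linarith
    rw [div_mul_eq_mul_div, div_le_iff₀ (by positivity)] at h4
    linarith
  have hc := succ_div_factorial_le hp
  -- After raising to the power `p + 1`, the length enters through `r^(p+1)`, which is bounded, and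
  -- `ε̃` through `ε̃^p`, which has no fractional exponents.
  refine le_of_pow_le_pow_left₀ (n := p + 1) (by omega) (by positivity) ?_
  calc ‖gradient g w‖ ^ (p + 1) ≤ ((p + 1) * M / (p ! : ℝ) * r ^ p) ^ (p + 1) := by gcongr
    _ = ((p + 1) / (p ! : ℝ)) ^ (p + 1) * M ^ (p + 1) * (r ^ (p + 1)) ^ p := by
        rw [← pow_mul, mul_comm (p + 1) p, pow_mul, ← mul_pow, ← mul_pow]
        congr 1
        ring
    _ ≤ 2 ^ (p + 1) * M ^ (p + 1) *
        (tolTilde p M ε * ((p + 1)! : ℝ) / ((p - 1) * M)) ^ p := by gcongr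
    _ = (ε / 2) ^ (p + 1) * (2 ^ (p + 1) / (8 ^ p * (p - 1) ^ p * p)) := by
        rw [div_pow, mul_pow, mul_pow, tolTilde_pow hp hM hε]
        field_simp
        ring
    _ ≤ (ε / 2) ^ (p + 1) * 1 := by
        gcongr
        rw [div_le_one (by positivity)]
        have a1 : (2 : ℝ) ^ (p + 1) ≤ 8 ^ p := by
          calc (2 : ℝ) ^ (p + 1) ≤ 2 ^ (3 * p) := pow_le_pow_right₀ (by norm_num) (by omega)
            _ = 8 ^ p := by rw [pow_mul]; norm_num
        have a2 : (1 : ℝ) ≤ (p - 1) ^ p := one_le_pow₀ (by linarith)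
        calc (2 : ℝ) ^ (p + 1) ≤ 8 ^ p * 1 * 1 := by linarith
          _ ≤ _ := by gcongr; linarith
    _ = _ := mul_one _

theorem quadReg_zero (g : EucSp n → ℝ) (z : EucSp n) : quadReg g 0 z = g := by
  funext x; simp [quadReg]

theorem Execution.IsComplete.norm_gradient_le (hp : 2 ≤ p) (hM : 0 < M) (hR : 0 < R) (hε : 0 < ε)
    (hf : IsConvexSmooth p M f) (hs : IsMinOn f Set.univ xstar) (hx : ‖x₀ - xstar‖ ≤ R)
    {e : Execution n} (he : e.IsComplete p M R ε f x₀) : ‖gradient f e.out‖ ≤ ε := by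
  have hμ := regMu_pos hR hε
  have hd := hf.differentiable hp
  obtain ⟨v, hv⟩ := exists_isMinOn_quadReg hμ hd hs x₀
  have hg := hf.quadReg hp hμ.le x₀
  have hxv := norm_sub_isMinOn_quadReg_le hμ hs hx hv
  have hp' : (2 : ℝ) ≤ p := by exact_mod_cast hp
  suffices h : ‖gradient (quadReg f (regMu R ε) x₀) e.out‖ ≤ ε / 2 ∧ ‖e.out - x₀‖ ≤ 2 * R by
    have e1 : gradient f e.out =
        gradient (quadReg f (regMu R ε) x₀) e.out - regMu R ε • (e.out - x₀) := by
      rw [gradient_quadReg hd, add_sub_cancel_right]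
    rw [e1]
    refine (norm_sub_le _ _).trans ?_
    rw [norm_smul, Real.norm_of_nonneg hμ.le]
    have h2 : regMu R ε * ‖e.out - x₀‖ ≤ regMu R ε * (2 * R) := by gcongr; exact h.2
    have h3 : regMu R ε * (2 * R) = ε / 2 := by rw [regMu]; field_simp; norm_num
    linarith [h.1]
  have hfin := he.final
  -- Without any restart no gap estimate is available. Instead the failed test at `k = 0` says that
  -- `M R^p / ε` is tiny, and then any tensor step of length at most `2R` has a small gradient.
  rcases Nat.eq_zero_or_pos e.K with hK | hK
  · have hz : (e.state e.K 0).y = x₀ := by rw [hK, he.restarts.init]; rfl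
    rw [hz] at hfin
    have hr : ‖e.out - x₀‖ ≤ 2 * ‖v - x₀‖ := by
      refine IsTensorStep.norm_sub_le hp hg hM (le_refl 0) hv ?_
      rwa [quadReg_zero]
    rw [norm_sub_rev v] at hr
    have hr2 : ‖e.out - x₀‖ ≤ 2 * R := by linarith
    refine ⟨?_, hr2⟩
    have hexit := he.exit
    rw [hK, loopTest_iff hp hM hR hε, pow_zero, not_le] at hexit
    have h1 : logArg p M R ε ^ p < 1 :=
      pow_lt_one₀ (logArg_pos hp hM hR hε).le hexit (by omega)
    rw [logArg_rpow hp hM hε] at h1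
    have h2 := hfin.norm_gradient_le (by omega) hg hM.le
    have hc := succ_div_factorial_le hp
    have h3 : 2 ^ (p + 1) * 2 * (M * R ^ p / ε) ≤ 1 := by
      refine le_trans ?_ h1.le
      have a1 : (1 : ℝ) ≤ ((p + 1)! : ℝ) ^ p :=
        one_le_pow₀ (by exact_mod_cast Nat.factorial_pos (p + 1))
      calc _ = 2 ^ (p + 1) * 1 * 2 * (M * R ^ p / ε) := by ring
        _ ≤ _ := by gcongr
    rw [mul_div_assoc', div_le_one hε] at h3
    calc _ ≤ _ := h2
      _ = (p + 1) / (p ! : ℝ) * M * ‖e.out - x₀‖ ^ p := by ring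
      _ ≤ 2 * M * (2 * R) ^ p := by gcongr
      _ = 2 ^ (p + 1) * 2 * (M * R ^ p) / 2 := by rw [mul_pow, pow_succ]; ring
      _ ≤ ε / 2 := by linarith
  · obtain ⟨k, hk⟩ : ∃ k, e.K = k + 1 := ⟨e.K - 1, by omega⟩
    have hgap := he.restarts.gap_succ_le hp hM hR hε hf hv (k := k) (by omega)
      (he.restarts.norm_sub_le hp hM hR hε hf hs hx hv (by omega))
    rw [← hk] at hgap
    have hexit := he.exit
    rw [loopTest, not_le] at hexit
    have hle := hfin.le_self hg
    have hpos : 0 ≤ (p - 1) * M / ((p + 1)! : ℝ) * ‖e.out - (e.state e.K 0).y‖ ^ (p + 1) := by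
      have : (0 : ℝ) ≤ p - 1 := by linarith
      positivity
    have hmin : quadReg f (regMu R ε) x₀ v ≤ quadReg f (regMu R ε) x₀ e.out :=
      hv (Set.mem_univ _)
    refine ⟨tensorStep_norm_gradient_le hp hM hε hg hfin (by linarith), ?_⟩
    have h1 : ‖e.out - v‖ ≤ radius R e.K :=
      norm_le_of_quadReg_gap_le hμ (radius_pos hR _).le hf.convex hd hv (by linarith)
    have h2 := norm_sub_le_norm_sub_add_norm_sub e.out v x₀
    rw [norm_sub_rev v] at h2
    linarith [radius_le hR e.K]

end Restarts

end

noncomputable section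

/-! ### Stability of trial points in `L`, and the bracket for the bisection -/

section LineSearch

open scoped RealInnerProductSpace

variable {n p : ℕ} {M R ε : ℝ}

theorem modelDeriv_quadReg (hp : 2 ≤ p) {g : EucSp n → ℝ} (hg : ContDiff ℝ p g) (M L : ℝ)
    (z x w : EucSp n) :
    modelDeriv p M (quadReg g L z) x w = modelDeriv p M g x w + L • innerSL ℝ (w - z) := by
  have hq : LipschitzJet (p - 1) 0 (fun x : EucSp n => L • innerSL ℝ (x - z)) := by
    have h := lipschitzJet_quadratic (n := n) hp L z
    obtain ⟨k, rfl⟩ : ∃ k, p = k + 1 := ⟨p - 1, by omega⟩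
    have h2 := h.fderiv
    rwa [fderiv_quadratic] at h2
  have hg' : ContDiff ℝ (p - 1 : ℕ) (fderiv ℝ g) := hg.fderiv_right (by norm_cast; omega)
  rw [modelDeriv, modelDeriv, fderiv_quadReg (hg.differentiable (by norm_cast; omega)),
    vecTaylor_add hg' hq.contDiff, hq.vecTaylor_eq]
  abel

theorem pow_sub_pow_le_mul {a b ρ : ℝ} (k : ℕ) (hb : 0 ≤ b) (ha : a ≤ ρ) (hab : b ≤ a) :
    a ^ (k + 1) - b ^ (k + 1) ≤ (k + 1) * ρ ^ k * (a - b) := by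
  have ha0 : 0 ≤ a := hb.trans hab
  induction k with
  | zero => simp
  | succ k ih =>
    have e : a ^ (k + 1 + 1) - b ^ (k + 1 + 1) =
        a * (a ^ (k + 1) - b ^ (k + 1)) + b ^ (k + 1) * (a - b) := by ring
    have h1 : a * (a ^ (k + 1) - b ^ (k + 1)) ≤ ρ * ((k + 1) * ρ ^ k * (a - b)) := by
      have : 0 ≤ a ^ (k + 1) - b ^ (k + 1) := sub_nonneg.2 (pow_le_pow_left₀ hb hab _)
      exact mul_le_mul ha ih this (ha0.trans ha)
    have h2 : b ^ (k + 1) * (a - b) ≤ ρ ^ (k + 1) * (a - b) := by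
      have : 0 ≤ a - b := sub_nonneg.2 hab
      gcongr
      exact hab.trans ha
    rw [e]
    push_cast
    calc _ ≤ _ := add_le_add h1 h2
      _ = _ := by ring

namespace MSNState

/-- The quantity that an admissible `L_k` has to bring into `[1/2, 1]`. -/
def stepRatio (p : ℕ) (M : ℝ) (s : MSNState n) (L : ℝ) (w : EucSp n) : ℝ :=
  2 * (p + 1) * M / ((p ! : ℝ) * L) * ‖w - s.extrap L‖ ^ (p - 1)

/-- The a priori bounds on the states of the method, `v` being the minimizer. -/
structure IsNear (R : ℝ) (v : EucSp n) (s : MSNState n) : Prop where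
  A_nonneg : 0 ≤ s.A
  y_le : ‖s.y - v‖ ≤ 11 / 5 * R
  u_le : ‖s.u - v‖ ≤ R

variable {g : EucSp n → ℝ} {v w w' : EucSp n} {s : MSNState n} {L L' : ℝ}

theorem IsNear.norm_extrap_sub_le (h : s.IsNear R v) (hR : 0 < R) (hL : 0 < L) :
    ‖s.extrap L - v‖ ≤ 11 / 5 * R := by
  have h1 := MSNState.norm_extrap_sub_le hL h.A_nonneg v
  have hA' := nextA_pos (s := s) hL h.A_nonneg
  have ha := weight_pos (s := s) hL
  have hy := mul_le_mul_of_nonneg_left h.y_le h.A_nonneg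
  have hu := mul_le_mul_of_nonneg_left h.u_le ha.le
  refine le_of_mul_le_mul_left (h1.trans ?_) hA'
  have haR := mul_pos ha hR
  rw [nextA]
  linarith

theorem IsTrial.norm_sub_extrap_le (hp : 2 ≤ p) (hM : 0 < M) (hR : 0 < R)
    (hg : IsConvexSmooth p M g) (hv : IsMinOn g Set.univ v) (hs : s.IsNear R v)
    (h : s.IsTrial p M g L w) : ‖w - s.extrap L‖ ≤ 5 * R := by
  have h1 := IsTensorStep.norm_sub_le hp hg hM h.1.le hv h.2
  have h2 := hs.norm_extrap_sub_le hR h.1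
  rw [norm_sub_rev v] at h1
  linarith

theorem exists_isTrial (hp : 2 ≤ p) (hM : 0 < M) (hg : IsConvexSmooth p M g)
    (hv : IsMinOn g Set.univ v) (s : MSNState n) (hL : 0 < L) : ∃ w, s.IsTrial p M g L w := by
  obtain ⟨w, hw⟩ := exists_isTensorStep hp (hg.quadReg hp hL.le (s.extrap L)) hM (b := g v)
    (fun w => by
      have h1 : g v ≤ g w := hv (Set.mem_univ w)
      simp only [quadReg]
      have : 0 ≤ L / 2 * ‖w - s.extrap L‖ ^ 2 := by positivity
      linarith) (s.extrap L)
  exact ⟨w, hL, hw⟩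

/-- Writing `x(L) = y + (u - y)/b` with `b = L a`, the number `b ≥ 1` solves `b² - b = A L`. Hence
`b` is nondecreasing in `L` and `b/L` nonincreasing, which gives a Lipschitz bound independent of
`A`. -/
theorem norm_extrap_sub_extrap_le (hA : 0 ≤ s.A) (hL : 0 < L) (hLL : L ≤ L') :
    ‖s.extrap L - s.extrap L'‖ ≤ (L' - L) / L * ‖s.u - s.y‖ := by
  have hL' := hL.trans_le hLL
  have key : ∀ {l : ℝ}, 0 < l → ∃ b : ℝ, 1 ≤ b ∧ b ^ 2 - b = s.A * l ∧
      s.extrap l = s.y + (1 / b) • (s.u - s.y) := by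
    intro l hl
    have ha := weight_pos (s := s) hl
    have hA' := nextA_pos (s := s) hl hA
    have haL := mul_weight_sq hl hA
    have hAA : s.nextA l = s.A + s.weight l := rfl
    refine ⟨l * s.weight l, ?_, ?_, ?_⟩
    · have : s.weight l * (l * s.weight l) = s.weight l * 1 + s.A := by
        rw [mul_one, add_comm, ← hAA, ← haL]; ring
      refine le_of_mul_le_mul_left ?_ ha
      linarith
    · have : (l * s.weight l) ^ 2 = l * s.nextA l := by rw [← haL]; ring
      rw [this, hAA]; ring
    · have e1 : 1 / (l * s.weight l) = s.weight l / s.nextA l := by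
        rw [← haL]; field_simp
      have e2 : s.A / s.nextA l = 1 - s.weight l / s.nextA l := by
        rw [hAA] at hA' ⊢
        field_simp
        ring
      rw [e1, extrap, e2]
      module
  obtain ⟨b, hb1, hb2, hb3⟩ := key hL
  obtain ⟨b', hb1', hb2', hb3'⟩ := key hL'
  have hbb : b ≤ b' := by
    by_contra! hlt
    have : s.A * L ≤ s.A * L' := by gcongr
    nlinarith
  have hbb' : b' * L ≤ b * L' := by
    by_contra! hlt
    have h1 : (b' ^ 2 - b') * L = (b ^ 2 - b) * L' := by rw [hb2, hb2']; ring
    have h2 : (b * L') * (b' - 1) < (b' * L) * (b' - 1) ∨ b' = 1 := by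
      rcases hb1'.eq_or_lt with h | h
      · exact Or.inr h.symm
      · exact Or.inl (mul_lt_mul_of_pos_right hlt (by linarith))
    rcases h2 with h2 | h2
    · have h3 : (b * L') * (b - 1) ≤ (b * L') * (b' - 1) := by gcongr
      nlinarith
    · have : b = 1 := le_antisymm (hbb.trans h2.le) hb1
      rw [h2, this] at hlt
      linarith
  rw [hb3, hb3', add_sub_add_left_eq_sub, ← sub_smul, norm_smul]
  gcongr
  have hb0 : 0 < b := by linarith
  have hb0' : 0 < b' := by linarith
  rw [Real.norm_eq_abs, abs_of_nonneg (sub_nonneg.2 (one_div_le_one_div_of_le hb0 hbb)),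
    div_sub_div _ _ hb0.ne' hb0'.ne', div_le_div_iff₀ (by positivity) hL]
  have h4 : (L' - L) ≤ (L' - L) * (b * b') :=
    le_mul_of_one_le_right (by linarith) (one_le_mul_of_one_le_of_one_le hb1 hb1')
  have h5 : (b' - b) * L ≤ (L' - L) * b := by linarith
  have h6 : (L' - L) * b ≤ (L' - L) * (b * b') := by
    have : 0 ≤ L' - L := by linarith
    gcongr
    exact le_mul_of_one_le_right hb0.le hb1'
  linarith

theorem IsTrial.norm_sub_le (hp : 2 ≤ p) (hM : 0 < M) (hg : IsConvexSmooth p M g)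
    (h : s.IsTrial p M g L w) (h' : s.IsTrial p M g L' w') (hLL : L ≤ L') {ρ : ℝ}
    (hρ : ‖s.extrap L - s.extrap L'‖ + ‖w' - s.extrap L'‖ ≤ ρ) :
    L * ‖w - w'‖ ≤ (L' - L) * ‖w' - s.extrap L'‖ +
      (L + (p + 1) * M * ρ ^ (p - 1)) * ‖s.extrap L - s.extrap L'‖ := by
  have hp0 : (0 : ℝ) < p := by positivity
  have hd := hg.differentiable hp
  set x := s.extrap L with hx
  set x' := s.extrap L' with hx'
  have m1 := h.2.modelDeriv_eq_zero (by omega) (hg.quadReg hp h.1.le x).contDiff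
  have m2 := h'.2.modelDeriv_eq_zero (by omega) (hg.quadReg hp h'.1.le x').contDiff
  rw [modelDeriv_quadReg hp hg.contDiff] at m1 m2
  have hmono := hg.model_monotone hp hM.le x w w'
  have hconv : 0 ≤ (fderiv ℝ g w - fderiv ℝ g w') (w - w') := by
    have c1 := hg.convex.add_inner_gradient_le hd w w'
    have c2 := hg.convex.add_inner_gradient_le hd w' w
    rw [inner_gradient_left] at c1 c2
    have : fderiv ℝ g w (w' - w) = - fderiv ℝ g w (w - w') := by rw [← map_neg, neg_sub]
    rw [FunLike.coe_sub, Pi.sub_apply]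
    linarith
  have hm := hconv.trans hmono
  set E := modelDeriv p (p * M) g x w' - modelDeriv p (p * M) g x' w' with hE
  have hEbound : ‖E‖ ≤ (p + 1) * M * ρ ^ (p - 1) * ‖x - x'‖ := by
    have t1 := (hg.lipschitzJet_fderiv (by omega)).norm_vecTaylor_sub_le hM.le x x' w'
    have t2 := norm_normPow_sub_le (p - 1) (v := w' - x) (w := w' - x') (ρ := ρ)
      (by
        have := norm_sub_le_norm_sub_add_norm_sub w' x' x
        rw [norm_sub_rev x' x] at this
        linarith) (by linarith [norm_nonneg (x - x')])
    have e3 : w' - x - (w' - x') = x' - x := by abel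
    rw [e3, norm_sub_rev x' x] at t2
    have e1 : E = (vecTaylor (p - 1) (fderiv ℝ g) x w' - vecTaylor (p - 1) (fderiv ℝ g) x' w') +
        (p * M / (p ! : ℝ)) • innerSL ℝ (normPow (p - 1) (w' - x) - normPow (p - 1) (w' - x')) := by
      rw [hE, modelDeriv, modelDeriv, map_sub, smul_sub]
      abel
    have hfac : (p ! : ℝ) = p * ((p - 1)! : ℝ) := by
      exact_mod_cast (Nat.mul_factorial_pred (by omega)).symm
    have hfac1 : (1 : ℝ) ≤ ((p - 1)! : ℝ) := by exact_mod_cast Nat.factorial_pos _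
    rw [e1]
    refine (norm_add_le _ _).trans ?_
    rw [norm_smul, innerSL_apply_norm, Real.norm_of_nonneg (by positivity)]
    have e2 : p * M / (p ! : ℝ) = M / ((p - 1)! : ℝ) := by rw [hfac]; field_simp
    have e4 : ((p - 1 : ℕ) : ℝ) + 1 = p := by rw [Nat.cast_sub (by omega)]; simp
    rw [e4] at t2
    have hρ0 : 0 ≤ ρ := le_trans (by positivity) hρ
    have hMf : M / ((p - 1)! : ℝ) ≤ M := div_le_self hM.le hfac1
    rw [e2]
    calc _ ≤ M * ‖x - x'‖ * ρ ^ (p - 1) / ((p - 1)! : ℝ) + M / ((p - 1)! : ℝ) *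
          (p * ρ ^ (p - 1) * ‖x - x'‖) := by
          refine add_le_add (t1.trans ?_) (by gcongr)
          gcongr
      _ = M / ((p - 1)! : ℝ) * ((p + 1) * ρ ^ (p - 1) * ‖x - x'‖) := by ring
      _ ≤ M * ((p + 1) * ρ ^ (p - 1) * ‖x - x'‖) := by gcongr
      _ = _ := by ring
  have e1 : modelDeriv p (p * M) g x w - modelDeriv p (p * M) g x w' =
      innerSL ℝ ((L' - L) • (w' - x') + L • (x - x') - L • (w - w')) - E := by
    rw [hE, eq_neg_of_add_eq_zero_left m1, eq_neg_of_add_eq_zero_left m2]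
    simp only [map_sub, map_add, map_smul]
    module
  rw [e1, FunLike.coe_sub, Pi.sub_apply, innerSL_apply_apply, inner_sub_left, inner_smul_left,
    real_inner_self_eq_norm_sq, RCLike.conj_to_real] at hm
  have i1 : ⟪(L' - L) • (w' - x') + L • (x - x'), w - w'⟫ ≤
      ((L' - L) * ‖w' - x'‖ + L * ‖x - x'‖) * ‖w - w'‖ := by
    refine (real_inner_le_norm _ _).trans ?_
    gcongr
    refine (norm_add_le _ _).trans (le_of_eq ?_)
    rw [norm_smul, norm_smul, Real.norm_of_nonneg (by linarith), Real.norm_of_nonneg h.1.le]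
  have i2 : - E (w - w') ≤ (p + 1) * M * ρ ^ (p - 1) * ‖x - x'‖ * ‖w - w'‖ := by
    refine (neg_le_abs _).trans ((E.le_opNorm _).trans ?_)
    gcongr
  rcases (norm_nonneg (w - w')).eq_or_lt with h0 | h0
  · rw [← h0, mul_zero]
    have hρ0 : 0 ≤ ρ := le_trans (by positivity) hρ
    have a1 := h.1
    have a2 : 0 ≤ L' - L := by linarith
    positivity
  · refine le_of_mul_le_mul_right ?_ h0
    nlinarith

end MSNState

/-- The smallest value tried for `L_k`. -/
def searchLo (p : ℕ) (M R ε : ℝ) : ℝ :=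
  M * R ^ (p - 1) / ((p ! : ℝ) * 10 ^ (p - 1) * (2 + M * R ^ p / ε))

/-- An upper bound for the values tried for `L_k`. -/
def searchHi (p : ℕ) (M R : ℝ) : ℝ :=
  4 * (p + 1) * M / (p ! : ℝ) * (5 * R) ^ (p - 1)

theorem searchLo_pos (hM : 0 < M) (hR : 0 < R) (hε : 0 < ε) : 0 < searchLo p M R ε := by
  rw [searchLo]; positivity

theorem searchHi_pos (hM : 0 < M) (hR : 0 < R) : 0 < searchHi p M R := by
  rw [searchHi]; positivity

theorem searchLo_le_searchHi (hM : 0 < M) (hR : 0 < R) (hε : 0 < ε) :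
    searchLo p M R ε ≤ searchHi p M R := by
  rw [searchLo, searchHi, mul_pow, div_le_iff₀ (by positivity)]
  have hq : 0 < M * R ^ p / ε := by positivity
  have h1 : (1 : ℝ) ≤ 5 ^ (p - 1) := one_le_pow₀ (by norm_num)
  have h2 : (1 : ℝ) ≤ 10 ^ (p - 1) := one_le_pow₀ (by norm_num)
  have h3 : (1 : ℝ) ≤ 4 * (p + 1) := by
    have : (0 : ℝ) ≤ p := by positivity
    linarith
  have h4 : (1 : ℝ) ≤ 2 + M * R ^ p / ε := by linarith
  calc M * R ^ (p - 1) = (1 * 1 * 1 * 1) * (M * R ^ (p - 1)) := by ring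
    _ ≤ ((4 * (p + 1)) * 5 ^ (p - 1) * 10 ^ (p - 1) * (2 + M * R ^ p / ε)) *
        (M * R ^ (p - 1)) := by gcongr
    _ = _ := by field_simp

namespace MSNState

variable {v w w' : EucSp n} {s : MSNState n} {L L' : ℝ}

theorem stepRatio_searchHi_le {g : EucSp n → ℝ} (hp : 2 ≤ p) (hM : 0 < M) (hR : 0 < R)
    (hg : IsConvexSmooth p M g) (hv : IsMinOn g Set.univ v) (hs : s.IsNear R v)
    (h : s.IsTrial p M g (searchHi p M R) w) :
    s.stepRatio p M (searchHi p M R) w ≤ 1 / 2 := by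
  have h1 := h.norm_sub_extrap_le hp hM hR hg hv hs
  have hL := h.1
  rw [stepRatio]
  calc _ ≤ 2 * (p + 1) * M / ((p ! : ℝ) * searchHi p M R) * (5 * R) ^ (p - 1) := by gcongr
    _ = 1 / 2 := by rw [searchHi]; field_simp; norm_num

/-- `searchLo` is small enough that a ratio at most 1 forces a step of length at most `R/10`, and
that `searchLo · R ≤ ε`. The residual and the proximal term then cost `3ε/20`, and `μ ‖w - x₀‖` at
most `33ε/40`. -/
theorem norm_gradient_searchLo_le {f : EucSp n → ℝ} {x₀ xstar : EucSp n} (hp : 2 ≤ p) (hM : 0 < M)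
    (hR : 0 < R) (hε : 0 < ε)
    (hf : IsConvexSmooth p M f) (hs : IsMinOn f Set.univ xstar) (hx : ‖x₀ - xstar‖ ≤ R)
    (hv : IsMinOn (quadReg f (regMu R ε) x₀) Set.univ v) (hn : s.IsNear R v)
    (h : s.IsTrial p M (quadReg f (regMu R ε) x₀) (searchLo p M R ε) w)
    (hr : s.stepRatio p M (searchLo p M R ε) w ≤ 1) : ‖gradient f w‖ ≤ ε := by
  have hμ := regMu_pos hR hε
  have hd := hf.differentiable hp
  have hL := searchLo_pos (p := p) hM hR hε
  have hres := h.residual_le hp hM.le (hf.quadReg hp hμ.le x₀) hr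
  have hxv := norm_sub_isMinOn_quadReg_le hμ hs hx hv
  have hext := hn.norm_extrap_sub_le hR hL
  have hq : 0 < M * R ^ p / ε := by positivity
  set Lo := searchLo p M R ε with hLo
  set x := s.extrap Lo
  have hr1 : ‖w - x‖ ≤ R / 10 := by
    rw [stepRatio, div_mul_eq_mul_div, div_le_one (by positivity)] at hr
    have h1 : (p ! : ℝ) * Lo ≤ 2 * (p + 1) * M * (R / 10) ^ (p - 1) := by
      rw [hLo, searchLo, div_pow]
      have h3 : (1 : ℝ) ≤ 2 * (p + 1) := by
        have : (0 : ℝ) ≤ p := by positivity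
        linarith
      have e : (p ! : ℝ) * (M * R ^ (p - 1) / ((p ! : ℝ) * 10 ^ (p - 1) * (2 + M * R ^ p / ε))) =
          M * (R ^ (p - 1) / 10 ^ (p - 1)) / (2 + M * R ^ p / ε) := by field_simp
      rw [e]
      calc _ ≤ M * (R ^ (p - 1) / 10 ^ (p - 1)) := div_le_self (by positivity) (by linarith)
        _ = 1 * M * (R ^ (p - 1) / 10 ^ (p - 1)) := by ring
        _ ≤ _ := by gcongr
    have h2 := le_of_mul_le_mul_left (hr.trans h1) (by positivity)
    exact le_of_pow_le_pow_left₀ (by omega) (by positivity) h2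
  have hLR : Lo * R ≤ ε := by
    have e1 : R ^ p = R ^ (p - 1) * R := by rw [← pow_succ]; congr 1; omega
    have h1 : Lo ≤ M * R ^ (p - 1) / (M * R ^ p / ε) := by
      rw [hLo, searchLo]
      gcongr
      have a1 : (1 : ℝ) ≤ (p ! : ℝ) := by exact_mod_cast Nat.factorial_pos p
      have a2 : (1 : ℝ) ≤ 10 ^ (p - 1) := one_le_pow₀ (by norm_num)
      calc _ ≤ 1 * 1 * (2 + M * R ^ p / ε) := by linarith
        _ ≤ _ := by gcongr
    have h2 : M * R ^ (p - 1) / (M * R ^ p / ε) = ε / R := by rw [e1]; field_simp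
    rw [h2, le_div_iff₀ hR] at h1
    exact h1
  have e1 : gradient f w = (gradient (quadReg f (regMu R ε) x₀) w + Lo • (w - x)) -
      (Lo • (w - x) + regMu R ε • (w - x₀)) := by
    rw [gradient_quadReg hd]; abel
  have h3 : ‖w - x₀‖ ≤ 33 / 10 * R := by
    have a1 := norm_sub_le_norm_sub_add_norm_sub w x x₀
    have a2 := norm_sub_le_norm_sub_add_norm_sub x v x₀
    rw [norm_sub_rev v x₀] at a2
    linarith
  rw [e1]
  refine (norm_sub_le _ _).trans ((add_le_add hres (norm_add_le _ _)).trans ?_)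
  rw [norm_smul, norm_smul, Real.norm_of_nonneg hL.le, Real.norm_of_nonneg hμ.le]
  have h4 : regMu R ε * ‖w - x₀‖ ≤ regMu R ε * (33 / 10 * R) := by gcongr
  have h5 : regMu R ε * (33 / 10 * R) = 33 / 40 * ε := by rw [regMu]; field_simp; norm_num
  have h6 : Lo * ‖w - x‖ ≤ Lo * (R / 10) := by gcongr
  linarith

/-- The bracket of the bisection cannot become too short. -/
theorem exists_searchHi_le (hp : 2 ≤ p) : ∃ C : ℝ, 0 < C ∧
    ∀ (n : ℕ) (M R ε : ℝ), 0 < M → 0 < R → 0 < ε → ∀ (g : EucSp n → ℝ) (v : EucSp n)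
      (s : MSNState n) (L L' : ℝ) (w w' : EucSp n), IsConvexSmooth p M g → IsMinOn g Set.univ v →
      s.IsNear R v → searchLo p M R ε ≤ L → L < L' → s.IsTrial p M g L w → s.IsTrial p M g L' w' →
      1 ≤ s.stepRatio p M L w → s.stepRatio p M L' w' ≤ 1 / 2 →
      searchHi p M R ≤ C * (2 + M * R ^ p / ε) ^ 3 * (L' - L) := by
  have hp0 : (0 : ℝ) < p := by positivity
  obtain ⟨j, rfl⟩ : ∃ j, p = j + 2 := ⟨p - 2, by omega⟩
  set P : ℝ := ((j + 2 : ℕ) : ℝ) with hP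
  set k₀ : ℝ := 2 * (P + 1) / ((j + 2)! : ℝ) with hk₀
  set c : ℝ := ((j + 2)! : ℝ) * 10 ^ (j + 1) with hc
  set K₀ : ℝ := k₀ * (j + 1) * 5 ^ j with hK₀
  set K₁ : ℝ := 4 * (P + 1) * 9 ^ (j + 1) with hK₁
  have hk₀0 : 0 < k₀ := by positivity
  have hc0 : 0 < c := by positivity
  have hK₀0 : 0 < K₀ := by positivity
  have hK₁0 : 0 < K₁ := by positivity
  refine ⟨2 * k₀ * 5 ^ (j + 1) * (4 * K₀ * (13 + K₁) + 2) * c ^ 3, by positivity, ?_⟩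
  intro n M R ε hM hR hε g v s L L' w w' hg hv hs hLo hLL h h' hratio hratio'
  have hL := h.1
  have hL' := h'.1
  set q := M * R ^ (j + 2) / ε with hq
  have hq0 : 0 < q := by positivity
  set Y := M * R ^ (j + 1) with hY
  have hY0 : 0 < Y := by positivity
  set τ := c * (2 + q) with hτ
  have hτ1 : 1 ≤ τ := by
    have a1 : (1 : ℝ) ≤ ((j + 2)! : ℝ) := by exact_mod_cast Nat.factorial_pos _
    have a2 : (1 : ℝ) ≤ 10 ^ (j + 1) := one_le_pow₀ (by norm_num)
    calc (1 : ℝ) = 1 * 1 * 1 := by norm_num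
      _ ≤ _ := by rw [hτ, hc]; gcongr; linarith
  have hYτ : Y ≤ τ * L := by
    have h1 : searchLo (j + 2) M R ε = Y / τ := rfl
    rw [h1, div_le_iff₀ (by positivity)] at hLo
    linarith
  have hd : 0 < L' - L := by linarith
  have hHi : searchHi (j + 2) M R = 2 * k₀ * 5 ^ (j + 1) * Y := by
    rw [searchHi, hk₀, hY]
    change 4 * (P + 1) * M / _ * (5 * R) ^ (j + 1) = _
    rw [mul_pow]
    ring
  -- The claim relative to `L`. Since `searchHi` is a multiple of `Y ≤ τ L`, passing to it costs the
  -- third factor `τ`.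
  have hcore : L ≤ (4 * K₀ * (13 + K₁) + 2) * τ ^ 2 * (L' - L) := by
    have hτ2 : 1 ≤ τ ^ 2 := one_le_pow₀ hτ1
    -- If `L'` is larger, then `L' - L > L/2` and the claim is clear. Otherwise `L'/2 ≤ 3L/4`, so
    -- the two ratio conditions make `k₀ M r^(p-1)` and `k₀ M r'^(p-1)` differ by at least `L/4`,
    -- while stability of the trial points bounds `r - r'` by a multiple of `L' - L`.
    by_cases hbig : L' ≤ 3 / 2 * L
    · set r := ‖w - s.extrap L‖ with hr
      set r' := ‖w' - s.extrap L'‖ with hr'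
      set δ := ‖s.extrap L - s.extrap L'‖ with hδ
      have hrR : r ≤ 5 * R := h.norm_sub_extrap_le hp hM hR hg hv hs
      have hrR' : r' ≤ 5 * R := h'.norm_sub_extrap_le hp hM hR hg hv hs
      have hr0' : 0 ≤ r' := norm_nonneg _
      have hyu : ‖s.u - s.y‖ ≤ 4 * R := by
        have := norm_sub_le_norm_sub_add_norm_sub s.u v s.y
        rw [norm_sub_rev v] at this
        linarith [hs.y_le, hs.u_le]
      have hδ1 : δ ≤ (L' - L) / L * (4 * R) :=
        (norm_extrap_sub_extrap_le hs.A_nonneg hL hLL.le).trans (by gcongr)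
      have hδ2 : δ ≤ 4 * R := by
        refine hδ1.trans (mul_le_of_le_one_left (by positivity) ?_)
        rw [div_le_one hL]
        linarith
      have hw := h.norm_sub_le hp hM hg h' hLL.le (ρ := 9 * R) (by linarith)
      have hrr : r - r' ≤ ‖w - w'‖ + δ := by
        have e : w - s.extrap L = (w - w') + (w' - s.extrap L') - (s.extrap L - s.extrap L') := by
          abel
        have a1 := norm_sub_le ((w - w') + (w' - s.extrap L')) (s.extrap L - s.extrap L')
        have a2 := norm_add_le (w - w') (w' - s.extrap L')
        rw [← e] at a1
        linarith
      have hκ : ∀ l ρ : ℝ, 0 < l → 2 * (P + 1) * M / (((j + 2)! : ℝ) * l) * ρ =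
          k₀ * M * ρ / l := fun l ρ hl => by rw [hk₀]; field_simp
      have r1 : L ≤ k₀ * M * r ^ (j + 1) := by
        have := hratio
        change 1 ≤ 2 * (P + 1) * M / (((j + 2)! : ℝ) * L) * r ^ (j + 1) at this
        rwa [hκ _ _ hL, le_div_iff₀ hL, one_mul] at this
      have r2 : k₀ * M * r' ^ (j + 1) ≤ 1 / 2 * L' := by
        have := hratio'
        change 2 * (P + 1) * M / (((j + 2)! : ℝ) * L') * r' ^ (j + 1) ≤ _ at this
        rwa [hκ _ _ hL', div_le_iff₀ hL'] at this
      have hkM : 0 < k₀ * M := by positivity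
      have hr'r : r' ≤ r := by
        by_contra! hlt
        have : r ^ (j + 1) ≤ r' ^ (j + 1) := pow_le_pow_left₀ (norm_nonneg _) hlt.le _
        have := mul_le_mul_of_nonneg_left this hkM.le
        linarith
      have hpow := pow_sub_pow_le_mul j hr0' hrR hr'r
      have h1 : L / 4 ≤ k₀ * M * ((j + 1) * (5 * R) ^ j * (r - r')) := by
        have := mul_le_mul_of_nonneg_left hpow hkM.le
        linarith
      have h2 : L * (r - r') ≤ R * (L' - L) * (13 + K₁ * τ) := by
        have a1 : L * δ ≤ (L' - L) * (4 * R) := by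
          have := mul_le_mul_of_nonneg_left hδ1 hL.le
          calc _ ≤ _ := this
            _ = _ := by field_simp
        have a2 : (P + 1) * M * (9 * R) ^ (j + 1) * δ ≤
            (P + 1) * 9 ^ (j + 1) * τ * ((L' - L) * (4 * R)) := by
          calc _ = (P + 1) * 9 ^ (j + 1) * Y * δ := by rw [hY, mul_pow]; ring
            _ ≤ (P + 1) * 9 ^ (j + 1) * (τ * L) * δ := by gcongr
            _ = (P + 1) * 9 ^ (j + 1) * τ * (L * δ) := by ring
            _ ≤ _ := by gcongr
        have a3 : (L' - L) * r' ≤ (L' - L) * (5 * R) := by gcongr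
        have a4 := mul_le_mul_of_nonneg_left hrr hL.le
        change L * ‖w - w'‖ ≤ (L' - L) * r' + (L + (P + 1) * M * (9 * R) ^ (j + 1)) * δ at hw
        calc L * (r - r') ≤ L * ‖w - w'‖ + L * δ := by linarith
          _ ≤ (L' - L) * (5 * R) + 2 * ((L' - L) * (4 * R)) +
              (P + 1) * 9 ^ (j + 1) * τ * ((L' - L) * (4 * R)) := by linarith
          _ = _ := by rw [hK₁]; ring
      have h3 : L * (L / 4) ≤ K₀ * Y * ((L' - L) * (13 + K₁ * τ)) := by
        calc L * (L / 4) ≤ L * (k₀ * M * ((j + 1) * (5 * R) ^ j * (r - r'))) := by gcongr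
          _ = k₀ * M * ((j + 1) * (5 * R) ^ j) * (L * (r - r')) := by ring
          _ ≤ k₀ * M * ((j + 1) * (5 * R) ^ j) * (R * (L' - L) * (13 + K₁ * τ)) := by gcongr
          _ = _ := by rw [hK₀, hY, mul_pow]; ring
      have h4 : L * (L / 4) ≤ L * (K₀ * (13 + K₁) * τ ^ 2 * (L' - L)) := by
        calc _ ≤ _ := h3
          _ ≤ K₀ * (τ * L) * ((L' - L) * (13 * τ + K₁ * τ)) := by
              gcongr
              linarith
          _ = _ := by ring
      have h5 := le_of_mul_le_mul_left h4 hL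
      have h6 : 0 ≤ 2 * τ ^ 2 * (L' - L) := by positivity
      linarith
    · rw [not_le] at hbig
      have a1 : (L' - L) * 1 ≤ (L' - L) * τ ^ 2 := by gcongr
      have a2 : 0 ≤ 4 * K₀ * (13 + K₁) * τ ^ 2 * (L' - L) := by positivity
      linarith
  rw [hHi]
  calc _ ≤ 2 * k₀ * 5 ^ (j + 1) * (τ * ((4 * K₀ * (13 + K₁) + 2) * τ ^ 2 * (L' - L))) := by
        gcongr
        exact hYτ.trans (by gcongr)
    _ = _ := by rw [hτ]; ring

end MSNState

end LineSearch

end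

/-! ### Oracle programs and their translation into oracle methods -/

noncomputable section

/-- A program that may query a `p`-th order oracle. -/
inductive OracleProg (n p : ℕ) (α : Type) : Type
  | ret : α → OracleProg n p α
  | query : EucSp n → (Jet n p → OracleProg n p α) → OracleProg n p α

namespace OracleProg

variable {n p : ℕ} {α β : Type}

/-- The result of a program. -/
def run (O : EucSp n → Jet n p) : OracleProg n p α → α
  | ret a => a
  | query x k => (k (O x)).run O

/-- The number of oracle calls of a program. -/
def cost (O : EucSp n → Jet n p) : OracleProg n p α → ℕ
  | ret _ => 0
  | query x k => (k (O x)).cost O + 1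

/-- The queries of a program with their answers. -/
def trace (O : EucSp n → Jet n p) : OracleProg n p α → List (EucSp n × Jet n p)
  | ret _ => []
  | query x k => (x, O x) :: (k (O x)).trace O

/-- Sequential composition. -/
def bind : OracleProg n p α → (α → OracleProg n p β) → OracleProg n p β
  | ret a, h => h a
  | query x k, h => query x fun J => (k J).bind h

/-- The next action of a program after a given list of answered queries. -/
def act : OracleProg n p α → List (EucSp n × Jet n p) → EucSp n ⊕ α
  | ret a, _ => Sum.inr a
  | query x _, [] => Sum.inl x
  | query _ k, a :: l => (k a.2).act l

/-- The oracle method that executes a program. -/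
def toMethod (P : OracleProg n p α) : OracleMethod n p α := ⟨P.act⟩

theorem run_bind (O : EucSp n → Jet n p) (P : OracleProg n p α) (h : α → OracleProg n p β) :
    (P.bind h).run O = (h (P.run O)).run O := by
  induction P with
  | ret a => rfl
  | query x k ih => exact ih (O x)

theorem cost_bind (O : EucSp n → Jet n p) (P : OracleProg n p α) (h : α → OracleProg n p β) :
    (P.bind h).cost O = P.cost O + (h (P.run O)).cost O := by
  induction P with
  | ret a => simp [bind, cost, run]
  | query x k ih =>
    have := ih (O x)
    simp only [bind, cost, run]
    omega

/-- Replaying a program on a prefix of its own trace arrives either at the next query of the trace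
or, when the trace is used up, at the result. This identifies the history-driven method with the
program. -/
theorem act_take_trace (O : EucSp n → Jet n p) (P : OracleProg n p α) (t : ℕ) :
    (∃ x, P.act ((P.trace O).take t) = Sum.inl x ∧
      (P.trace O).take (t + 1) = (P.trace O).take t ++ [(x, O x)]) ∨
    (P.act ((P.trace O).take t) = Sum.inr (P.run O) ∧
      (P.trace O).take (t + 1) = (P.trace O).take t) := by
  induction P generalizing t with
  | ret a => exact Or.inr ⟨rfl, by simp [trace]⟩
  | query x k ih =>
    cases t with
    | zero => exact Or.inl ⟨x, rfl, rfl⟩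
    | succ t =>
      rcases ih (O x) t with ⟨y, h1, h2⟩ | ⟨h1, h2⟩
      · refine Or.inl ⟨y, h1, ?_⟩
        simp only [trace, List.take_succ_cons] at h2 ⊢
        rw [h2]
        rfl
      · refine Or.inr ⟨h1, ?_⟩
        simp only [trace, List.take_succ_cons] at h2 ⊢
        rw [h2]

theorem transcript_toMethod (O : EucSp n → Jet n p) (P : OracleProg n p α) (t : ℕ) :
    P.toMethod.transcript O t = (P.trace O).take t := by
  induction t with
  | zero => simp [OracleMethod.transcript]
  | succ t ih =>
    rw [OracleMethod.transcript, ih]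
    change (match P.act ((P.trace O).take t) with
      | Sum.inl x => (P.trace O).take t ++ [(x, O x)]
      | Sum.inr _ => (P.trace O).take t) = _
    rcases act_take_trace O P t with ⟨x, h1, h2⟩ | ⟨h1, h2⟩
    · rw [h1, h2]
    · rw [h1, h2]

theorem act_trace (O : EucSp n → Jet n p) (P : OracleProg n p α) :
    P.act (P.trace O) = Sum.inr (P.run O) := by
  induction P with
  | ret a => rfl
  | query x k ih => exact ih (O x)

theorem length_trace (O : EucSp n → Jet n p) (P : OracleProg n p α) :
    (P.trace O).length = P.cost O := by
  induction P with
  | ret a => rfl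
  | query x k ih => simp [trace, cost, ih]

theorem haltsWithin_toMethod (O : EucSp n → Jet n p) (P : OracleProg n p α) :
    P.toMethod.HaltsWithin O (P.cost O) (P.run O) := by
  rw [OracleMethod.HaltsWithin, transcript_toMethod, ← length_trace O P, List.take_length]
  exact act_trace O P

end OracleProg

/-! ### The bisection search and the main loop as programs -/

section Method

variable {n p : ℕ}

/-- The gradient contained in a jet. -/
def jetGradient (J : Jet n p) : EucSp n :=
  if h : 1 < p + 1 then
    (InnerProductSpace.toDual ℝ (EucSp n)).symm
      (continuousMultilinearCurryFin1 ℝ (EucSp n) ℝ (J ⟨1, h⟩))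
  else 0

theorem jetGradient_jetOracle (hp : 1 ≤ p) (f : EucSp n → ℝ) (x : EucSp n) :
    jetGradient (jetOracle p f x) = gradient f x := by
  rw [jetGradient, dif_pos (by omega), gradient]
  congr 1
  ext v
  change iteratedFDeriv ℝ 1 f x (Fin.snoc 0 v) = _
  rw [iteratedFDeriv_one_apply]
  rfl

/-- The objective of a tensor step for `f + μ/2 ‖· - x₀‖² + L/2 ‖· - x‖²` at `x`, computed from the
jet of `f` at `x`. -/
def jetModel (M μ : ℝ) (x₀ : EucSp n) (L : ℝ) (x : EucSp n) (J : Jet n p) (w : EucSp n) : ℝ :=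
  ∑ r : Fin (p + 1), 1 / ((r : ℕ)! : ℝ) * J r (fun _ => w - x) + μ / 2 * ‖w - x₀‖ ^ 2 +
    L / 2 * ‖w - x‖ ^ 2 + p * M / ((p + 1)! : ℝ) * ‖w - x‖ ^ (p + 1)

/-- A tensor step, computed from the jet. -/
def jetStep (M μ : ℝ) (x₀ : EucSp n) (L : ℝ) (x : EucSp n) (J : Jet n p) : EucSp n :=
  Classical.epsilon fun w => IsMinOn (jetModel M μ x₀ L x J) Set.univ w

/-- The two quadratic terms are known and equal their Taylor polynomials, so the jet of `f` at the
centre determines the whole objective. The choice operator then makes the selected minimizer a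
deterministic function of the jet. -/
theorem isTensorStep_jetStep (hp : 2 ≤ p) {M μ : ℝ} {f : EucSp n → ℝ} (hf : ContDiff ℝ p f)
    {x₀ : EucSp n} {L : ℝ} {x : EucSp n}
    (h : ∃ w, IsTensorStep p (p * M) (quadReg (quadReg f μ x₀) L x) x w) :
    IsTensorStep p (p * M) (quadReg (quadReg f μ x₀) L x) x
      (jetStep M μ x₀ L x (jetOracle p f x)) := by
  have e : jetModel M μ x₀ L x (jetOracle p f x) = fun w =>
      taylorModel p (quadReg (quadReg f μ x₀) L x) x w +
        p * M / ((p + 1)! : ℝ) * ‖w - x‖ ^ (p + 1) := by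
    funext w
    have hq : ContDiff ℝ p (quadReg f μ x₀) := hf.add (lipschitzJet_quadratic (n := n) hp μ x₀).contDiff
    rw [taylorModel_quadReg hp hq, taylorModel_quadReg hp hf, taylorModel, Finset.sum_range,
      jetModel]
    rfl
  unfold IsTensorStep at h ⊢
  rw [← e] at h ⊢
  exact Classical.epsilon_spec h

/-- The parameters of Algorithm 3. -/
structure MethodParams (n : ℕ) where
  M : ℝ
  R : ℝ
  ε : ℝ
  x₀ : EucSp n

namespace MethodParams

variable (P : MethodParams n) (p)

/-- Computes a trial point and the gradient of `f` there. -/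
def trial (s : MSNState n) (L : ℝ) : OracleProg n p (EucSp n × EucSp n) :=
  .query (s.extrap L) fun J =>
    .query (jetStep P.M (regMu P.R P.ε) P.x₀ L (s.extrap L) J) fun J' =>
      .ret (jetStep P.M (regMu P.R P.ε) P.x₀ L (s.extrap L) J, jetGradient J')

/-- The state after the choice of `L` with trial point `w`, where `v = ∇f(w)`. -/
def accept (s : MSNState n) (L : ℝ) (w v : EucSp n) : MSNState n :=
  ⟨s.nextA L, w, s.u - s.weight L • (v + regMu P.R P.ε • (w - P.x₀))⟩

open Classical in
/-- Bisection for an admissible value of `L`. -/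
def bisect (s : MSNState n) : ℕ → ℝ → ℝ → OracleProg n p (ℝ × (EucSp n ⊕ MSNState n))
  -- A default that is not a valid step; `bisect_run` shows that it is not reached when `m` is large
  -- enough.
  | 0, lo, _ => .ret (lo, Sum.inr s)
  | m + 1, lo, hi => (P.trial p s ((lo + hi) / 2)).bind fun a =>
      if 1 < s.stepRatio p P.M ((lo + hi) / 2) a.1 then bisect s m ((lo + hi) / 2) hi
      else if s.stepRatio p P.M ((lo + hi) / 2) a.1 < 1 / 2 then bisect s m lo ((lo + hi) / 2)
      else .ret ((lo + hi) / 2, Sum.inr (P.accept s ((lo + hi) / 2) a.1 a.2))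

open Classical in
/-- The choice of `L`: either a trial point with small gradient, or the next state. -/
def search (m : ℕ) (s : MSNState n) : OracleProg n p (ℝ × (EucSp n ⊕ MSNState n)) :=
  (P.trial p s (searchLo p P.M P.R P.ε)).bind fun a =>
    if ‖a.2‖ ≤ P.ε then .ret (searchLo p P.M P.R P.ε, Sum.inl a.1)
    else P.bisect p s m (searchLo p P.M P.R P.ε) (searchHi p P.M P.R)

/-- Records a trial point at which the execution stops. -/
def stopAt (e : Execution n) (L : ℝ) (w : EucSp n) : Execution n :=
  { e with
    L := fun k j => if k = e.K ∧ j = e.J then L else e.L k j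
    out := w }

/-- Records one more iteration of the inner method. -/
def extend (e : Execution n) (L : ℝ) (s : MSNState n) : Execution n :=
  { e with
    J := e.J + 1
    state := fun k j => if k = e.K ∧ j = e.J + 1 then s else e.state k j
    L := fun k j => if k = e.K ∧ j = e.J then L else e.L k j }

/-- Records the beginning of the next restart. -/
def restart (e : Execution n) : Execution n :=
  { e with
    K := e.K + 1
    J := 0
    state := fun k j =>
      if k = e.K + 1 ∧ j = 0 then MSNState.start (e.state e.K e.J).y else e.state k j }

open Classical in
/-- The main loop of Algorithm 3, with `m` bisection steps in each search. -/
def loop (m : ℕ) : ℕ → Execution n → OracleProg n p (Execution n)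
  | 0, e => .ret e
  | fuel + 1, e =>
    if loopTest p P.M P.R P.ε e.K then
      if e.J < innerCount p P.M P.R P.ε e.K then
        (P.search p m (e.state e.K e.J)).bind fun a =>
          match a.2 with
          | Sum.inl w => .ret (stopAt e a.1 w)
          | Sum.inr s => loop m fuel (extend e a.1 s)
      else loop m fuel (restart e)
    else .query (e.state e.K 0).y fun J =>
      .ret { e with out := jetStep P.M (regMu P.R P.ε) P.x₀ 0 (e.state e.K 0).y J }

theorem cost_bisect_le (O : EucSp n → Jet n p) (s : MSNState n) (m : ℕ) (lo hi : ℝ) :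
    (P.bisect p s m lo hi).cost O ≤ 2 * m := by
  induction m generalizing lo hi with
  | zero => exact le_rfl
  | succ m ih =>
    rw [bisect, OracleProg.cost_bind]
    have h1 : (P.trial p s ((lo + hi) / 2)).cost O = 2 := rfl
    rw [h1]
    split_ifs
    · have := ih ((lo + hi) / 2) hi
      omega
    · have := ih lo ((lo + hi) / 2)
      omega
    · simp only [OracleProg.cost]
      omega

theorem cost_search_le (O : EucSp n → Jet n p) (m : ℕ) (s : MSNState n) :
    (P.search p m s).cost O ≤ 2 * (m + 1) := by
  rw [search, OracleProg.cost_bind]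
  have h1 : (P.trial p s (searchLo p P.M P.R P.ε)).cost O = 2 := rfl
  rw [h1]
  split_ifs
  · simp only [OracleProg.cost]
    omega
  · have := P.cost_bisect_le p O s m (searchLo p P.M P.R P.ε) (searchHi p P.M P.R)
    omega

/-- One pass of the loop makes at most one search, and every trial in it costs two calls: one at
`x^k` for the model, one at the trial point for the gradient. -/
theorem cost_loop_le (O : EucSp n → Jet n p) (m fuel : ℕ) (e : Execution n) :
    (P.loop p m fuel e).cost O ≤ fuel * (2 * (m + 1)) := by
  induction fuel generalizing e with
  | zero => exact Nat.zero_le _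
  | succ fuel ih =>
    rw [loop, add_mul, one_mul]
    split_ifs
    · rw [OracleProg.cost_bind]
      have h1 := P.cost_search_le p O m (e.state e.K e.J)
      split
      · simp only [OracleProg.cost]
        omega
      · next s _ =>
        have := ih (extend e ((P.search p m (e.state e.K e.J)).run O).1 s)
        omega
    · have := ih (restart e)
      omega
    · simp only [OracleProg.cost]
      omega

variable {p P}
variable {f : EucSp n → ℝ} {xstar v : EucSp n}

/-- The standing assumptions on the parameters and the objective. -/
structure IsAdmissible (p : ℕ) (P : MethodParams n) (f : EucSp n → ℝ) (xstar v : EucSp n) :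
    Prop where
  two_le : 2 ≤ p
  M_pos : 0 < P.M
  R_pos : 0 < P.R
  ε_pos : 0 < P.ε
  smooth : IsConvexSmooth p P.M f
  isMinOn : IsMinOn f Set.univ xstar
  dist_le : ‖P.x₀ - xstar‖ ≤ P.R
  isMinOn_reg : IsMinOn (quadReg f (regMu P.R P.ε) P.x₀) Set.univ v

namespace IsAdmissible

variable (h : IsAdmissible p P f xstar v)
include h

theorem smooth_reg : IsConvexSmooth p P.M (quadReg f (regMu P.R P.ε) P.x₀) :=
  h.smooth.quadReg h.two_le (regMu_pos h.R_pos h.ε_pos).le _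

theorem isTrial_run (s : MSNState n) {L : ℝ} (hL : 0 < L) :
    s.IsTrial p P.M (quadReg f (regMu P.R P.ε) P.x₀) L
        ((P.trial p s L).run (jetOracle p f)).1 ∧
      ((P.trial p s L).run (jetOracle p f)).2 =
        gradient f ((P.trial p s L).run (jetOracle p f)).1 := by
  refine ⟨⟨hL, ?_⟩, ?_⟩
  · obtain ⟨w, hw⟩ := MSNState.exists_isTrial h.two_le h.M_pos h.smooth_reg h.isMinOn_reg s hL
    exact isTensorStep_jetStep h.two_le h.smooth.contDiff ⟨w, hw.2⟩
  · exact jetGradient_jetOracle (by have := h.two_le; omega) f _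

theorem isStep_accept {s : MSNState n} {L : ℝ} {w : EucSp n}
    (ht : s.IsTrial p P.M (quadReg f (regMu P.R P.ε) P.x₀) L w)
    (h1 : ¬ 1 < s.stepRatio p P.M L w) (h2 : ¬ s.stepRatio p P.M L w < 1 / 2) :
    s.IsStep p P.M (quadReg f (regMu P.R P.ε) P.x₀) L (P.accept s L w (gradient f w)) where
  trial := ht
  lower := not_lt.1 h2
  upper := not_lt.1 h1
  eq_A := rfl
  eq_u := by
    rw [gradient_quadReg (h.smooth.differentiable h.two_le)]
    rfl

end IsAdmissible

end MethodParams

end Method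

end

noncomputable section

/-! ### Correctness of the program -/

section Correctness

variable {n p : ℕ} {P : MethodParams n} {f : EucSp n → ℝ} {xstar v : EucSp n}

theorem MSNState.IsRun.isNear {M R D : ℝ} {g : EucSp n → ℝ} {z : EucSp n} {m : ℕ}
    {σ : ℕ → MSNState n} {L : ℕ → ℝ} (hp : 2 ≤ p) (hM : 0 ≤ M) (hg : IsConvexSmooth p M g)
    (h : MSNState.IsRun p M g z m σ L) (hv : IsMinOn g Set.univ v) (hD : ‖z - v‖ ≤ D)
    (hDR : D ≤ R) {j : ℕ} (hj : j ≤ m) : (σ j).IsNear R v :=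
  ⟨h.A_nonneg hj, h.norm_y_sub_le hp hM hg hv (hD.trans hDR) hj,
    h.norm_u_sub_le hp hM hg hv (hD.trans hDR) hj⟩

namespace MethodParams

/-- The partial executions reached by the main loop. -/
structure IsPartial (p : ℕ) (P : MethodParams n) (f : EucSp n → ℝ) (e : Execution n) : Prop where
  restarts : e.IsRestarts p P.M P.R P.ε f P.x₀
  le : e.J ≤ innerCount p P.M P.R P.ε e.K
  step : ∀ j < e.J, (e.state e.K j).IsStep p P.M (quadReg f (regMu P.R P.ε) P.x₀) (e.L e.K j)
    (e.state e.K (j + 1))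
  -- Conditional, since directly after a restart the test has not been made. It yields `J = 0` when
  -- the test fails.
  test : 0 < e.J → loopTest p P.M P.R P.ε e.K

/-- A partial execution in which nothing has been done. -/
def emptyExecution (P : MethodParams n) : Execution n where
  K := 0
  J := 0
  state _ _ := MSNState.start P.x₀
  L _ _ := 0
  out := P.x₀

theorem isPartial_empty : P.IsPartial p f P.emptyExecution :=
  ⟨⟨rfl, fun _ h => absurd h (Nat.not_lt_zero _), fun _ h => absurd h (Nat.not_lt_zero _),
    fun _ h => absurd h (Nat.not_lt_zero _)⟩, Nat.zero_le _, fun _ h => absurd h (Nat.not_lt_zero _),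
    fun h => absurd h (lt_irrefl 0)⟩

theorem IsPartial.extend {e : Execution n} (h : P.IsPartial p f e) {L : ℝ} {s : MSNState n}
    (ht : loopTest p P.M P.R P.ε e.K) (hJ : e.J < innerCount p P.M P.R P.ε e.K)
    (hs : (e.state e.K e.J).IsStep p P.M (quadReg f (regMu P.R P.ε) P.x₀) L s) :
    P.IsPartial p f (MethodParams.extend e L s) := by
  have hst : ∀ k j, ¬ (k = e.K ∧ j = e.J + 1) →
      (MethodParams.extend e L s).state k j = e.state k j := fun k j hkj => if_neg hkj
  have hst' : (MethodParams.extend e L s).state e.K (e.J + 1) = s := if_pos ⟨rfl, rfl⟩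
  have hL : ∀ k j, ¬ (k = e.K ∧ j = e.J) →
      (MethodParams.extend e L s).L k j = e.L k j := fun k j hkj => if_neg hkj
  have hL' : (MethodParams.extend e L s).L e.K e.J = L := if_pos ⟨rfl, rfl⟩
  refine ⟨⟨?_, h.restarts.test, fun k hk j hj => ?_, fun k hk => ?_⟩, hJ, fun j hj => ?_,
    fun _ => ht⟩
  · rw [hst _ _ (by omega)]
    exact h.restarts.init
  · have hk' : k < e.K := hk
    rw [hst _ _ (by omega), hst _ _ (by omega), hL _ _ (by omega)]
    exact h.restarts.step k hk j hj
  · have hk' : k < e.K := hk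
    rw [hst _ _ (by omega), hst _ _ (by omega)]
    exact h.restarts.next k hk
  · have hj' : j < e.J + 1 := hj
    change ((MethodParams.extend e L s).state e.K j).IsStep p P.M _
      ((MethodParams.extend e L s).L e.K j) ((MethodParams.extend e L s).state e.K (j + 1))
    rcases Nat.lt_succ_iff_lt_or_eq.1 hj' with hlt | rfl
    · rw [hst _ _ (by omega), hst _ _ (by omega), hL _ _ (by omega)]
      exact h.step j hlt
    · rw [hst _ _ (by omega), hst', hL']
      exact hs

theorem IsPartial.restart {e : Execution n} (h : P.IsPartial p f e)
    (ht : loopTest p P.M P.R P.ε e.K) (hJ : e.J = innerCount p P.M P.R P.ε e.K) :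
    P.IsPartial p f (MethodParams.restart e) := by
  have hst : ∀ k j, ¬ (k = e.K + 1 ∧ j = 0) →
      (MethodParams.restart e).state k j = e.state k j := fun k j hkj => if_neg hkj
  have hst' : (MethodParams.restart e).state (e.K + 1) 0 =
      MSNState.start (e.state e.K e.J).y := if_pos ⟨rfl, rfl⟩
  refine ⟨⟨?_, fun k hk => ?_, fun k hk j hj => ?_, fun k hk => ?_⟩, Nat.zero_le _,
    fun j hj => absurd hj (Nat.not_lt_zero _), fun hj => absurd hj (lt_irrefl 0)⟩
  · rw [hst _ _ (by omega)]
    exact h.restarts.init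
  · rcases Nat.lt_succ_iff_lt_or_eq.1 hk with hlt | rfl
    · exact h.restarts.test k hlt
    · exact ht
  · have hk' : k < e.K + 1 := hk
    rw [hst _ _ (by omega), hst _ _ (by omega)]
    rcases Nat.lt_succ_iff_lt_or_eq.1 hk' with hlt | rfl
    · exact h.restarts.step k hlt j hj
    · exact h.step j (hJ ▸ hj)
  · have hk' : k < e.K + 1 := hk
    rw [hst k _ (by omega)]
    rcases Nat.lt_succ_iff_lt_or_eq.1 hk' with hlt | rfl
    · rw [hst _ _ (by omega)]
      exact h.restarts.next k hlt
    · rw [hst', hJ]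

namespace IsAdmissible

variable (h : IsAdmissible p P f xstar v)
include h

theorem isNear_of_isPartial {e : Execution n} (he : P.IsPartial p f e) :
    (e.state e.K e.J).IsNear P.R v := by
  have hrun : MSNState.IsRun p P.M (quadReg f (regMu P.R P.ε) P.x₀) (e.state e.K 0).y e.J
      (e.state e.K) (e.L e.K) := ⟨he.restarts.state_zero le_rfl, he.step⟩
  exact hrun.isNear h.two_le h.M_pos.le h.smooth_reg h.isMinOn_reg
    (he.restarts.norm_sub_le h.two_le h.M_pos h.R_pos h.ε_pos h.smooth h.isMinOn h.dist_le
      h.isMinOn_reg le_rfl) (radius_le h.R_pos _) le_rfl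

/-- The bracket keeps a ratio at least 1 at its lower end and at most 1/2 at its upper end, and each
halving spends one power of 2 in `hm`. With no halvings left, the bracket would be shorter than `hX`
allows. -/
theorem bisect_run {X : ℝ} (hX : ∀ (s : MSNState n) (L L' : ℝ) (w w' : EucSp n), s.IsNear P.R v →
      searchLo p P.M P.R P.ε ≤ L → L < L' →
      s.IsTrial p P.M (quadReg f (regMu P.R P.ε) P.x₀) L w →
      s.IsTrial p P.M (quadReg f (regMu P.R P.ε) P.x₀) L' w' →
      1 ≤ s.stepRatio p P.M L w → s.stepRatio p P.M L' w' ≤ 1 / 2 →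
      searchHi p P.M P.R ≤ X * (L' - L)) {s : MSNState n} (hs : s.IsNear P.R v) (m : ℕ)
    {lo hi : ℝ} (hlo : searchLo p P.M P.R P.ε ≤ lo) (hlh : lo < hi)
    (h1 : ∃ w, s.IsTrial p P.M (quadReg f (regMu P.R P.ε) P.x₀) lo w ∧ 1 ≤ s.stepRatio p P.M lo w)
    (h2 : ∃ w, s.IsTrial p P.M (quadReg f (regMu P.R P.ε) P.x₀) hi w ∧
      s.stepRatio p P.M hi w ≤ 1 / 2)
    (hm : X * (hi - lo) < searchHi p P.M P.R * 2 ^ m) :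
    ∃ s', ((P.bisect p s m lo hi).run (jetOracle p f)).2 = Sum.inr s' ∧
      s.IsStep p P.M (quadReg f (regMu P.R P.ε) P.x₀)
        ((P.bisect p s m lo hi).run (jetOracle p f)).1 s' := by
  induction m generalizing lo hi with
  | zero =>
    obtain ⟨w, hw, hr⟩ := h1
    obtain ⟨w', hw', hr'⟩ := h2
    have := hX s lo hi w w' hs hlo hlh hw hw' hr hr'
    rw [pow_zero, mul_one] at hm
    exact absurd this (not_le.2 hm)
  | succ m ih =>
    have hlo0 := searchLo_pos (p := p) h.M_pos h.R_pos h.ε_pos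
    obtain ⟨ht, hgrad⟩ := h.isTrial_run s (L := (lo + hi) / 2) (by linarith)
    have hm' : X * ((hi - lo) / 2) < searchHi p P.M P.R * 2 ^ m := by
      rw [pow_succ] at hm
      linarith
    rw [MethodParams.bisect, OracleProg.run_bind]
    split_ifs with c1 c2
    · refine ih (by linarith) (by linarith) ⟨_, ht, c1.le⟩ h2 ?_
      have : hi - (lo + hi) / 2 = (hi - lo) / 2 := by ring
      rwa [this]
    · refine ih hlo (by linarith) h1 ⟨_, ht, c2.le⟩ ?_
      have : (lo + hi) / 2 - lo = (hi - lo) / 2 := by ring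
      rwa [this]
    · refine ⟨_, rfl, ?_⟩
      rw [hgrad]
      exact h.isStep_accept ht c1 c2

theorem search_run {X : ℝ} (hX0 : 0 < X)
    (hX : ∀ (s : MSNState n) (L L' : ℝ) (w w' : EucSp n), s.IsNear P.R v →
      searchLo p P.M P.R P.ε ≤ L → L < L' →
      s.IsTrial p P.M (quadReg f (regMu P.R P.ε) P.x₀) L w →
      s.IsTrial p P.M (quadReg f (regMu P.R P.ε) P.x₀) L' w' →
      1 ≤ s.stepRatio p P.M L w → s.stepRatio p P.M L' w' ≤ 1 / 2 →
      searchHi p P.M P.R ≤ X * (L' - L)) {s : MSNState n} (hs : s.IsNear P.R v) {m : ℕ}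
    (hm : X ≤ 2 ^ m) :
    (∃ w, ((P.search p m s).run (jetOracle p f)).2 = Sum.inl w ∧
      s.IsTrial p P.M (quadReg f (regMu P.R P.ε) P.x₀)
        ((P.search p m s).run (jetOracle p f)).1 w ∧ ‖gradient f w‖ ≤ P.ε) ∨
    ∃ s', ((P.search p m s).run (jetOracle p f)).2 = Sum.inr s' ∧
      s.IsStep p P.M (quadReg f (regMu P.R P.ε) P.x₀)
        ((P.search p m s).run (jetOracle p f)).1 s' := by
  have hlo0 := searchLo_pos (p := p) h.M_pos h.R_pos h.ε_pos
  have hhi0 := searchHi_pos (p := p) h.M_pos h.R_pos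
  obtain ⟨ht, hgrad⟩ := h.isTrial_run s hlo0
  rw [MethodParams.search, OracleProg.run_bind]
  split_ifs with c
  · rw [hgrad] at c
    exact Or.inl ⟨_, rfl, ht, c⟩
  · right
    have hr : 1 < s.stepRatio p P.M (searchLo p P.M P.R P.ε)
        ((P.trial p s (searchLo p P.M P.R P.ε)).run (jetOracle p f)).1 := by
      by_contra hcon
      refine c ?_
      rw [hgrad]
      exact MSNState.norm_gradient_searchLo_le h.two_le h.M_pos h.R_pos h.ε_pos h.smooth h.isMinOn
        h.dist_le h.isMinOn_reg hs ht (not_lt.1 hcon)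
    obtain ⟨w, hw⟩ := MSNState.exists_isTrial h.two_le h.M_pos h.smooth_reg h.isMinOn_reg s hhi0
    have hr' := MSNState.stepRatio_searchHi_le h.two_le h.M_pos h.R_pos h.smooth_reg
      h.isMinOn_reg hs hw
    -- If the ends coincided, the computed trial point would have both ratio above 1 and ratio at
    -- most 1/2.
    have hlt : searchLo p P.M P.R P.ε < searchHi p P.M P.R := by
      refine lt_of_le_of_ne (searchLo_le_searchHi h.M_pos h.R_pos h.ε_pos) fun heq => ?_
      obtain ⟨ht', -⟩ := h.isTrial_run s hhi0
      have := MSNState.stepRatio_searchHi_le h.two_le h.M_pos h.R_pos h.smooth_reg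
        h.isMinOn_reg hs ht'
      rw [← heq] at this
      linarith
    refine h.bisect_run hX hs m le_rfl hlt ⟨_, ht, hr.le⟩ ⟨w, hw, hr'⟩ ?_
    calc X * (searchHi p P.M P.R - searchLo p P.M P.R P.ε) < X * searchHi p P.M P.R := by
          gcongr
          linarith
      _ ≤ 2 ^ m * searchHi p P.M P.R := by gcongr
      _ = _ := mul_comm _ _

/-- The fuel is compared with the number of passes already made: `N_k` iterations and one restart
pass for each finished `k`, plus `J`. The final 1 in `hfuel` pays for the exit pass. -/
theorem loop_run {X : ℝ} (hX0 : 0 < X)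
    (hX : ∀ (s : MSNState n) (L L' : ℝ) (w w' : EucSp n), s.IsNear P.R v →
      searchLo p P.M P.R P.ε ≤ L → L < L' →
      s.IsTrial p P.M (quadReg f (regMu P.R P.ε) P.x₀) L w →
      s.IsTrial p P.M (quadReg f (regMu P.R P.ε) P.x₀) L' w' →
      1 ≤ s.stepRatio p P.M L w → s.stepRatio p P.M L' w' ≤ 1 / 2 →
      searchHi p P.M P.R ≤ X * (L' - L)) {m : ℕ} (hm : X ≤ 2 ^ m) {Kmax : ℕ}
    (hKmax : ¬ loopTest p P.M P.R P.ε Kmax) (fuel : ℕ) {e : Execution n} (he : P.IsPartial p f e)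
    (hfuel : ∑ k ∈ Finset.range Kmax, (innerCount p P.M P.R P.ε k + 1) + 1 ≤
      fuel + (∑ k ∈ Finset.range e.K, (innerCount p P.M P.R P.ε k + 1) + e.J)) :
    ((P.loop p m fuel e).run (jetOracle p f)).IsComplete p P.M P.R P.ε f P.x₀ ∨
      ((P.loop p m fuel e).run (jetOracle p f)).IsStoppedEarly p P.M P.R P.ε f P.x₀ := by
  induction fuel generalizing e with
  | zero =>
    exfalso
    have hle : e.K ≤ Kmax := by
      by_contra! hlt
      exact hKmax (he.restarts.test _ hlt)
    -- In either case the passes made number at most the full sum up to `Kmax`, one short of what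
    -- `hfuel` demands.
    rcases hle.eq_or_lt with heq | hlt
    · have hJ : e.J = 0 := by
        by_contra hJ
        exact hKmax (heq ▸ he.test (Nat.pos_of_ne_zero hJ))
      rw [heq, hJ] at hfuel
      omega
    · have h1 : ∑ k ∈ Finset.range (e.K + 1), (innerCount p P.M P.R P.ε k + 1) ≤
          ∑ k ∈ Finset.range Kmax, (innerCount p P.M P.R P.ε k + 1) :=
        Finset.sum_le_sum_of_subset (Finset.range_mono hlt)
      rw [Finset.sum_range_succ] at h1
      have := he.le
      omega
  | succ fuel ih =>
    rw [MethodParams.loop]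
    split_ifs with c1 c2
    · rw [OracleProg.run_bind]
      rcases h.search_run hX0 hX (h.isNear_of_isPartial he) hm with
        ⟨w, hw, ht, hsmall⟩ | ⟨s', hs', hstep⟩
      · rw [hw]
        right
        refine ⟨⟨he.restarts.init, he.restarts.test, fun k hk j hj => ?_, he.restarts.next⟩, c1, c2,
          fun j hj => ?_, ?_, hsmall⟩
        · have hk' : k < e.K := hk
          have hL : (stopAt e ((P.search p m (e.state e.K e.J)).run (jetOracle p f)).1 w).L k j =
              e.L k j := if_neg (by omega)
          have := he.restarts.step k hk j hj
          rwa [← hL] at this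
        · have hj' : j < e.J := hj
          have hL : (stopAt e ((P.search p m (e.state e.K e.J)).run (jetOracle p f)).1 w).L e.K j =
              e.L e.K j := if_neg (by omega)
          have := he.step j hj'
          rwa [← hL] at this
        · have hL : (stopAt e ((P.search p m (e.state e.K e.J)).run (jetOracle p f)).1 w).L e.K e.J
              = ((P.search p m (e.state e.K e.J)).run (jetOracle p f)).1 := if_pos ⟨rfl, rfl⟩
          rwa [← hL] at ht
      · rw [hs']
        refine ih (he.extend c1 c2 hstep) ?_
        change _ ≤ fuel + (∑ k ∈ Finset.range e.K, (innerCount p P.M P.R P.ε k + 1) + (e.J + 1))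
        omega
    · have hJ : e.J = innerCount p P.M P.R P.ε e.K := le_antisymm he.le (not_lt.1 c2)
      refine ih (he.restart c1 hJ) ?_
      change _ ≤ fuel + (∑ k ∈ Finset.range (e.K + 1), (innerCount p P.M P.R P.ε k + 1) + 0)
      rw [Finset.sum_range_succ]
      omega
    · left
      refine ⟨⟨he.restarts.init, he.restarts.test, he.restarts.step, he.restarts.next⟩, ?_, c1, ?_⟩
      · by_contra hJ
        exact c1 (he.test (Nat.pos_of_ne_zero hJ))
      · obtain ⟨w, hw⟩ := exists_isTensorStep h.two_le h.smooth_reg h.M_pos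
          (b := quadReg f (regMu P.R P.ε) P.x₀ v) (fun w => h.isMinOn_reg (Set.mem_univ w))
          (e.state e.K 0).y
        have := isTensorStep_jetStep (M := P.M) (μ := regMu P.R P.ε) (x₀ := P.x₀) (L := 0)
          (x := (e.state e.K 0).y) h.two_le h.smooth.contDiff ⟨w, by rwa [quadReg_zero]⟩
        rw [quadReg_zero] at this
        exact this

end IsAdmissible

end MethodParams

theorem exists_not_loopTest (hp : 2 ≤ p) {M R ε : ℝ} (hM : 0 < M) (hR : 0 < R) (hε : 0 < ε) :
    ∃ K, ¬ loopTest p M R ε K ∧ ∀ k < K, loopTest p M R ε k := by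
  classical
  have hex : ∃ K, ¬ loopTest p M R ε K := by
    obtain ⟨K, hK⟩ := pow_unbounded_of_one_lt (logArg p M R ε) (by norm_num : (1 : ℝ) < 4)
    exact ⟨K, fun hcon => absurd ((loopTest_iff hp hM hR hε K).1 hcon) (not_le.2 hK)⟩
  exact ⟨Nat.find hex, Nat.find_spec hex, fun k hk => not_not.1 (Nat.find_min hex hk)⟩

theorem one_le_innerCount {M R ε : ℝ} (k : ℕ) : 1 ≤ innerCount p M R ε k := le_max_right _ _

/-- The number of bisection steps is logarithmic. -/
theorem exists_halvings {C : ℝ} (hC : 1 ≤ C) : ∃ C' : ℝ, 0 < C' ∧ ∀ q : ℝ, 0 < q →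
    ∃ m : ℕ, C * (2 + q) ^ 3 ≤ 2 ^ m ∧ (m : ℝ) + 1 ≤ C' * Real.log (2 + q) := by
  have hlog2 : 0 < Real.log 2 := Real.log_pos (by norm_num)
  have hlogC : 0 ≤ Real.log C := Real.log_nonneg hC
  refine ⟨(Real.log C / Real.log 2 + 5) / Real.log 2, by positivity, fun q hq => ?_⟩
  set X := C * (2 + q) ^ 3 with hX
  have hX1 : 1 ≤ X := one_le_mul_of_one_le_of_one_le hC (one_le_pow₀ (by linarith))
  have hX0 : 0 < X := by linarith
  have hlogq : Real.log 2 ≤ Real.log (2 + q) := Real.log_le_log (by norm_num) (by linarith)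
  have hlogX : Real.log X = Real.log C + 3 * Real.log (2 + q) := by
    rw [hX, Real.log_mul (by positivity) (by positivity), Real.log_pow]
    norm_num
  refine ⟨⌈Real.log X / Real.log 2⌉₊, ?_, ?_⟩
  · rw [← Real.rpow_natCast, ← Real.log_le_log_iff hX0 (by positivity), Real.log_rpow (by norm_num),
      ← div_le_iff₀ hlog2]
    exact Nat.le_ceil _
  · have h1 := Nat.ceil_lt_add_one (div_nonneg (Real.log_nonneg hX1) hlog2.le)
    have h2 : Real.log X / Real.log 2 + 2 ≤
        (Real.log C / Real.log 2 + 5) / Real.log 2 * Real.log (2 + q) := by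
      rw [hlogX, div_add' _ _ _ hlog2.ne', div_mul_eq_mul_div, div_le_div_iff_of_pos_right hlog2]
      have h3 : Real.log C ≤ Real.log C / Real.log 2 * Real.log (2 + q) := by
        rw [div_mul_eq_mul_div, le_div_iff₀ hlog2]
        gcongr
      linarith
    linarith

end Correctness

end
-- Assembly of the constants
theorem mainTheorem2 (p : ℕ) (hp : 2 ≤ p) :
    ∃ C : ℝ, 0 < C ∧
      ∀ (n : ℕ) (M R ε : ℝ), 0 < M → 0 < R → 0 < ε → ∀ x₀ : EucSp n,
        (∀ (f : EucSp n → ℝ) (xstar : EucSp n), IsConvexSmooth p M f →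
          IsMinOn f Set.univ xstar → ‖x₀ - xstar‖ ≤ R →
          ∀ e : Execution n, e.IsComplete p M R ε f x₀ →
            ‖gradient f e.out‖ ≤ ε ∧ (e.iterations p M R ε : ℝ) ≤ C * iterBound p M R ε) ∧
        (∃ m : OracleMethod n p (Execution n),
          ∀ (f : EucSp n → ℝ) (xstar : EucSp n), IsConvexSmooth p M f →
            IsMinOn f Set.univ xstar → ‖x₀ - xstar‖ ≤ R →
            ∃ (t : ℕ) (e : Execution n),
              m.HaltsWithin (jetOracle p f) t e ∧
              (e.IsComplete p M R ε f x₀ ∨ e.IsStoppedEarly p M R ε f x₀) ∧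
              (t : ℝ) ≤ C * Real.log (2 + M * R ^ p / ε) * (1 + iterBound p M R ε)) := by
  obtain ⟨C₁, hC₁, hiter⟩ := exists_sum_innerCount_le hp
  obtain ⟨C₂, hC₂, hbracket⟩ := MSNState.exists_searchHi_le hp
  obtain ⟨C₃, hC₃, hhalv⟩ := exists_halvings (le_max_right C₂ 1)
  refine ⟨C₁ + 2 * C₃ * (2 * C₁ + 1), by positivity, fun n M R ε hM hR hε x₀ => ⟨?_, ?_⟩⟩
  · intro f xstar hf hs hx e he
    refine ⟨he.norm_gradient_le hp hM hR hε hf hs hx, ?_⟩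
    rw [Execution.iterations, he.noExtra, add_zero]
    have h1 := hiter M R ε hM hR hε e.K he.restarts.test
    have hB := iterBound_nonneg (p := p) hM hR hε
    have h2 : 0 ≤ 2 * C₃ * (2 * C₁ + 1) * iterBound p M R ε := by positivity
    linarith
  · have hq : 0 < M * R ^ p / ε := by positivity
    obtain ⟨m, hm, hmC⟩ := hhalv _ hq
    obtain ⟨Kmax, hKmax, hK⟩ := exists_not_loopTest hp hM hR hε
    have hsum := hiter M R ε hM hR hε Kmax hK
    set T := ∑ k ∈ Finset.range Kmax, (innerCount p M R ε k + 1) with hT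
    let P : MethodParams n := ⟨M, R, ε, x₀⟩
    -- The numbers `m` and `T` were fixed from `p, M, R, ε` alone, so the method does not depend on
    -- `f`.
    refine ⟨(P.loop p m (T + 1) P.emptyExecution).toMethod, fun f xstar hf hs hx => ?_⟩
    obtain ⟨v, hv⟩ := exists_isMinOn_quadReg (regMu_pos hR hε) (hf.differentiable hp) hs x₀
    have h : MethodParams.IsAdmissible p P f xstar v := ⟨hp, hM, hR, hε, hf, hs, hx, hv⟩
    refine ⟨_, _, OracleProg.haltsWithin_toMethod (jetOracle p f) _, ?_, ?_⟩
    · refine h.loop_run (X := C₂ * (2 + M * R ^ p / ε) ^ 3) (by positivity)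
        (fun s L L' w w' hsn hL hLL hw hw' hr hr' =>
          hbracket n M R ε hM hR hε _ v s L L' w w' h.smooth_reg hv hsn hL hLL hw hw' hr hr')
        (le_trans (by gcongr; exact le_max_left _ _) hm) hKmax (T + 1)
        MethodParams.isPartial_empty ?_
      exact Nat.le_add_right _ _
    · have hcost := P.cost_loop_le p (jetOracle p f) m (T + 1) P.emptyExecution
      -- The extra pass per restart is absorbed because every `N_k` is at least 1.
      have hT2 : T ≤ 2 * ∑ k ∈ Finset.range Kmax, innerCount p M R ε k := by
        rw [hT, Finset.mul_sum]
        refine Finset.sum_le_sum fun k _ => ?_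
        have := one_le_innerCount (p := p) (M := M) (R := R) (ε := ε) k
        omega
      have hT3 : (T : ℝ) ≤ 2 * (C₁ * iterBound p M R ε) := by
        have : (T : ℝ) ≤ 2 * ((∑ k ∈ Finset.range Kmax, innerCount p M R ε k : ℕ) : ℝ) := by
          exact_mod_cast hT2
        linarith
      have hB := iterBound_nonneg (p := p) hM hR hε
      have hlog : 0 < Real.log (2 + M * R ^ p / ε) := Real.log_pos (by linarith)
      calc _ ≤ (((T + 1) * (2 * (m + 1)) : ℕ) : ℝ) := by exact_mod_cast hcost
        _ = ((T : ℝ) + 1) * (2 * ((m : ℝ) + 1)) := by push_cast; ring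
        _ ≤ (2 * (C₁ * iterBound p M R ε) + 1) *
            (2 * (C₃ * Real.log (2 + M * R ^ p / ε))) := by gcongr
        _ = 2 * C₃ * (2 * (C₁ * iterBound p M R ε) + 1) * Real.log (2 + M * R ^ p / ε) := by ring
        _ ≤ (C₁ + 2 * C₃ * (2 * C₁ + 1)) * (1 + iterBound p M R ε) *
            Real.log (2 + M * R ^ p / ε) := by
          refine mul_le_mul_of_nonneg_right ?_ hlog.le
          nlinarith [mul_nonneg hC₁.le hB, mul_nonneg hC₃.le hB, mul_nonneg hC₃.le hC₁.le]
        _ = _ := by ring
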